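/- **Setting.** Let $H$ be a finite-dimensional quasi-Hopf algebra over a field $k$: a unital algebra with unital algebra maps $\Delta:H\to H\otimes H$, $\varepsilon:H\to k$, an invertible $\phi=\sum X\otimes Y\otimes Z\in H^{\otimes 3}$ with inverse $\phi^{-1}=\sum\bar X\otimes\bar Y\otimes\bar Z$, a bijective unital anti-multiplicative linear map $S:H\to H$ and $\alpha,\beta\in H$, such that for all $a\in H$ (summation suppressed, $\Delta(a)=a_{(1)}\otimes a_{(2)}$) $$(\mathrm{id}\otimes\Delta)(\Delta(a))\,\phi=\phi\,(\Delta\otimes\mathrm{id})(\Delta(a)),$$ $$(\mathrm{id}\otimes\mathrm{id}\otimes\Delta)(\phi)\,(\Delta\otimes\mathrm{id}\otimes\mathrm{id})(\phi)=(1\otimes\phi)\,(\mathrm{id}\otimes\Delta\otimes\mathrm{id})(\phi)\,(\phi\otimes1),$$ $$(\varepsilon\otimes\mathrm{id})\Delta=\mathrm{id}=(\mathrm{id}\otimes\varepsilon)\Delta,\qquad(\mathrm{id}\otimes\varepsilon\otimes\mathrm{id})(\phi)=1\otimes1,$$ $$S(a_{(1)})\alpha a_{(2)}=\varepsilon(a)\alpha,\qquad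 a_{(1)}\beta S(a_{(2)})=\varepsilon(a)\beta,\qquad X\beta S(Y)\alpha Z=1=S(\bar X)\alpha\bar Y\beta S(\bar Z).$$ Write $\psi^{21}$ for the flip of $\psi\in H\otimes H$ and $\Delta^{op}(a)=\Delta(a)^{21}$. Put $$q_R=X\otimes S^{-1}(\alpha Z)Y,\qquad p_R=\bar X\otimes\bar Y\beta S(\bar Z),$$ $$\gamma=(S(U')\otimes S(T'))(\alpha\otimes\alpha)(V'\otimes W'),\quad\text{where } T'\otimes U'\otimes V'\otimes W'=(1\otimes\phi^{-1})(\mathrm{id}\otimes\mathrm{id}\otimes\Delta)(\phi),$$ $$f=(S\otimes S)(\Delta^{op}(\bar X))\,\gamma\,\Delta(\bar Y\beta S(\bar Z)),\qquad h=(S^{-1}\otimes S^{-1})(f^{21})$$ ($f$ is invertible by a theorem of Drinfeld), and $$U=f^{-1}(S\otimes S)(q_R^{21}),\qquad V=(S^{-1}\otimes S^{-1})(p_R^{21})\,h,\qquad\bar\Delta(a)=V\Delta(a)U.$$ Let $\hat H$ be the dual space of $H$, with the $H$-bimodule structure $(a\cdot\psi\cdot b)(m)=\psi(S^{-1}(a)\,m\,S(b))$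 and the coaction $\rho:\hat H\to\hat H\otimes H\cong\mathrm{Hom}_k(H,H)$, $\rho(\psi)(m)=(\mathrm{id}\otimes\psi)(\bar\Delta(m))$. Writing $\rho(\psi)=\psi_{(0)}\otimes\psi_{(1)}$ and $q_R=q^1\otimes q^2$, put $$E(\psi)=q^1\cdot\psi_{(0)}\cdot\beta S(q^2\psi_{(1)}).$$ The elements of $E(\hat H)$ are the *left cointegrals* on $H$. A *right integral* is an $r\in H$ with $ra=\varepsilon(a)r$ for all $a\in H$. The *modulus* of $H$ is the algebra map $\mu=\varepsilon\circ\theta_\omega^{-1}:H\to k$, where $\omega$ is any nondegenerate functional on $H$ and $\theta_\omega$ is the algebra automorphism of $H$ with $\omega(ab)=\omega(b\,\theta_\omega(a))$ for all $a,b\in H$ (it does not depend on $\omega$). Let $\lambda$ be a left cointegral and $r$ a right integral with $\lambda(r)=1$. The *comodulus* of $H$ is $u=(\lambda\otimes\mathrm{id})(V\Delta(r)U)$. Finally put $$v=(\mathrm{id}\otimes\lambda\circ S)(V\Delta(r)U),\qquad S_\mu(a)=S(a)\leftharpoonup\mu,\quad\text{where } b\leftharpoonup\mu=\mu(b_{(1)})\,b_{(2)}.$$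 **Proposition (Radford's formula).** The element $u$ is invertible, the linear map $S_\mu:H\to H$ is bijective, and $$u^{-1}=S^2(v)=S_\mu^{-2}(v),\qquad u^{-1}\,a\,u=S^2\big(S_\mu^2(a)\big)\quad\text{for all }a\in H.$$ -/

import Mathlib

open scoped TensorProduct

noncomputable section

/-- A quasi-Hopf algebra structure on the `k`-algebra `H`, with bijective antipode `S`.
Threefold and fourfold tensor powers are bracketed to the right, `H ⊗ (H ⊗ H)` and
`H ⊗ (H ⊗ (H ⊗ H))`; only the canonical identifications `TensorProduct.assoc` are inserted.
Writing `φ = X ⊗ Y ⊗ Z` and `φ⁻¹ = X' ⊗ Y' ⊗ Z'` (summation suppressed), the axioms are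
those displayed at the fields. -/
structure QuasiHopfAlgebra (k H : Type*) [Field k] [Ring H] [Algebra k H] where
  /-- the coproduct `Δ`, a unital algebra morphism -/
  Δ : H →ₐ[k] H ⊗[k] H
  /-- the counit `ε`, a unital algebra morphism -/
  ε : H →ₐ[k] k
  /-- the reassociator `φ`, an invertible element -/
  φ : (H ⊗[k] (H ⊗[k] H))ˣ
  /-- `(id ⊗ Δ)(Δ(a)) φ = φ (Δ ⊗ id)(Δ(a))` -/
  quasi_coassoc : ∀ a : H,
    Algebra.TensorProduct.map (AlgHom.id k H) Δ (Δ a) * (φ : H ⊗[k] (H ⊗[k] H)) =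
      (φ : H ⊗[k] (H ⊗[k] H)) *
        TensorProduct.assoc k H H H (Algebra.TensorProduct.map Δ (AlgHom.id k H) (Δ a))
  /-- `(id ⊗ id ⊗ Δ)(φ) (Δ ⊗ id ⊗ id)(φ) = (1 ⊗ φ) (id ⊗ Δ ⊗ id)(φ) (φ ⊗ 1)` -/
  pentagon :
    Algebra.TensorProduct.map (AlgHom.id k H)
        (Algebra.TensorProduct.map (AlgHom.id k H) Δ) (φ : H ⊗[k] (H ⊗[k] H)) *
      TensorProduct.assoc k H H (H ⊗[k] H)
        (Algebra.TensorProduct.map Δ (AlgHom.id k (H ⊗[k] H)) (φ : H ⊗[k] (H ⊗[k] H))) =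
    ((1 : H) ⊗ₜ[k] (φ : H ⊗[k] (H ⊗[k] H))) *
      TensorProduct.map LinearMap.id
        ((TensorProduct.assoc k H H H).toLinearMap ∘ₗ
          TensorProduct.map Δ.toLinearMap LinearMap.id) (φ : H ⊗[k] (H ⊗[k] H)) *
      TensorProduct.map LinearMap.id (TensorProduct.assoc k H H H).toLinearMap
        (TensorProduct.assoc k H (H ⊗[k] H) H ((φ : H ⊗[k] (H ⊗[k] H)) ⊗ₜ[k] (1 : H)))
  /-- `(ε ⊗ id) ∘ Δ = id` -/
  counit_left : ∀ a : H,
    TensorProduct.lid k H (TensorProduct.map ε.toLinearMap LinearMap.id (Δ a)) = a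
  /-- `(id ⊗ ε) ∘ Δ = id` -/
  counit_right : ∀ a : H,
    TensorProduct.rid k H (TensorProduct.map LinearMap.id ε.toLinearMap (Δ a)) = a
  /-- `(id ⊗ ε ⊗ id)(φ) = 1 ⊗ 1` -/
  counit_reassociator :
    TensorProduct.map LinearMap.id
      ((TensorProduct.lid k H).toLinearMap ∘ₗ TensorProduct.map ε.toLinearMap LinearMap.id)
      (φ : H ⊗[k] (H ⊗[k] H)) = (1 : H) ⊗ₜ[k] (1 : H)
  /-- the antipode `S`, a bijective linear map -/
  S : H ≃ₗ[k] H
  S_one : S 1 = 1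
  S_mul : ∀ a b : H, S (a * b) = S b * S a
  α : H
  β : H
  /-- `S(a₁) α a₂ = ε(a) α` -/
  antipode_left : ∀ a : H,
    LinearMap.mul' k H
      (TensorProduct.map (LinearMap.mulRight k α ∘ₗ S.toLinearMap) LinearMap.id (Δ a)) = ε a • α
  /-- `a₁ β S(a₂) = ε(a) β` -/
  antipode_right : ∀ a : H,
    LinearMap.mul' k H
      (TensorProduct.map (LinearMap.mulRight k β) S.toLinearMap (Δ a)) = ε a • β
  /-- `X β S(Y) α Z = 1` -/
  antipode_reassociator :
    LinearMap.mul' k H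
      (TensorProduct.map (LinearMap.mulRight k β)
        (LinearMap.mul' k H ∘ₗ
          TensorProduct.map (LinearMap.mulRight k α ∘ₗ S.toLinearMap) LinearMap.id)
        (φ : H ⊗[k] (H ⊗[k] H))) = 1
  /-- `S(X') α Y' β S(Z') = 1` -/
  antipode_reassociator_inv :
    LinearMap.mul' k H
      (TensorProduct.map (LinearMap.mulRight k α ∘ₗ S.toLinearMap)
        (LinearMap.mul' k H ∘ₗ TensorProduct.map (LinearMap.mulRight k β) S.toLinearMap)
        ((φ⁻¹ : (H ⊗[k] (H ⊗[k] H))ˣ) : H ⊗[k] (H ⊗[k] H))) = 1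

namespace QuasiHopfAlgebra

variable {k H : Type*} [Field k] [Ring H] [Algebra k H] (Q : QuasiHopfAlgebra k H)

/-- `φ⁻¹` as an element of `H ⊗ H ⊗ H`. -/
def φinv : H ⊗[k] (H ⊗[k] H) := ((Q.φ⁻¹ : (H ⊗[k] (H ⊗[k] H))ˣ) : H ⊗[k] (H ⊗[k] H))

/-- `S ⊗ S` on `H ⊗ H`. -/
def SS : H ⊗[k] H →ₗ[k] H ⊗[k] H := TensorProduct.map Q.S.toLinearMap Q.S.toLinearMap

/-- `S⁻¹ ⊗ S⁻¹` on `H ⊗ H`. -/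
def SSinv : H ⊗[k] H →ₗ[k] H ⊗[k] H :=
  TensorProduct.map Q.S.symm.toLinearMap Q.S.symm.toLinearMap

/-- The flip `x ⊗ y ↦ y ⊗ x`, that is `ψ ↦ ψ²¹`. -/
def flip : H ⊗[k] H →ₗ[k] H ⊗[k] H := (TensorProduct.comm k H H).toLinearMap

/-- `γ = (S(U) ⊗ S(T)) (α ⊗ α) (V ⊗ W)`, where
`T ⊗ U ⊗ V ⊗ W = (1 ⊗ φ⁻¹) (id ⊗ id ⊗ Δ)(φ)`. -/
def γ : H ⊗[k] H :=
  LinearMap.mul' k (H ⊗[k] H)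
    (TensorProduct.map
      (LinearMap.mulRight k (Q.α ⊗ₜ[k] Q.α) ∘ₗ Q.SS ∘ₗ flip) LinearMap.id
      ((TensorProduct.assoc k H H (H ⊗[k] H)).symm
        (((1 : H) ⊗ₜ[k] Q.φinv) *
          Algebra.TensorProduct.map (AlgHom.id k H)
            (Algebra.TensorProduct.map (AlgHom.id k H) Q.Δ)
            (Q.φ : H ⊗[k] (H ⊗[k] H)))))

/-- `p_R = X' ⊗ Y' β S(Z')`. -/
def pR : H ⊗[k] H :=
  TensorProduct.map LinearMap.id
    (LinearMap.mul' k H ∘ₗ TensorProduct.map (LinearMap.mulRight k Q.β) Q.S.toLinearMap) Q.φinv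

/-- `q_R = X ⊗ S⁻¹(α Z) Y`. -/
def qR : H ⊗[k] H :=
  TensorProduct.map LinearMap.id
    (LinearMap.mul' k H ∘ₗ
      TensorProduct.map (Q.S.symm.toLinearMap ∘ₗ LinearMap.mulLeft k Q.α) LinearMap.id ∘ₗ flip)
    (Q.φ : H ⊗[k] (H ⊗[k] H))

/-- The twist `f = (S ⊗ S)(Δᵒᵖ(X')) γ Δ(Y' β S(Z'))`. -/
def f : H ⊗[k] H :=
  LinearMap.mul' k (H ⊗[k] H)
    (TensorProduct.map
      (LinearMap.mulRight k Q.γ ∘ₗ Q.SS ∘ₗ flip ∘ₗ Q.Δ.toLinearMap)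
      (Q.Δ.toLinearMap ∘ₗ LinearMap.mul' k H ∘ₗ
        TensorProduct.map (LinearMap.mulRight k Q.β) Q.S.toLinearMap)
      Q.φinv)

/-- `h = (S⁻¹ ⊗ S⁻¹)(f²¹)`. -/
def h : H ⊗[k] H := Q.SSinv (flip Q.f)

/-- `U = f⁻¹ (S ⊗ S)(q_R²¹)`. The inverse is taken in the ring `H ⊗ H`, where `f` is
invertible for every quasi-Hopf algebra. -/
def U : H ⊗[k] H := Ring.inverse Q.f * Q.SS (flip Q.qR)

/-- `V = (S⁻¹ ⊗ S⁻¹)(p_R²¹) h`. -/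
def V : H ⊗[k] H := Q.SSinv (flip Q.pR) * Q.h

/-- The deformed coproduct `Δ'(a) = V Δ(a) U` (written `Δ` with a bar in the literature). -/
def Δbar : H →ₗ[k] H ⊗[k] H :=
  LinearMap.mulLeft k Q.V ∘ₗ LinearMap.mulRight k Q.U ∘ₗ Q.Δ.toLinearMap

section Bimodule

variable {M : Type*} [AddCommGroup M] [Module k M]

/-- For a space `M` with left `H`-action `L`, right `H`-action `R` and right `H`-coaction
`ρ(m) = m₀ ⊗ m₁`, the map `E(m) = q¹ · m₀ · β S(q² m₁)` with `q¹ ⊗ q² = q_R`, whose image is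
by definition the space of coinvariants of a quasi-Hopf bimodule `M`. -/
def E (L R : H →ₗ[k] M →ₗ[k] M) (ρ : M →ₗ[k] M ⊗[k] H) : M →ₗ[k] M :=
  TensorProduct.lift (R.flip.compl₂ (LinearMap.mulLeft k Q.β ∘ₗ Q.S.toLinearMap)) ∘ₗ
    TensorProduct.homTensorHomMap (RingHom.id k) M H M H
      (TensorProduct.map L (LinearMap.mul k H) Q.qR) ∘ₗ ρ

end Bimodule

/-- The left action `(a · ψ)(m) = ψ(S⁻¹(a) m)` on the dual of `H`. -/
def dualLeft : H →ₗ[k] Module.Dual k H →ₗ[k] Module.Dual k H :=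
  Module.Dual.transpose ∘ₗ LinearMap.mul k H ∘ₗ Q.S.symm.toLinearMap

/-- The right action `(ψ · b)(m) = ψ(m S(b))` on the dual of `H`. -/
def dualRight : H →ₗ[k] Module.Dual k H →ₗ[k] Module.Dual k H :=
  Module.Dual.transpose ∘ₗ (LinearMap.mul k H).flip ∘ₗ Q.S.toLinearMap

/-- The coaction on the dual of `H`: under the identification of `Ĥ ⊗ H` with `Hom(H, H)` it
sends `ψ` to `m ↦ (id ⊗ ψ)(Δ'(m))`. -/
def dualCoaction [FiniteDimensional k H] :
    Module.Dual k H →ₗ[k] Module.Dual k H ⊗[k] H :=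
  (dualTensorHomEquiv k H H).symm.toLinearMap ∘ₗ
    LinearMap.lcomp k H Q.Δbar ∘ₗ
      LinearMap.llcomp k (H ⊗[k] H) (H ⊗[k] k) H (TensorProduct.rid k H).toLinearMap ∘ₗ
        LinearMap.lTensorHom H

/-- The space of left cointegrals on `H`: the coinvariants of the dual of `H`. -/
def leftCointegrals [FiniteDimensional k H] : Submodule k (Module.Dual k H) :=
  LinearMap.range (Q.E Q.dualLeft Q.dualRight Q.dualCoaction)

/-- The space of right integrals in `H`. -/
def rightIntegrals : Submodule k H where
  carrier := {r | ∀ a : H, r * a = Q.ε a • r}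
  add_mem' := fun hx hy a => by rw [add_mul, hx a, hy a, smul_add]
  zero_mem' := fun a => by rw [zero_mul, smul_zero]
  smul_mem' := fun c x hx a => by rw [smul_mul_assoc, hx a, smul_comm]

/-- `μ` is the modulus of `H`: `μ = ε ∘ θ⁻¹`, where `θ` is the modular (Nakayama) automorphism
of any nondegenerate functional `ω` on `H`, that is `ω(ab) = ω(b θ(a))`. (A finite dimensional
quasi-Hopf algebra has a nondegenerate functional, `θ` exists for each of them and is unique up
to inner automorphisms, so that `μ` exists and is unique.) -/
def IsModulus (μ : H →ₐ[k] k) : Prop :=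
  ∀ (ω : Module.Dual k H) (θ : H ≃ₐ[k] H),
    (LinearMap.compr₂ (LinearMap.mul k H) ω).Nondegenerate →
    (∀ a b : H, ω (a * b) = ω (b * θ a)) →
    ∀ a : H, μ a = Q.ε (θ.symm a)

/-- `a ↼ ψ = ψ(a₁) a₂`. -/
def hitRight (ψ : Module.Dual k H) : H →ₗ[k] H :=
  (TensorProduct.lid k H).toLinearMap ∘ₗ TensorProduct.map ψ LinearMap.id ∘ₗ Q.Δ.toLinearMap

/-- `S_μ(a) = S(a) ↼ μ`. -/
def Smod (μ : H →ₐ[k] k) : H →ₗ[k] H := Q.hitRight μ.toLinearMap ∘ₗ Q.S.toLinearMap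

/-- `u = (λ ⊗ id)(V Δ(r) U)`; this is the comodulus of `H` when `λ` is a left cointegral and `r`
a right integral with `λ(r) = 1`. -/
def comodulus (lam : Module.Dual k H) (r : H) : H :=
  TensorProduct.lid k H (TensorProduct.map lam LinearMap.id (Q.Δbar r))

/-- `v = (id ⊗ λ ∘ S)(V Δ(r) U)`. -/
def comodulusAux (lam : Module.Dual k H) (r : H) : H :=
  TensorProduct.rid k H
    (TensorProduct.map LinearMap.id (lam ∘ₗ Q.S.toLinearMap) (Q.Δbar r))

end QuasiHopfAlgebra

end

/-!
Let `D = V Δ(r) U`. Everything follows from two facts about `D` and a left cointegral `λ`: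

* `D (1 ⊗ S(a)) = D (a ⊗ 1)` for all `a` (`Δbar_mul_inR`);
* `(id ⊗ λ)(D) = λ(r) 1` (`sliceR_Δbar`).

If `λ(r) = 1`, they say that `D¹ λ(D² S(a)) = a`, so `D` is the tensor of dual bases for the pairing
`(x, a) ↦ λ(x S(a))`. Hence `λ` is nondegenerate and has a Nakayama automorphism `θ`. The comodulus
`u = λ(D¹) D²` is the element with `λ(S⁻¹(z)) = λ(u z)`, which makes it invertible and gives
`v = S⁻²(u⁻¹)`; comparing the Nakayama automorphisms of the two sides gives
`u⁻¹ b u = S θ S⁻¹ θ(b)` (`comodulus_conj`). The right integrals are spanned by `r`, so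
`a r = μ(S(a)) r`, and with the rule `(1 ⊗ S⁻¹(a)) V = (a₂ ⊗ 1) V Δ(S⁻¹(a₁))` this turns
`(id ⊗ λ)((1 ⊗ S⁻¹(a)) D)` into `S_μ = S⁻¹ θ` (`hitRight_modulus`). The formulas for `u⁻¹` and for
the conjugation by `u` are then immediate.

The first fact is the rule `Δ(S(a₁)) U (a₂ ⊗ 1) = U (1 ⊗ S(a))`, a consequence of
`f Δ(S(a)) = (S ⊗ S)(Δᵒᵖ(a)) f`. For the second, the definition `λ = E(ψ)` and the first fact
express `(id ⊗ λ)(D)` through the contraction `x ⊗ y ⊗ z ↦ x β S(y) ψ(z)` of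
`(1 ⊗ h) (id ⊗ Δ)(D) (1 ⊗ U)` (`sliceR_E`). Quasi-coassociativity, the compatibility of `f` with
`φ` (`twist_cocycle`) and the corresponding property of `U` (`idΔ_U_mul`) rewrite this element as a
product whose contraction is a scalar multiple of `1` (`contrβ_idΔ_Δbar`). The scalar is found by
applying `ε`, since `(ε ⊗ id)(U) = (ε ⊗ id)(V) = 1`.

Identities between contractions of products of reassociators are proved as follows. A bracketing
`t` of the tensor factors (*legs*) of an algebra determines an iterated coproduct `leg t`, and a
reassociator `Φ a b c` is attached to any three disjoint bracketings. These satisfy naturality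
(`Intw.Φ`) and the pentagon relation (`pentagon_Φ`), and they are `1` when one of `a`, `b`, `c` is
empty (`Φ_unit₁`, `Φ_unit₂`, `Φ_unit₃`). A linear map that contains a factor `S(xᵢ) α xⱼ` or
`xᵢ β S(xⱼ)` does not change when a bracket `ij` at the far left, respectively right, of its
argument is deleted (`EqL`, `EqR`). Each identity is a rewriting of words in the `Φ a b c` by these
rules.
-/

noncomputable section

/-! ### Ordered products of linear maps along tensors -/

section OrderedProducts

variable {k H A B : Type*} [Field k] [Ring H] [Algebra k H] [Ring A] [Algebra k A]
  [AddCommGroup B] [Module k B]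

theorem tensor3_induction {X Y Z : Type*} [AddCommGroup X] [Module k X] [AddCommGroup Y]
    [Module k Y] [AddCommGroup Z] [Module k Z] {P : X ⊗[k] (Y ⊗[k] Z) → Prop}
    (tmul : ∀ x y z, P (x ⊗ₜ (y ⊗ₜ z))) (add : ∀ s t, P s → P t → P (s + t)) (t) : P t := by
  have h0 : P 0 := by simpa using tmul 0 0 0
  induction t using TensorProduct.induction_on with
  | zero => exact h0
  | add s t hs ht => exact add s t hs ht
  | tmul x w =>
    induction w using TensorProduct.induction_on with
    | zero => simpa using h0
    | add s t hs ht => rw [TensorProduct.tmul_add]; exact add _ _ hs ht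
    | tmul y z => exact tmul x y z

theorem tensor2_induction {X Y : Type*} [AddCommGroup X] [Module k X] [AddCommGroup Y]
    [Module k Y] {P : X ⊗[k] Y → Prop}
    (tmul : ∀ x y, P (x ⊗ₜ y)) (add : ∀ s t, P s → P t → P (s + t)) (t) : P t := by
  have h0 : P 0 := by simpa using tmul 0 0
  induction t using TensorProduct.induction_on with
  | zero => exact h0
  | add s t hs ht => exact add s t hs ht
  | tmul x y => exact tmul x y

theorem tensor4_induction {X Y Z W : Type*} [AddCommGroup X] [Module k X] [AddCommGroup Y]
    [Module k Y] [AddCommGroup Z] [Module k Z] [AddCommGroup W] [Module k W]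
    {P : X ⊗[k] (Y ⊗[k] (Z ⊗[k] W)) → Prop}
    (tmul : ∀ x y z w, P (x ⊗ₜ (y ⊗ₜ (z ⊗ₜ w)))) (add : ∀ s t, P s → P t → P (s + t)) (t) :
    P t := by
  have h0 : P 0 := by simpa using tmul 0 0 0 0
  induction t using TensorProduct.induction_on with
  | zero => exact h0
  | add s t hs ht => exact add s t hs ht
  | tmul x w =>
    induction w using tensor3_induction with
    | add s t hs ht => rw [TensorProduct.tmul_add]; exact add _ _ hs ht
    | tmul y z w => exact tmul x y z w

/-- The map `x ⊗ y ↦ a(x) b(y)`. -/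
def mul2 (a b : H →ₗ[k] A) : H ⊗[k] H →ₗ[k] A := LinearMap.mul' k A ∘ₗ TensorProduct.map a b

/-- The map `x ⊗ y ⊗ z ↦ a(x) b(y) c(z)`. -/
def mul3 (a b c : H →ₗ[k] A) : H ⊗[k] (H ⊗[k] H) →ₗ[k] A :=
  LinearMap.mul' k A ∘ₗ TensorProduct.map a (mul2 b c)

/-- The map `x ⊗ y ⊗ z ⊗ w ↦ a(x) b(y) c(z) d(w)`. -/
def mul4 (a b c d : H →ₗ[k] A) : H ⊗[k] (H ⊗[k] (H ⊗[k] H)) →ₗ[k] A :=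
  LinearMap.mul' k A ∘ₗ TensorProduct.map a (mul3 b c d)

variable (a b c d : H →ₗ[k] A)

@[simp] theorem mul2_tmul (x y : H) : mul2 a b (x ⊗ₜ y) = a x * b y := rfl

@[simp] theorem mul3_tmul (x y z : H) : mul3 a b c (x ⊗ₜ (y ⊗ₜ z)) = a x * (b y * c z) := rfl

@[simp] theorem mul4_tmul (x y z w : H) :
    mul4 a b c d (x ⊗ₜ (y ⊗ₜ (z ⊗ₜ w))) = a x * (b y * (c z * d w)) := rfl

theorem mul4_tmul' (x : H) (t : H ⊗[k] (H ⊗[k] H)) :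
    mul4 a b c d (x ⊗ₜ t) = a x * mul3 b c d t := rfl

/-- The images of two linear maps into an algebra commute elementwise. -/
def CommMaps {X Y : Type*} [AddCommGroup X] [Module k X] [AddCommGroup Y] [Module k Y]
    (a : X →ₗ[k] A) (b : Y →ₗ[k] A) : Prop := ∀ x y, Commute (a x) (b y)

/-- A map is multiplicative and unital. -/
def IsMulMap {X Y : Type*} [MulOneClass X] [MulOneClass Y] (a : X → Y) : Prop :=
  a 1 = 1 ∧ ∀ x y, a (x * y) = a x * a y

variable {a b c d}

theorem CommMaps.symm {X Y : Type*} [AddCommGroup X] [Module k X] [AddCommGroup Y] [Module k Y]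
    {a : X →ₗ[k] A} {b : Y →ₗ[k] A} (h : CommMaps a b) : CommMaps b a :=
  fun x y => (h y x).symm

theorem CommMaps.mul2 {X : Type*} [AddCommGroup X] [Module k X] {c : X →ₗ[k] A}
    (ha : CommMaps c a) (hb : CommMaps c b) : CommMaps c (mul2 a b) := by
  intro x t
  induction t using tensor2_induction with
  | tmul y z => exact (ha x y).mul_right (hb x z)
  | add s t hs ht => rw [map_add]; exact hs.add_right ht

theorem CommMaps.mul3 {X : Type*} [AddCommGroup X] [Module k X] {d : X →ₗ[k] A}
    (ha : CommMaps d a) (hb : CommMaps d b) (hc : CommMaps d c) : CommMaps d (mul3 a b c) := by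
  intro x t
  induction t using tensor3_induction with
  | tmul y z w => exact (ha x y).mul_right ((hb x z).mul_right (hc x w))
  | add s t hs ht => rw [map_add]; exact hs.add_right ht

theorem isMulMap_mul' {X Y : Type*} [Ring X] [Algebra k X] [Ring Y] [Algebra k Y]
    {a : X →ₗ[k] A} {b : Y →ₗ[k] A} (ha : IsMulMap a) (hb : IsMulMap b) (h : CommMaps a b) :
    IsMulMap (LinearMap.mul' k A ∘ₗ TensorProduct.map a b) := by
  refine ⟨?_, fun s t => ?_⟩
  · rw [Algebra.TensorProduct.one_def]
    simp [ha.1, hb.1]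
  · induction s using tensor2_induction with
    | add s s' h1 h2 => simp only [add_mul, map_add, h1, h2]
    | tmul x y =>
      induction t using tensor2_induction with
      | add t t' h1 h2 => simp only [mul_add, map_add, h1, h2]
      | tmul x' y' =>
        simp only [Algebra.TensorProduct.tmul_mul_tmul, LinearMap.comp_apply,
          TensorProduct.map_tmul, LinearMap.mul'_apply, ha.2, hb.2, mul_assoc]
        rw [← mul_assoc (a x'), (h x' y).eq, mul_assoc]

theorem IsMulMap.mul2 (ha : IsMulMap a) (hb : IsMulMap b) (h : CommMaps a b) :
    IsMulMap (mul2 a b) := isMulMap_mul' ha hb h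

theorem IsMulMap.mul3 (ha : IsMulMap a) (hb : IsMulMap b) (hc : IsMulMap c)
    (hab : CommMaps a b) (hac : CommMaps a c) (hbc : CommMaps b c) :
    IsMulMap (mul3 a b c) := isMulMap_mul' ha (hb.mul2 hc hbc) (hab.mul2 hac)

theorem IsMulMap.mul4 (ha : IsMulMap a) (hb : IsMulMap b) (hc : IsMulMap c) (hd : IsMulMap d)
    (hab : CommMaps a b) (hac : CommMaps a c) (had : CommMaps a d) (hbc : CommMaps b c)
    (hbd : CommMaps b d) (hcd : CommMaps c d) :
    IsMulMap (mul4 a b c d) := isMulMap_mul' ha (hb.mul3 hc hd hbc hbd hcd) (hab.mul3 hac had)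

end OrderedProducts

/-! ### Bracketed legs and the placements of the reassociator -/

/-- A family of algebra morphisms `H → A`, indexed by `ι`, whose images commute with each other,
such as the inclusions of `H` as the tensor factors of `H ⊗ ⋯ ⊗ H`. -/
structure Legs (k H A ι : Type*) [Field k] [Ring H] [Algebra k H] [Ring A] [Algebra k A] where
  /-- the individual legs -/
  toFun : ι → H →ₐ[k] A
  comm : ∀ {i j}, i ≠ j → ∀ x y, Commute (toFun i x) (toFun j y)

/-- Binary trees with leaves in `ι`, together with the empty tree `unit`. A tree encodes a
bracketing of the tensor product of the `H`-modules attached to its leaves. -/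
inductive Bracketing (ι : Type*)
  | unit : Bracketing ι
  | leaf : ι → Bracketing ι
  | node : Bracketing ι → Bracketing ι → Bracketing ι

namespace Bracketing

variable {ι : Type*}

/-- The list of leaves, from left to right. -/
def leaves : Bracketing ι → List ι
  | unit => []
  | leaf i => [i]
  | node s t => s.leaves ++ t.leaves

/-- No leaf occurs twice. -/
abbrev Ok (t : Bracketing ι) : Prop := t.leaves.Nodup

instance : Mul (Bracketing ι) := ⟨node⟩

instance (n : ℕ) [OfNat ι n] : OfNat (Bracketing ι) n := ⟨leaf (OfNat.ofNat n)⟩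

theorem leaves_mul (s t : Bracketing ι) : (s * t).leaves = s.leaves ++ t.leaves := rfl

end Bracketing

namespace QuasiHopfAlgebra

open Bracketing

variable {k H A B ι : Type*} [Field k] [Ring H] [Algebra k H] [Ring A] [Algebra k A]
  [AddCommGroup B] [Module k B] (Q : QuasiHopfAlgebra k H) (L : Legs k H A ι)

/-- The morphism `H → A` given by the iterated coproduct with bracketing `t`. -/
def leg : Bracketing ι → H →ₗ[k] A
  | unit => Algebra.linearMap k A ∘ₗ Q.ε.toLinearMap
  | leaf i => (L.toFun i).toLinearMap
  | node s t => mul2 (leg s) (leg t) ∘ₗ Q.Δ.toLinearMap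

theorem leg_unit (x : H) : Q.leg L unit x = algebraMap k A (Q.ε x) := rfl

theorem leg_mul (s t : Bracketing ι) (x : H) :
    Q.leg L (s * t) x = mul2 (Q.leg L s) (Q.leg L t) (Q.Δ x) := rfl

variable {Q L}

theorem commMaps_leg {s t : Bracketing ι} (h : List.Disjoint s.leaves t.leaves) :
    CommMaps (Q.leg L s) (Q.leg L t) := by
  induction s with
  | unit => exact fun x y => Algebra.commute_algebraMap_left _ _
  | node s s' hs hs' =>
    rw [leaves, List.disjoint_append_left] at h
    exact fun x y => ((hs h.1).symm.mul2 (hs' h.2).symm).symm (Q.Δ x) y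
  | leaf i =>
    induction t with
    | unit => exact fun x y => Algebra.commute_algebraMap_right _ _
    | leaf j =>
      exact fun x y => L.comm (by rintro rfl; simp [leaves] at h) x y
    | node t t' ht ht' =>
      rw [leaves.eq_3 t, List.disjoint_append_right] at h
      exact fun x y => ((ht h.1).mul2 (ht' h.2)) x (Q.Δ y)

theorem commMaps_of_ok {s t : Bracketing ι} (h : (s * t).Ok) :
    CommMaps (Q.leg L s) (Q.leg L t) :=
  commMaps_leg (List.nodup_append'.1 h).2.2

theorem ok_left {s t : Bracketing ι} (h : (s * t).Ok) : s.Ok := (List.nodup_append'.1 h).1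

theorem ok_right {s t : Bracketing ι} (h : (s * t).Ok) : t.Ok := (List.nodup_append'.1 h).2.1

theorem isMulMap_leg {s : Bracketing ι} (h : s.Ok) : IsMulMap (Q.leg L s) := by
  induction s with
  | unit => exact ⟨by simp [leg], fun x y => by simp [leg]⟩
  | leaf i => exact ⟨by simp [leg], fun x y => by simp [leg]⟩
  | node s t hs ht =>
    have := (hs (ok_left h)).mul2 (ht (ok_right h)) (commMaps_of_ok h)
    refine ⟨?_, fun x y => ?_⟩
    · simpa [leg] using this.1
    · simpa [leg] using this.2 (Q.Δ x) (Q.Δ y)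

theorem isMulMap_mul3_leg {a b c : Bracketing ι} (h : (a * (b * c)).Ok) :
    IsMulMap (mul3 (Q.leg L a) (Q.leg L b) (Q.leg L c)) := by
  have h' := (List.nodup_append'.1 h).2.2
  change List.Disjoint _ (b.leaves ++ c.leaves) at h'
  rw [List.disjoint_append_right] at h'
  exact (isMulMap_leg (ok_left h)).mul3 (isMulMap_leg (ok_left (ok_right h)))
    (isMulMap_leg (ok_right (ok_right h))) (commMaps_leg h'.1)
    (commMaps_leg h'.2) (commMaps_of_ok (ok_right h))

theorem isMulMap_mul4_leg {a b c d : Bracketing ι} (h : (a * (b * (c * d))).Ok) :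
    IsMulMap (mul4 (Q.leg L a) (Q.leg L b) (Q.leg L c) (Q.leg L d)) := by
  have h' := (List.nodup_append'.1 h).2.2
  change List.Disjoint _ (b.leaves ++ (c.leaves ++ d.leaves)) at h'
  rw [List.disjoint_append_right, List.disjoint_append_right] at h'
  have h'' := (List.nodup_append'.1 (ok_right h)).2.2
  change List.Disjoint _ (c.leaves ++ d.leaves) at h''
  rw [List.disjoint_append_right] at h''
  exact (isMulMap_leg (ok_left h)).mul4 (isMulMap_leg (ok_left (ok_right h)))
    (isMulMap_leg (ok_left (ok_right (ok_right h))))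
    (isMulMap_leg (ok_right (ok_right (ok_right h)))) (commMaps_leg h'.1)
    (commMaps_leg h'.2.1) (commMaps_leg h'.2.2) (commMaps_leg h''.1) (commMaps_leg h''.2)
    (commMaps_of_ok (ok_right (ok_right h)))

variable (Q L)

theorem φ_mul_φinv : (Q.φ : H ⊗[k] (H ⊗[k] H)) * Q.φinv = 1 := Units.mul_inv _

theorem φinv_mul_φ : Q.φinv * (Q.φ : H ⊗[k] (H ⊗[k] H)) = 1 := Units.inv_mul _

open Classical in
/-- The reassociator placed on the legs `a`, `b`, `c`, which have to be disjoint (the value is `1`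
otherwise). It maps the bracketing `(ab)c` to the bracketing `a(bc)`. -/
def Φ (a b c : Bracketing ι) : Aˣ :=
  if h : (a * (b * c)).Ok then
    { val := mul3 (Q.leg L a) (Q.leg L b) (Q.leg L c) Q.φ
      inv := mul3 (Q.leg L a) (Q.leg L b) (Q.leg L c) Q.φinv
      val_inv := by
        rw [← (isMulMap_mul3_leg h).2, φ_mul_φinv, (isMulMap_mul3_leg h).1]
      inv_val := by
        rw [← (isMulMap_mul3_leg h).2, φinv_mul_φ, (isMulMap_mul3_leg h).1] }
  else 1

variable {Q L}

theorem coe_Φ {a b c : Bracketing ι} (h : (a * (b * c)).Ok) :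
    (Q.Φ L a b c : A) = mul3 (Q.leg L a) (Q.leg L b) (Q.leg L c) Q.φ := by
  simp only [Φ, dif_pos h]

theorem coe_Φ_inv {a b c : Bracketing ι} (h : (a * (b * c)).Ok) :
    ((Q.Φ L a b c)⁻¹ : Aˣ) = mul3 (Q.leg L a) (Q.leg L b) (Q.leg L c) Q.φinv := by
  simp only [Φ, dif_pos h]; rfl

variable (Q L) in
/-- The element `u` intertwines the bracketings `s` and `t`. -/
def Intw (u : Aˣ) (s t : Bracketing ι) : Prop := ∀ x, (u : A) * Q.leg L s x = Q.leg L t x * u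

theorem Intw.inv {u : Aˣ} {s t : Bracketing ι} (h : Q.Intw L u s t) : Q.Intw L u⁻¹ t s := by
  intro x
  rw [Units.inv_mul_eq_iff_eq_mul, ← mul_assoc, h, mul_assoc, Units.mul_inv, mul_one]

theorem Intw.node {u : Aˣ} {s s' t t' : Bracketing ι} (h : Q.Intw L u s s') (h' : Q.Intw L u t t') :
    Q.Intw L u (s * t) (s' * t') := by
  intro x
  rw [leg_mul, leg_mul]
  induction Q.Δ x using tensor2_induction with
  | tmul x y => rw [mul2_tmul, mul2_tmul, ← mul_assoc, h, mul_assoc, h', mul_assoc]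
  | add z z' h1 h2 => simp only [map_add, mul_add, add_mul, h1, h2]

/-- Naturality of the reassociator. -/
theorem Intw.Φ {u : Aˣ} {a b c a' b' c' : Bracketing ι} (ha : Q.Intw L u a a')
    (hb : Q.Intw L u b b') (hc : Q.Intw L u c c') (h : (a * (b * c)).Ok := by decide)
    (h' : (a' * (b' * c')).Ok := by decide) :
    u * Q.Φ L a b c = Q.Φ L a' b' c' * u := by
  ext
  rw [Units.val_mul, Units.val_mul, coe_Φ h, coe_Φ h']
  induction (Q.φ : H ⊗[k] (H ⊗[k] H)) using tensor3_induction with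
  | tmul x y z =>
    rw [mul3_tmul, mul3_tmul, ← mul_assoc, ha, mul_assoc, ← mul_assoc (u : A), hb,
      mul_assoc _ (u : A), hc, mul_assoc, mul_assoc]
  | add z z' h1 h2 => simp only [map_add, mul_add, add_mul, h1, h2]

theorem Φ_nat {a b c : Bracketing ι} (h : (a * (b * c)).Ok := by decide) :
    Q.Intw L (Q.Φ L a b c) (a * b * c) (a * (b * c)) := by
  intro x
  have h1 : ∀ t : H ⊗[k] H, mul2 (Q.leg L a) (Q.leg L (b * c)) t =
      mul3 (Q.leg L a) (Q.leg L b) (Q.leg L c)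
        (Algebra.TensorProduct.map (AlgHom.id k H) Q.Δ t) := by
    intro t
    induction t using tensor2_induction with
    | tmul x y => rfl
    | add z z' h1 h2 => simp only [map_add, h1, h2]
  have h3 : ∀ (t : H ⊗[k] H) (y : H), mul2 (Q.leg L a) (Q.leg L b) t * Q.leg L c y =
      mul3 (Q.leg L a) (Q.leg L b) (Q.leg L c) (TensorProduct.assoc k H H H (t ⊗ₜ y)) := by
    intro t y
    induction t using tensor2_induction with
    | tmul x y => simp [mul_assoc]
    | add z z' h1 h2 => simp only [map_add, add_mul, h1, h2, TensorProduct.add_tmul]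
  have h2 : ∀ t : H ⊗[k] H, mul2 (Q.leg L (a * b)) (Q.leg L c) t =
      mul3 (Q.leg L a) (Q.leg L b) (Q.leg L c) (TensorProduct.assoc k H H H
        (Algebra.TensorProduct.map Q.Δ (AlgHom.id k H) t)) := by
    intro t
    induction t using tensor2_induction with
    | tmul x y => rw [mul2_tmul, leg_mul, h3]; rfl
    | add z z' h1 h2 => simp only [map_add, h1, h2]
  rw [leg_mul, leg_mul, h1, h2, coe_Φ h, ← (isMulMap_mul3_leg h).2, ← (isMulMap_mul3_leg h).2,
    Q.quasi_coassoc]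

/-- The reassociator commutes with the legs it is not attached to. -/
theorem Φ_comm {a b c t : Bracketing ι} (h : (a * (b * c) * t).Ok := by decide) :
    Q.Intw L (Q.Φ L a b c) t t := by
  intro x
  have h' := (List.nodup_append'.1 h).2.2
  change List.Disjoint (a.leaves ++ (b.leaves ++ c.leaves)) _ at h'
  rw [List.disjoint_append_left, List.disjoint_append_left] at h'
  rw [coe_Φ (ok_left h)]
  exact ((commMaps_leg h'.1).symm.mul3 (commMaps_leg h'.2.1).symm
    (commMaps_leg h'.2.2).symm).symm _ _

theorem mul4_map_Δ (a b c d : Bracketing ι) (t : H ⊗[k] (H ⊗[k] H)) :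
    mul4 (Q.leg L a) (Q.leg L b) (Q.leg L c) (Q.leg L d)
      (Algebra.TensorProduct.map (AlgHom.id k H)
        (Algebra.TensorProduct.map (AlgHom.id k H) Q.Δ) t) =
      mul3 (Q.leg L a) (Q.leg L b) (Q.leg L (c * d)) t := by
  induction t using tensor3_induction with
  | tmul x y z =>
    rw [mul3_tmul, leg_mul]
    rfl
  | add z z' h1 h2 => simp only [map_add, h1, h2]

/-- The pentagon relation for placed reassociators. -/
theorem pentagon_Φ {a b c d : Bracketing ι} (h : (a * (b * (c * d))).Ok := by decide) :
    Q.Φ L a b (c * d) * Q.Φ L (a * b) c d = Q.Φ L b c d * Q.Φ L a (b * c) d * Q.Φ L a b c := by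
  have hm := isMulMap_mul4_leg (Q := Q) (L := L) h
  have key := congrArg (mul4 (Q.leg L a) (Q.leg L b) (Q.leg L c) (Q.leg L d)) Q.pentagon
  rw [hm.2, hm.2, hm.2, mul4_map_Δ, ← coe_Φ (c := c * d) h] at key
  have e2 : mul4 (Q.leg L a) (Q.leg L b) (Q.leg L c) (Q.leg L d)
      (TensorProduct.assoc k H H (H ⊗[k] H)
        (Algebra.TensorProduct.map Q.Δ (AlgHom.id k (H ⊗[k] H)) (Q.φ : H ⊗[k] (H ⊗[k] H)))) =
      Q.Φ L (a * b) c d := by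
    have h1 : (a * b * (c * d)).Ok := by simpa only [Ok, leaves_mul, List.append_assoc] using h
    rw [coe_Φ h1]
    induction (Q.φ : H ⊗[k] (H ⊗[k] H)) using tensor3_induction with
    | tmul x y z =>
      rw [mul3_tmul, leg_mul, Algebra.TensorProduct.map_tmul]
      induction Q.Δ x using tensor2_induction with
      | tmul x1 x2 => simp [mul_assoc]
      | add z z' h1 h2 => simp only [map_add, add_mul, h1, h2, TensorProduct.add_tmul]
    | add z z' h1 h2 => simp only [map_add, h1, h2]
  have e3 : mul4 (Q.leg L a) (Q.leg L b) (Q.leg L c) (Q.leg L d)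
      ((1 : H) ⊗ₜ[k] (Q.φ : H ⊗[k] (H ⊗[k] H))) = Q.Φ L b c d := by
    rw [coe_Φ (ok_right h), mul4_tmul', (isMulMap_leg (ok_left h)).1, one_mul]
  have e4 : mul4 (Q.leg L a) (Q.leg L b) (Q.leg L c) (Q.leg L d)
      (TensorProduct.map LinearMap.id
        ((TensorProduct.assoc k H H H).toLinearMap ∘ₗ
          TensorProduct.map Q.Δ.toLinearMap LinearMap.id) (Q.φ : H ⊗[k] (H ⊗[k] H))) =
      Q.Φ L a (b * c) d := by
    have h1 : (a * (b * c * d)).Ok := by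
      simpa only [Ok, leaves_mul, List.append_assoc] using h
    rw [coe_Φ h1]
    induction (Q.φ : H ⊗[k] (H ⊗[k] H)) using tensor3_induction with
    | tmul x y z =>
      rw [mul3_tmul, leg_mul, TensorProduct.map_tmul, mul4_tmul']
      simp only [LinearMap.comp_apply, TensorProduct.map_tmul, AlgHom.toLinearMap_apply]
      congr 1
      induction Q.Δ y using tensor2_induction with
      | tmul x1 x2 => simp [mul_assoc]
      | add z z' h1 h2 => simp only [map_add, add_mul, h1, h2, TensorProduct.add_tmul]
    | add z z' h1 h2 => simp only [map_add, h1, h2]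
  have e5 : mul4 (Q.leg L a) (Q.leg L b) (Q.leg L c) (Q.leg L d)
      (TensorProduct.map LinearMap.id (TensorProduct.assoc k H H H).toLinearMap
        (TensorProduct.assoc k H (H ⊗[k] H) H ((Q.φ : H ⊗[k] (H ⊗[k] H)) ⊗ₜ[k] (1 : H)))) =
      Q.Φ L a b c := by
    have h1 : (a * (b * c)).Ok := by
      have h2 : (a * (b * c) * d).Ok := by
        simpa only [Ok, leaves_mul, List.append_assoc] using h
      exact ok_left h2
    rw [coe_Φ h1]
    induction (Q.φ : H ⊗[k] (H ⊗[k] H)) using tensor3_induction with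
    | tmul x y z =>
      simp [(isMulMap_leg (Q := Q) (L := L) (ok_right (ok_right (ok_right h)))).1]
    | add z z' h1 h2 => simp only [map_add, h1, h2, TensorProduct.add_tmul]
  rw [e2, e3, e4, e5] at key
  ext
  simpa only [Units.val_mul] using key

theorem leg_unit_mul (t : Bracketing ι) : Q.leg L (unit * t) = Q.leg L t := by
  ext x
  rw [leg_mul]
  conv_rhs => rw [← Q.counit_left x]
  induction Q.Δ x using tensor2_induction with
  | tmul x y => simp [leg_unit, Algebra.algebraMap_eq_smul_one]
  | add z z' h1 h2 => simp only [map_add, h1, h2]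

theorem leg_mul_unit (t : Bracketing ι) : Q.leg L (t * unit) = Q.leg L t := by
  ext x
  rw [leg_mul]
  conv_rhs => rw [← Q.counit_right x]
  induction Q.Δ x using tensor2_induction with
  | tmul x y => simp [leg_unit, Algebra.algebraMap_eq_smul_one]
  | add z z' h1 h2 => simp only [map_add, h1, h2]

theorem Φ_congr {a b c a' b' c' : Bracketing ι} (ha : Q.leg L a = Q.leg L a')
    (hb : Q.leg L b = Q.leg L b') (hc : Q.leg L c = Q.leg L c')
    (h : (a * (b * c)).leaves = (a' * (b' * c')).leaves) : Q.Φ L a b c = Q.Φ L a' b' c' := by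
  ext
  by_cases h' : (a * (b * c)).Ok
  · have h'' : (a' * (b' * c')).Ok := by rwa [Ok, ← h]
    rw [coe_Φ h', coe_Φ h'', ha, hb, hc]
  · have h'' : ¬ (a' * (b' * c')).Ok := by rwa [Ok, ← h]
    simp only [Φ, dif_neg h', dif_neg h'']

theorem Φ_unit₂ (a b : Bracketing ι) : Q.Φ L a unit b = 1 := by
  by_cases h : (a * (unit * b)).Ok
  · ext
    rw [coe_Φ h]
    have key := congrArg (mul2 (Q.leg L a) (Q.leg L b)) Q.counit_reassociator
    rw [mul2_tmul, (isMulMap_leg (ok_left h)).1, (isMulMap_leg (ok_right (ok_right h))).1,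
      one_mul] at key
    rw [Units.val_one, ← key]
    induction (Q.φ : H ⊗[k] (H ⊗[k] H)) using tensor3_induction with
    | tmul x y z => simp [leg_unit, Algebra.algebraMap_eq_smul_one]
    | add z z' h1 h2 => simp only [map_add, h1, h2]
  · simp only [Φ, dif_neg h]

theorem Φ_unit₁ (a b : Bracketing ι) : Q.Φ L unit a b = 1 := by
  by_cases h : (unit * (a * b)).Ok
  · have key := pentagon_Φ (Q := Q) (L := L) (a := unit) (b := unit) (c := a) (d := b) h
    have e1 : Q.Φ L (unit * unit) a b = Q.Φ L unit a b :=
      Φ_congr (leg_unit_mul _) rfl rfl rfl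
    have e2 : Q.Φ L unit (unit * a) b = Q.Φ L unit a b :=
      Φ_congr rfl (leg_unit_mul _) rfl rfl
    rw [e1, e2, Φ_unit₂, Φ_unit₂, one_mul, mul_one] at key
    exact (right_eq_mul.1 key)
  · simp only [Φ, dif_neg h]

theorem Φ_unit₃ (a b : Bracketing ι) : Q.Φ L a b unit = 1 := by
  by_cases h : (a * (b * unit)).Ok
  · have key := pentagon_Φ (Q := Q) (L := L) (a := a) (b := b) (c := unit) (d := unit)
      (by simpa [Ok, leaves_mul, leaves] using h)
    have e1 : Q.Φ L a b (unit * unit) = Q.Φ L a b unit :=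
      Φ_congr rfl rfl (leg_unit_mul _) rfl
    have e2 : Q.Φ L a (b * unit) unit = Q.Φ L a b unit :=
      Φ_congr rfl (leg_mul_unit _) rfl (by simp [leaves])
    rw [e1, e2, Φ_unit₂, Φ_unit₂, mul_one, one_mul] at key
    exact (left_eq_mul.1 key)
  · simp only [Φ, dif_neg h]

end QuasiHopfAlgebra

namespace QuasiHopfAlgebra

open Bracketing

variable {k H A B ι : Type*} [Field k] [Ring H] [Algebra k H] [Ring A] [Algebra k A]
  [AddCommGroup B] [Module k B] (Q : QuasiHopfAlgebra k H) (L : Legs k H A ι)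

/-! ### Linear maps that are invariant under a leg -/

/-- The map `C` does not distinguish left multiplication through the brackets `s` and `t`. -/
def EqL (C : A →ₗ[k] B) (s t : Bracketing ι) : Prop :=
  ∀ x w, C (Q.leg L s x * w) = C (Q.leg L t x * w)

/-- The map `C` does not distinguish right multiplication through the brackets `s` and `t`. -/
def EqR (C : A →ₗ[k] B) (s t : Bracketing ι) : Prop :=
  ∀ x w, C (w * Q.leg L s x) = C (w * Q.leg L t x)

variable {Q L} {C : A →ₗ[k] B} {s t : Bracketing ι}

theorem EqL.mul_right (h : Q.EqL L C s unit) (t : Bracketing ι) : Q.EqL L C (s * t) t := by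
  intro x w
  rw [← leg_unit_mul t, leg_mul, leg_mul]
  induction Q.Δ x using tensor2_induction with
  | tmul x y => rw [mul2_tmul, mul2_tmul, mul_assoc, mul_assoc, h]
  | add z z' h1 h2 => simp only [map_add, add_mul, h1, h2]

theorem EqL.mul_left (h : Q.EqL L C s unit) (t : Bracketing ι)
    (hst : (s * t).Ok := by decide) : Q.EqL L C (t * s) t := by
  intro x w
  have hc := commMaps_of_ok (Q := Q) (L := L) hst
  rw [← leg_mul_unit t, leg_mul, leg_mul]
  induction Q.Δ x using tensor2_induction with
  | tmul x y =>
    rw [mul2_tmul, mul2_tmul, ← (hc y x).eq, mul_assoc, h, leg_unit, ← mul_assoc,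
      Algebra.commutes]
  | add z z' h1 h2 => simp only [map_add, add_mul, h1, h2]

theorem EqR.mul_left (h : Q.EqR L C s unit) (t : Bracketing ι) : Q.EqR L C (t * s) t := by
  intro x w
  rw [← leg_mul_unit t, leg_mul, leg_mul]
  induction Q.Δ x using tensor2_induction with
  | tmul x y => rw [mul2_tmul, mul2_tmul, ← mul_assoc, ← mul_assoc, h]
  | add z z' h1 h2 => simp only [map_add, mul_add, h1, h2]

theorem EqR.mul_right (h : Q.EqR L C s unit) (t : Bracketing ι)
    (hst : (s * t).Ok := by decide) : Q.EqR L C (s * t) t := by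
  intro x w
  have hc := commMaps_of_ok (Q := Q) (L := L) hst
  rw [← leg_unit_mul t, leg_mul, leg_mul]
  induction Q.Δ x using tensor2_induction with
  | tmul x y =>
    rw [mul2_tmul, mul2_tmul, (hc x y).eq, ← mul_assoc, h, leg_unit, mul_assoc,
      Algebra.commutes]
  | add z z' h1 h2 => simp only [map_add, mul_add, h1, h2]

theorem EqL.trans {r : Bracketing ι} (h : Q.EqL L C r s) (h' : Q.EqL L C s t) :
    Q.EqL L C r t := fun x w => (h x w).trans (h' x w)

theorem EqR.trans {r : Bracketing ι} (h : Q.EqR L C r s) (h' : Q.EqR L C s t) :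
    Q.EqR L C r t := fun x w => (h x w).trans (h' x w)

theorem EqL.congr_left (h : Q.EqL L C s t) (r : Bracketing ι)
    (hs : (r * s).Ok := by decide) (ht : (r * t).Ok := by decide) :
    Q.EqL L C (r * s) (r * t) := by
  intro x w
  have hs := commMaps_of_ok (Q := Q) (L := L) hs
  have ht := commMaps_of_ok (Q := Q) (L := L) ht
  rw [leg_mul, leg_mul]
  induction Q.Δ x using tensor2_induction with
  | tmul x y =>
    rw [mul2_tmul, mul2_tmul, (hs x y).eq, (ht x y).eq, mul_assoc, h, mul_assoc]
  | add z z' h1 h2 => simp only [map_add, add_mul, h1, h2]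

theorem EqL.congr_right (h : Q.EqL L C s t)
    (r : Bracketing ι) : Q.EqL L C (s * r) (t * r) := by
  intro x w
  rw [leg_mul, leg_mul]
  induction Q.Δ x using tensor2_induction with
  | tmul x y => rw [mul2_tmul, mul2_tmul, mul_assoc, mul_assoc, h]
  | add z z' h1 h2 => simp only [map_add, add_mul, h1, h2]

theorem EqR.congr_left (h : Q.EqR L C s t) (r : Bracketing ι) : Q.EqR L C (r * s) (r * t) := by
  intro x w
  rw [leg_mul, leg_mul]
  induction Q.Δ x using tensor2_induction with
  | tmul x y => rw [mul2_tmul, mul2_tmul, ← mul_assoc, h, mul_assoc]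
  | add z z' h1 h2 => simp only [map_add, mul_add, h1, h2]

theorem intw_one (t : Bracketing ι) : Q.Intw L 1 t t := fun x => by simp

theorem intw_unit (u : Aˣ) : Q.Intw L u unit unit := fun x =>
  (Algebra.commute_algebraMap_right (Q.ε x) (u : A)).eq

theorem Intw.mul {u v : Aˣ} {r s t : Bracketing ι} (hu : Q.Intw L u s t)
    (hv : Q.Intw L v r s) : Q.Intw L (u * v) r t := fun x => by
  rw [Units.val_mul, mul_assoc, hv, ← mul_assoc, hu, mul_assoc]

section

variable {u : Aˣ} {v : A} {a b c : Bracketing ι}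

/-- The element `u` may stand to the left of the leg if it commutes with both brackets. -/
theorem EqL.ctx (h : Q.EqL L C s t) (hs : Q.Intw L u s s) (ht : Q.Intw L u t t) (x : H) (w : A) :
    C (u * (Q.leg L s x * w) * v) = C (u * (Q.leg L t x * w) * v) := by
  rw [← mul_assoc, hs, ← mul_assoc (u : A) (Q.leg L t x), ht]
  simp only [mul_assoc, h x]

theorem EqL.comp_mulLeft (h : Q.EqL L C s t)
    (hs : Q.Intw L u s s) (ht : Q.Intw L u t t) :
    Q.EqL L (C ∘ₗ LinearMap.mulLeft k (u : A)) s t := fun x w => by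
  simpa using h.ctx hs ht (v := 1) x w

theorem EqR.ctx (h : Q.EqR L C s t) (hs : Q.Intw L u s s) (ht : Q.Intw L u t t) (x : H) (w : A) :
    C (v * (w * Q.leg L s x) * u) = C (v * (w * Q.leg L t x) * u) := by
  simp only [mul_assoc]
  rw [← hs, ← ht]
  simp only [← mul_assoc, h x]

theorem EqL.mul3₁ (h : Q.EqL L C s t) (hs : Q.Intw L u s s) (ht : Q.Intw L u t t) (f g : H →ₗ[k] A)
    (z : H ⊗[k] (H ⊗[k] H)) :
    C (u * mul3 (Q.leg L s) f g z * v) = C (u * mul3 (Q.leg L t) f g z * v) := by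
  induction z using tensor3_induction with
  | tmul x y z => exact h.ctx hs ht _ _
  | add z z' h1 h2 => simp only [map_add, mul_add, add_mul, h1, h2]

theorem EqL.mul3₂ (h : Q.EqL L C s t) (hs : Q.Intw L u s s) (ht : Q.Intw L u t t)
    {f g : H →ₗ[k] A} (hs' : CommMaps (Q.leg L s) f) (ht' : CommMaps (Q.leg L t) f)
    (z : H ⊗[k] (H ⊗[k] H)) :
    C (u * mul3 f (Q.leg L s) g z * v) = C (u * mul3 f (Q.leg L t) g z * v) := by
  induction z using tensor3_induction with
  | tmul x y z =>
    rw [mul3_tmul, mul3_tmul, ← (hs' y x).left_comm, ← (ht' y x).left_comm]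
    exact h.ctx hs ht _ _
  | add z z' h1 h2 => simp only [map_add, mul_add, add_mul, h1, h2]

theorem EqL.mul3₃ (h : Q.EqL L C s t) (hs : Q.Intw L u s s) (ht : Q.Intw L u t t)
    {f g : H →ₗ[k] A} (hs' : CommMaps (Q.leg L s) f) (ht' : CommMaps (Q.leg L t) f)
    (hs'' : CommMaps (Q.leg L s) g) (ht'' : CommMaps (Q.leg L t) g)
    (z : H ⊗[k] (H ⊗[k] H)) :
    C (u * mul3 f g (Q.leg L s) z * v) = C (u * mul3 f g (Q.leg L t) z * v) := by
  induction z using tensor3_induction with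
  | tmul x y z =>
    rw [mul3_tmul, mul3_tmul, ← (hs'' z y).eq, ← (ht'' z y).eq, ← (hs' z x).left_comm,
      ← (ht' z x).left_comm]
    exact h.ctx hs ht _ _
  | add z z' h1 h2 => simp only [map_add, mul_add, add_mul, h1, h2]

theorem EqR.mul3₃ (h : Q.EqR L C s t) (hs : Q.Intw L u s s) (ht : Q.Intw L u t t) (f g : H →ₗ[k] A)
    (z : H ⊗[k] (H ⊗[k] H)) :
    C (v * mul3 f g (Q.leg L s) z * u) = C (v * mul3 f g (Q.leg L t) z * u) := by
  induction z using tensor3_induction with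
  | tmul x y z =>
    rw [mul3_tmul, mul3_tmul, ← mul_assoc (f x), ← mul_assoc (f x)]
    exact h.ctx hs ht _ _
  | add z z' h1 h2 => simp only [map_add, mul_add, add_mul, h1, h2]

theorem EqR.mul3₂ (h : Q.EqR L C s t) (hs : Q.Intw L u s s) (ht : Q.Intw L u t t)
    {f g : H →ₗ[k] A} (hs' : CommMaps (Q.leg L s) g) (ht' : CommMaps (Q.leg L t) g)
    (z : H ⊗[k] (H ⊗[k] H)) :
    C (v * mul3 f (Q.leg L s) g z * u) = C (v * mul3 f (Q.leg L t) g z * u) := by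
  induction z using tensor3_induction with
  | tmul x y z =>
    rw [mul3_tmul, mul3_tmul, (hs' y z).eq, (ht' y z).eq, ← mul_assoc (f x),
      ← mul_assoc (f x)]
    exact h.ctx hs ht _ _
  | add z z' h1 h2 => simp only [map_add, mul_add, add_mul, h1, h2]

theorem EqR.mul3₁ (h : Q.EqR L C s t) (hs : Q.Intw L u s s) (ht : Q.Intw L u t t)
    {f g : H →ₗ[k] A} (hs' : CommMaps (Q.leg L s) f) (ht' : CommMaps (Q.leg L t) f)
    (hs'' : CommMaps (Q.leg L s) g) (ht'' : CommMaps (Q.leg L t) g)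
    (z : H ⊗[k] (H ⊗[k] H)) :
    C (v * mul3 (Q.leg L s) f g z * u) = C (v * mul3 (Q.leg L t) f g z * u) := by
  induction z using tensor3_induction with
  | tmul x y z =>
    rw [mul3_tmul, mul3_tmul, ((hs' x y).mul_right (hs'' x z)).eq,
      ((ht' x y).mul_right (ht'' x z)).eq]
    exact h.ctx hs ht _ _
  | add z z' h1 h2 => simp only [map_add, mul_add, add_mul, h1, h2]

end

theorem comm₁₂ {a b c : Bracketing ι} (h : (a * (b * c)).Ok) :
    CommMaps (Q.leg L a) (Q.leg L b) := by
  have h' := (List.nodup_append'.1 h).2.2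
  change List.Disjoint _ (b.leaves ++ c.leaves) at h'
  exact commMaps_leg (List.disjoint_append_right.1 h').1

theorem comm₁₃ {a b c : Bracketing ι} (h : (a * (b * c)).Ok) :
    CommMaps (Q.leg L a) (Q.leg L c) := by
  have h' := (List.nodup_append'.1 h).2.2
  change List.Disjoint _ (b.leaves ++ c.leaves) at h'
  exact commMaps_leg (List.disjoint_append_right.1 h').2

theorem comm₂₃ {a b c : Bracketing ι} (h : (a * (b * c)).Ok) :
    CommMaps (Q.leg L b) (Q.leg L c) := commMaps_of_ok (ok_right h)

section

variable {u v : Aˣ} {a b c : Bracketing ι}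

theorem EqL.Φ₁ (h : Q.EqL L C s t) (hs : Q.Intw L u s s) (ht : Q.Intw L u t t)
    (h1 : (s * (b * c)).Ok := by decide) (h2 : (t * (b * c)).Ok := by decide) :
    C ↑(u * Q.Φ L s b c * v) = C ↑(u * Q.Φ L t b c * v) := by
  simp only [Units.val_mul, coe_Φ h1, coe_Φ h2]; exact h.mul3₁ hs ht _ _ _

theorem EqL.Φ₁_inv (h : Q.EqL L C s t) (hs : Q.Intw L u s s) (ht : Q.Intw L u t t)
    (h1 : (s * (b * c)).Ok := by decide) (h2 : (t * (b * c)).Ok := by decide) :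
    C ↑(u * (Q.Φ L s b c)⁻¹ * v) = C ↑(u * (Q.Φ L t b c)⁻¹ * v) := by
  simp only [Units.val_mul, coe_Φ_inv h1, coe_Φ_inv h2]; exact h.mul3₁ hs ht _ _ _

theorem EqL.Φ₂ (h : Q.EqL L C s t) (hs : Q.Intw L u s s) (ht : Q.Intw L u t t)
    (h1 : (a * (s * c)).Ok := by decide) (h2 : (a * (t * c)).Ok := by decide) :
    C ↑(u * Q.Φ L a s c * v) = C ↑(u * Q.Φ L a t c * v) := by
  simp only [Units.val_mul, coe_Φ h1, coe_Φ h2]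
  exact h.mul3₂ hs ht (comm₁₂ h1).symm (comm₁₂ h2).symm _

theorem EqL.Φ₂_inv (h : Q.EqL L C s t) (hs : Q.Intw L u s s) (ht : Q.Intw L u t t)
    (h1 : (a * (s * c)).Ok := by decide) (h2 : (a * (t * c)).Ok := by decide) :
    C ↑(u * (Q.Φ L a s c)⁻¹ * v) = C ↑(u * (Q.Φ L a t c)⁻¹ * v) := by
  simp only [Units.val_mul, coe_Φ_inv h1, coe_Φ_inv h2]
  exact h.mul3₂ hs ht (comm₁₂ h1).symm (comm₁₂ h2).symm _

theorem EqL.Φ₃ (h : Q.EqL L C s t) (hs : Q.Intw L u s s) (ht : Q.Intw L u t t)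
    (h1 : (a * (b * s)).Ok := by decide) (h2 : (a * (b * t)).Ok := by decide) :
    C ↑(u * Q.Φ L a b s * v) = C ↑(u * Q.Φ L a b t * v) := by
  simp only [Units.val_mul, coe_Φ h1, coe_Φ h2]
  exact h.mul3₃ hs ht (comm₁₃ h1).symm (comm₁₃ h2).symm (comm₂₃ h1).symm (comm₂₃ h2).symm _

theorem EqL.Φ₃_inv (h : Q.EqL L C s t) (hs : Q.Intw L u s s) (ht : Q.Intw L u t t)
    (h1 : (a * (b * s)).Ok := by decide) (h2 : (a * (b * t)).Ok := by decide) :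
    C ↑(u * (Q.Φ L a b s)⁻¹ * v) = C ↑(u * (Q.Φ L a b t)⁻¹ * v) := by
  simp only [Units.val_mul, coe_Φ_inv h1, coe_Φ_inv h2]
  exact h.mul3₃ hs ht (comm₁₃ h1).symm (comm₁₃ h2).symm (comm₂₃ h1).symm (comm₂₃ h2).symm _

theorem EqR.Φ₁_inv (h : Q.EqR L C s t) (hs : Q.Intw L u s s) (ht : Q.Intw L u t t)
    (h1 : (s * (b * c)).Ok := by decide) (h2 : (t * (b * c)).Ok := by decide) :
    C ↑(v * (Q.Φ L s b c)⁻¹ * u) = C ↑(v * (Q.Φ L t b c)⁻¹ * u) := by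
  simp only [Units.val_mul, coe_Φ_inv h1, coe_Φ_inv h2]
  exact h.mul3₁ hs ht (comm₁₂ h1) (comm₁₂ h2) (comm₁₃ h1) (comm₁₃ h2) _

theorem EqR.Φ₂ (h : Q.EqR L C s t) (hs : Q.Intw L u s s) (ht : Q.Intw L u t t)
    (h1 : (a * (s * c)).Ok := by decide) (h2 : (a * (t * c)).Ok := by decide) :
    C ↑(v * Q.Φ L a s c * u) = C ↑(v * Q.Φ L a t c * u) := by
  simp only [Units.val_mul, coe_Φ h1, coe_Φ h2]
  exact h.mul3₂ hs ht (comm₂₃ h1) (comm₂₃ h2) _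

theorem EqR.Φ₂_inv (h : Q.EqR L C s t) (hs : Q.Intw L u s s) (ht : Q.Intw L u t t)
    (h1 : (a * (s * c)).Ok := by decide) (h2 : (a * (t * c)).Ok := by decide) :
    C ↑(v * (Q.Φ L a s c)⁻¹ * u) = C ↑(v * (Q.Φ L a t c)⁻¹ * u) := by
  simp only [Units.val_mul, coe_Φ_inv h1, coe_Φ_inv h2]
  exact h.mul3₂ hs ht (comm₂₃ h1) (comm₂₃ h2) _

theorem EqR.Φ₃ (h : Q.EqR L C s t) (hs : Q.Intw L u s s) (ht : Q.Intw L u t t)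
    (h1 : (a * (b * s)).Ok := by decide) (h2 : (a * (b * t)).Ok := by decide) :
    C ↑(v * Q.Φ L a b s * u) = C ↑(v * Q.Φ L a b t * u) := by
  simp only [Units.val_mul, coe_Φ h1, coe_Φ h2]
  exact h.mul3₃ hs ht _ _ _

theorem EqR.Φ₃_inv (h : Q.EqR L C s t) (hs : Q.Intw L u s s) (ht : Q.Intw L u t t)
    (h1 : (a * (b * s)).Ok := by decide) (h2 : (a * (b * t)).Ok := by decide) :
    C ↑(v * (Q.Φ L a b s)⁻¹ * u) = C ↑(v * (Q.Φ L a b t)⁻¹ * u) := by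
  simp only [Units.val_mul, coe_Φ_inv h1, coe_Φ_inv h2]
  exact h.mul3₃ hs ht _ _ _

end

/-! ### Tensor powers and contractions -/

/-- The inclusions of `H` as the tensor factors of its `n`-th tensor power. -/
def factors (k H : Type*) [Field k] [Ring H] [Algebra k H] (n : ℕ) :
    Legs k H (⨂[k] _ : Fin n, H) (Fin n) where
  toFun i := PiTensorProduct.singleAlgHom (R := k) (A := fun _ : Fin n => H) i
  comm {i j} hij x y := by
    simp only [PiTensorProduct.singleAlgHom_apply, MonoidHom.mulSingle_apply]
    exact Commute.tprod (Pi.mulSingle_commute (f := fun _ : Fin n => H) hij x y)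

theorem factors_apply (n : ℕ) (i : Fin n) (x : H) :
    (factors k H n).toFun i x = PiTensorProduct.tprod k (Pi.mulSingle i x) := rfl

theorem power_induction {n : ℕ} {P : (⨂[k] _ : Fin n, H) → Prop}
    (tprod : ∀ v : Fin n → H, P (PiTensorProduct.tprod k v)) (add : ∀ s t, P s → P t → P (s + t))
    (hz : 0 < n) (t) : P t := by
  induction t using PiTensorProduct.induction_on with
  | add s t hs ht => exact add s t hs ht
  | smul_tprod c v =>
    have := PiTensorProduct.tprod k |>.map_update_smul v ⟨0, hz⟩ c (v ⟨0, hz⟩)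
    rw [Function.update_eq_self] at this
    rw [← this]
    exact tprod _

/-- If `σ(x₁) a j(x₂) = ε(x) a`, then a map containing the factor `σ(xᵢ) a j(xⱼ)` is invariant
under left multiplication through the bracket `ij`. -/
theorem eqL_unit {E : Type*} [Ring E] [Algebra k E] {σ j : H →ₗ[k] E} {a : E}
    (ha : ∀ x, mul2 (LinearMap.mulRight k a ∘ₗ σ) j (Q.Δ x) = Q.ε x • a)
    (hσ : σ 1 = 1) (hj : j 1 = 1) {n : ℕ} (hz : 0 < n) {C : (⨂[k] _ : Fin n, H) →ₗ[k] B}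
    {i i' : Fin n}
    (h : ∀ v : Fin n → H, ∃ P : E →ₗ[k] B, ∀ x y, C ((factors k H n).toFun i x *
      ((factors k H n).toFun i' y * PiTensorProduct.tprod k v)) = P (σ x * a * j y)) :
    Q.EqL (factors k H n) C (leaf i * leaf i') unit := by
  intro x w
  rw [leg_mul, leg_unit, ← Algebra.smul_def, map_smul]
  induction w using power_induction with
  | hz => exact hz
  | add s t hs ht => simp only [mul_add, map_add, smul_add, hs, ht]
  | tprod v =>
    obtain ⟨P, hP⟩ := h v
    have key : ∀ z : H ⊗[k] H, C (mul2 (Q.leg (factors k H n) (leaf i))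
        (Q.leg (factors k H n) (leaf i')) z * PiTensorProduct.tprod k v) =
        P (mul2 (LinearMap.mulRight k a ∘ₗ σ) j z) := by
      intro z
      induction z using tensor2_induction with
      | tmul x y =>
        rw [mul2_tmul, mul_assoc]
        exact hP x y
      | add z z' h1 h2 => simp only [map_add, add_mul, h1, h2]
    have h1 := hP 1 1
    rw [map_one, map_one, one_mul, one_mul, hσ, hj, one_mul, mul_one] at h1
    rw [key, ha, map_smul, h1]

/-- If `j(x₁) b σ(x₂) = ε(x) b`, then a map containing the factor `j(xᵢ) b σ(xⱼ)` is invariant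
under right multiplication through the bracket `ij`. -/
theorem eqR_unit {E : Type*} [Ring E] [Algebra k E] {σ j : H →ₗ[k] E} {b : E}
    (hb : ∀ x, mul2 (LinearMap.mulRight k b ∘ₗ j) σ (Q.Δ x) = Q.ε x • b)
    (hσ : σ 1 = 1) (hj : j 1 = 1) {n : ℕ} (hz : 0 < n) {C : (⨂[k] _ : Fin n, H) →ₗ[k] B}
    {i i' : Fin n}
    (h : ∀ v : Fin n → H, ∃ P : E →ₗ[k] B, ∀ x y, C (PiTensorProduct.tprod k v *
      ((factors k H n).toFun i x * (factors k H n).toFun i' y)) = P (j x * b * σ y)) :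
    Q.EqR (factors k H n) C (leaf i * leaf i') unit := by
  intro x w
  rw [leg_mul, leg_unit, ← Algebra.commutes, ← Algebra.smul_def, map_smul]
  induction w using power_induction with
  | hz => exact hz
  | add s t hs ht => simp only [add_mul, map_add, smul_add, hs, ht]
  | tprod v =>
    obtain ⟨P, hP⟩ := h v
    have key : ∀ z : H ⊗[k] H, C (PiTensorProduct.tprod k v *
        mul2 (Q.leg (factors k H n) (leaf i)) (Q.leg (factors k H n) (leaf i')) z) =
        P (mul2 (LinearMap.mulRight k b ∘ₗ j) σ z) := by
      intro z
      induction z using tensor2_induction with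
      | tmul x y => exact hP x y
      | add z z' h1 h2 => simp only [map_add, mul_add, h1, h2]
    have h1 := hP 1 1
    rw [map_one, map_one, one_mul, mul_one, hσ, hj, one_mul, mul_one] at h1
    rw [key, hb, map_smul, h1]

/-- A map containing the factor `S(xᵢ) α xⱼ` is invariant under left multiplication through
the bracket `ij`. -/
theorem eqL_unit_α {n : ℕ} (hz : 0 < n) {C : (⨂[k] _ : Fin n, H) →ₗ[k] B} {i j : Fin n}
    (h : ∀ v : Fin n → H, ∃ P : H →ₗ[k] B, ∀ x y, C ((factors k H n).toFun i x *
      ((factors k H n).toFun j y * PiTensorProduct.tprod k v)) = P (Q.S x * Q.α * y)) :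
    Q.EqL (factors k H n) C (leaf i * leaf j) unit :=
  eqL_unit (σ := Q.S.toLinearMap) (j := LinearMap.id) Q.antipode_left Q.S_one rfl hz h

/-- A map containing the factor `xᵢ β S(xⱼ)` is invariant under right multiplication through
the bracket `ij`. -/
theorem eqR_unit_β {n : ℕ} (hz : 0 < n) {C : (⨂[k] _ : Fin n, H) →ₗ[k] B} {i j : Fin n}
    (h : ∀ v : Fin n → H, ∃ P : H →ₗ[k] B, ∀ x y, C (PiTensorProduct.tprod k v *
      ((factors k H n).toFun i x * (factors k H n).toFun j y)) = P (x * Q.β * Q.S y)) :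
    Q.EqR (factors k H n) C (leaf i * leaf j) unit :=
  eqR_unit (σ := Q.S.toLinearMap) (j := LinearMap.id) Q.antipode_right Q.S_one rfl hz h

end QuasiHopfAlgebra

namespace QuasiHopfAlgebra

open Bracketing

variable {k H A B ι : Type*} [Field k] [Ring H] [Algebra k H] [Ring A] [Algebra k A]
  [AddCommGroup B] [Module k B] (Q : QuasiHopfAlgebra k H) (L : Legs k H A ι)

/-! ### The elements `γ` and `δ` -/

/-- The placement of `(1 ⊗ φ⁻¹) (id ⊗ id ⊗ Δ)(φ)` on the legs `a`, `b`, `c`, `d`. It maps the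
bracketing `(ab)(cd)` to the bracketing `a((bc)d)`. -/
def Γ (a b c d : Bracketing ι) : Aˣ := (Q.Φ L b c d)⁻¹ * Q.Φ L a b (c * d)

/-- The element `(1 ⊗ φ⁻¹) (id ⊗ id ⊗ Δ)(φ)` of `H ⊗ H ⊗ H ⊗ H`. -/
def gammaTensor : H ⊗[k] (H ⊗[k] (H ⊗[k] H)) :=
  ((1 : H) ⊗ₜ[k] Q.φinv) *
    Algebra.TensorProduct.map (AlgHom.id k H)
      (Algebra.TensorProduct.map (AlgHom.id k H) Q.Δ) (Q.φ : H ⊗[k] (H ⊗[k] H))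

/-- The inverse `(id ⊗ id ⊗ Δ)(φ⁻¹) (1 ⊗ φ)` of `gammaTensor`. -/
def deltaTensor : H ⊗[k] (H ⊗[k] (H ⊗[k] H)) :=
  Algebra.TensorProduct.map (AlgHom.id k H)
      (Algebra.TensorProduct.map (AlgHom.id k H) Q.Δ) Q.φinv *
    ((1 : H) ⊗ₜ[k] (Q.φ : H ⊗[k] (H ⊗[k] H)))

/-- The map `t ⊗ u ⊗ v ⊗ w ↦ S(u) α v ⊗ S(t) α w`. -/
def gammaContr : H ⊗[k] (H ⊗[k] (H ⊗[k] H)) →ₗ[k] H ⊗[k] H :=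
  LinearMap.mul' k (H ⊗[k] H) ∘ₗ TensorProduct.map
    (LinearMap.mulRight k (Q.α ⊗ₜ[k] Q.α) ∘ₗ Q.SS ∘ₗ flip) LinearMap.id ∘ₗ
      (TensorProduct.assoc k H H (H ⊗[k] H)).symm.toLinearMap

/-- The map `t ⊗ u ⊗ v ⊗ w ↦ t β S(w) ⊗ u β S(v)`. -/
def deltaContr : H ⊗[k] (H ⊗[k] (H ⊗[k] H)) →ₗ[k] H ⊗[k] H :=
  LinearMap.mul' k (H ⊗[k] H) ∘ₗ TensorProduct.map
    (LinearMap.mulRight k (Q.β ⊗ₜ[k] Q.β)) (Q.SS ∘ₗ flip) ∘ₗ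
      (TensorProduct.assoc k H H (H ⊗[k] H)).symm.toLinearMap

/-- The element `δ = K β S(N) ⊗ L β S(M)`, where `K ⊗ L ⊗ M ⊗ N = (id ⊗ id ⊗ Δ)(φ⁻¹) (1 ⊗ φ)`. -/
def δ : H ⊗[k] H := Q.deltaContr Q.deltaTensor

/-- The antimultiplicative map `a ↦ (S ⊗ S)(Δᵒᵖ(a))`. -/
def SΔop : H →ₗ[k] H ⊗[k] H := Q.SS ∘ₗ flip ∘ₗ Q.Δ.toLinearMap

/-- The map `x ⊗ y ⊗ z ↦ x β S(y) α z`. -/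
def zigzag : H ⊗[k] (H ⊗[k] H) →ₗ[k] H :=
  mul2 (LinearMap.mulRight k Q.β) (LinearMap.id (R := k) (M := H)) ∘ₗ
    TensorProduct.map LinearMap.id (mul2 (LinearMap.mulRight k Q.α ∘ₗ Q.S.toLinearMap) LinearMap.id)

/-- The map `x ⊗ y ⊗ z ↦ S(x) α y β S(z)`. -/
def zigzagInv : H ⊗[k] (H ⊗[k] H) →ₗ[k] H :=
  mul2 (LinearMap.mulRight k Q.α ∘ₗ Q.S.toLinearMap) (LinearMap.id (R := k) (M := H)) ∘ₗ
    TensorProduct.map LinearMap.id (mul2 (LinearMap.mulRight k Q.β) Q.S.toLinearMap)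

@[simp] theorem zigzag_tmul (x y z : H) :
    Q.zigzag (x ⊗ₜ (y ⊗ₜ z)) = x * Q.β * (Q.S y * Q.α * z) := rfl

@[simp] theorem zigzagInv_tmul (x y z : H) :
    Q.zigzagInv (x ⊗ₜ (y ⊗ₜ z)) = Q.S x * Q.α * (y * Q.β * Q.S z) := rfl

theorem zigzag_φ : Q.zigzag Q.φ = 1 := by
  rw [← Q.antipode_reassociator]
  induction (Q.φ : H ⊗[k] (H ⊗[k] H)) using tensor3_induction with
  | tmul x y z => rfl
  | add z z' h1 h2 => simp only [map_add, h1, h2]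

theorem zigzagInv_φinv : Q.zigzagInv Q.φinv = 1 := by
  rw [← Q.antipode_reassociator_inv]
  change _ = LinearMap.mul' k H (TensorProduct.map _ _ Q.φinv)
  induction Q.φinv using tensor3_induction with
  | tmul x y z => rfl
  | add z z' h1 h2 => simp only [map_add, h1, h2]

@[simp] theorem flip_tmul (x y : H) : flip (k := k) (x ⊗ₜ y) = y ⊗ₜ x := rfl

@[simp] theorem SS_tmul (x y : H) : Q.SS (x ⊗ₜ y) = Q.S x ⊗ₜ Q.S y := rfl

@[simp] theorem gammaContr_tmul (x y z w : H) : Q.gammaContr (x ⊗ₜ (y ⊗ₜ (z ⊗ₜ w))) =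
    (Q.S y * Q.α * z) ⊗ₜ (Q.S x * Q.α * w) := by
  simp [gammaContr]

@[simp] theorem deltaContr_tmul (x y z w : H) : Q.deltaContr (x ⊗ₜ (y ⊗ₜ (z ⊗ₜ w))) =
    (x * Q.β * Q.S w) ⊗ₜ (y * Q.β * Q.S z) := by
  simp [deltaContr]

theorem gammaContr_gammaTensor : Q.gammaContr Q.gammaTensor = Q.γ := rfl

theorem SS_mul (s t : H ⊗[k] H) : Q.SS (s * t) = Q.SS t * Q.SS s := by
  induction s using tensor2_induction with
  | add z z' h1 h2 => simp only [map_add, mul_add, add_mul, h1, h2]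
  | tmul x y =>
    induction t using tensor2_induction with
    | add z z' h1 h2 => simp only [map_add, mul_add, add_mul, h1, h2]
    | tmul x' y' => simp [Q.S_mul]

theorem flip_mul (s t : H ⊗[k] H) : flip (s * t) = flip s * flip t :=
  map_mul (Algebra.TensorProduct.comm k H H) s t

theorem SΔop_apply (x : H) : Q.SΔop x = Q.SS (flip (Q.Δ x)) := rfl

theorem SΔop_mul (x y : H) : Q.SΔop (x * y) = Q.SΔop y * Q.SΔop x := by
  rw [SΔop_apply, map_mul, flip_mul, SS_mul]; rfl

theorem SΔop_one : Q.SΔop 1 = 1 := by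
  rw [SΔop_apply, map_one, Algebra.TensorProduct.one_def]
  simp [Q.S_one]

variable {Q L}

theorem mul4_gammaTensor {a b c d : Bracketing ι} (h : (a * (b * (c * d))).Ok := by decide) :
    mul4 (Q.leg L a) (Q.leg L b) (Q.leg L c) (Q.leg L d) Q.gammaTensor = Q.Γ L a b c d := by
  rw [gammaTensor, (isMulMap_mul4_leg h).2, mul4_map_Δ, ← coe_Φ (c := c * d) h, mul4_tmul',
    (isMulMap_leg (ok_left h)).1, one_mul, Γ, Units.val_mul, coe_Φ_inv (ok_right h)]

theorem mul4_deltaTensor {a b c d : Bracketing ι} (h : (a * (b * (c * d))).Ok := by decide) :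
    mul4 (Q.leg L a) (Q.leg L b) (Q.leg L c) (Q.leg L d) Q.deltaTensor = ↑(Q.Γ L a b c d)⁻¹ := by
  rw [deltaTensor, (isMulMap_mul4_leg h).2, mul4_map_Δ, ← coe_Φ_inv (c := c * d) h, mul4_tmul',
    (isMulMap_leg (ok_left h)).1, one_mul, Γ, mul_inv_rev, inv_inv, Units.val_mul,
    coe_Φ (ok_right h)]

/-- `Γ` intertwines the bracketings `(ab)(cd)` and `a((bc)d)`. -/
theorem Γ_nat {a b c d : Bracketing ι} (h : (a * (b * (c * d))).Ok := by decide)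
    (h' : (b * (c * d) * a).Ok := by decide) :
    Q.Intw L (Q.Γ L a b c d) (a * b * (c * d)) (a * (b * c * d)) :=
  Intw.mul (Intw.node (Φ_comm h').inv (Φ_nat (ok_left h')).inv) (Φ_nat h)

@[simp] theorem leg_ofNat (n : ℕ) [OfNat ι n] (x : H) :
    Q.leg L ofNat(n) x = L.toFun ofNat(n) x := rfl

variable (Q)

/-- The linear map on a tensor power attached to an expression that is linear in each factor. -/
def contr {n : ℕ} (f : (Fin n → H) → B)
    (h₁ : ∀ (m : Fin n → H) (i : Fin n) (x y : H), f (Function.update m i (x + y)) =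
      f (Function.update m i x) + f (Function.update m i y))
    (h₂ : ∀ (m : Fin n → H) (i : Fin n) (c : k) (x : H), f (Function.update m i (c • x)) =
      c • f (Function.update m i x)) : (⨂[k] _ : Fin n, H) →ₗ[k] B :=
  PiTensorProduct.lift (MultilinearMap.mk' f h₁ h₂)

@[simp] theorem contr_tprod {n : ℕ} (f : (Fin n → H) → B) (h₁) (h₂) (v : Fin n → H) :
    contr (k := k) f h₁ h₂ (PiTensorProduct.tprod k v) = f v := by
  simp [contr]

/-- The map `S(x₁) α x₂ ⊗ S(x₀) α x₃`. -/
def gammaMap : (⨂[k] _ : Fin 4, H) →ₗ[k] H ⊗[k] H :=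
  contr (fun v => (Q.S (v 1) * Q.α * v 2) ⊗ₜ[k] (Q.S (v 0) * Q.α * v 3))
    (by intro v i x y
        fin_cases i <;> simp [Function.update, add_mul, mul_add, TensorProduct.tmul_add,
          TensorProduct.add_tmul])
    (by intro v i x y
        fin_cases i <;> simp [Function.update, ← TensorProduct.smul_tmul'])

variable {Q}

theorem eqL_gammaMap_12 : Q.EqL (factors k H 4) Q.gammaMap (1 * 2) unit := by
  refine eqL_unit_α (by norm_num) fun v => ⟨(TensorProduct.mk k H H).flip
    (Q.S (v 0) * Q.α * v 3) ∘ₗ LinearMap.mulRight k (v 2) ∘ₗ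
      LinearMap.mulLeft k (Q.S (v 1)), fun x y => ?_⟩
  simp [factors_apply, gammaMap, Q.S_mul, mul_assoc]

theorem eqL_gammaMap_03 : Q.EqL (factors k H 4) Q.gammaMap (0 * 3) unit := by
  refine eqL_unit_α (by norm_num) fun v => ⟨(TensorProduct.mk k H H)
    (Q.S (v 1) * Q.α * v 2) ∘ₗ LinearMap.mulRight k (v 3) ∘ₗ
      LinearMap.mulLeft k (Q.S (v 0)), fun x y => ?_⟩
  simp [factors_apply, gammaMap, Q.S_mul, mul_assoc]

/-- Splitting of a contraction along the outer and inner pairs of legs; the analogous statements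
for other contractions below serve to recognize the elements of the theory in them. -/
theorem gammaMap_mul (t : H ⊗[k] (H ⊗[k] (H ⊗[k] H))) (s s' : H ⊗[k] H) :
    Q.gammaMap (mul4 (Q.leg (factors k H 4) 0) (Q.leg (factors k H 4) 1)
      (Q.leg (factors k H 4) 2) (Q.leg (factors k H 4) 3) t *
        (mul2 (Q.leg (factors k H 4) 0) (Q.leg (factors k H 4) 1) s *
          mul2 (Q.leg (factors k H 4) 2) (Q.leg (factors k H 4) 3) s')) =
      Q.SS (flip s) * Q.gammaContr t * s' := by
  induction t using tensor4_induction with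
  | add z z' h1 h2 => simp only [map_add, mul_add, add_mul, h1, h2]
  | tmul x y z w =>
    induction s using tensor2_induction with
    | add z z' h1 h2 => simp only [map_add, mul_add, add_mul, h1, h2]
    | tmul x y =>
      induction s' using tensor2_induction with
      | add z z' h1 h2 => simp only [map_add, mul_add, h1, h2]
      | tmul x y =>
        simp [factors_apply, gammaMap, Q.S_mul, mul_assoc]

end QuasiHopfAlgebra

namespace QuasiHopfAlgebra

open Bracketing

variable {k H A B ι : Type*} [Field k] [Ring H] [Algebra k H] [Ring A] [Algebra k A]
  [AddCommGroup B] [Module k B] {Q : QuasiHopfAlgebra k H} {L : Legs k H A ι}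

theorem SΔop_mul_γ_mul_Δ (x y : H) : Q.SΔop x * Q.γ * Q.Δ y = Q.gammaMap
    (Q.Γ (factors k H 4) 0 1 2 3 *
      (Q.leg (factors k H 4) (0 * 1) x * Q.leg (factors k H 4) (2 * 3) y)) := by
  rw [← mul4_gammaTensor, leg_mul, leg_mul, gammaMap_mul, gammaContr_gammaTensor]
  rfl

/-- The pair formed by `a ↦ (S ⊗ S)(Δᵒᵖ(a))` and `γ` satisfies the rule of `S` and `α` along `Δ`:
`Γ` carries `(01)(23)` to `0((12)3)`, where the contraction removes first `12` and then `03`. -/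
theorem antipode_left_γ (x : H) :
    mul2 (LinearMap.mulRight k Q.γ ∘ₗ Q.SΔop) Q.Δ.toLinearMap (Q.Δ x) = Q.ε x • Q.γ := by
  have h1 : ∀ z : H ⊗[k] H, mul2 (LinearMap.mulRight k Q.γ ∘ₗ Q.SΔop) Q.Δ.toLinearMap z =
      Q.gammaMap (Q.Γ (factors k H 4) 0 1 2 3 *
        mul2 (Q.leg (factors k H 4) (0 * 1)) (Q.leg (factors k H 4) (2 * 3)) z) := by
    intro z
    induction z using tensor2_induction with
    | tmul x y => exact SΔop_mul_γ_mul_Δ x y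
    | add z z' h1 h2 => simp only [map_add, mul_add, h1, h2]
  have h2 : Q.EqL (factors k H 4) Q.gammaMap (0 * (1 * 2 * 3)) unit :=
    ((eqL_gammaMap_12.mul_right 3).congr_left 0).trans eqL_gammaMap_03
  have h3 := SΔop_mul_γ_mul_Δ (Q := Q) 1 1
  rw [Q.SΔop_one, map_one, mul_one, one_mul, (isMulMap_leg (by decide)).1,
    (isMulMap_leg (by decide)).1, mul_one, mul_one] at h3
  rw [h1, ← leg_mul, Γ_nat, h2, leg_unit, ← Algebra.smul_def, map_smul, h3]

/-! ### The twist `f` -/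

variable (Q) in
/-- The map `(S ⊗ S)(Δᵒᵖ(x₀)) γ Δ(x₁ β S(x₂))`. -/
def twistMap : (⨂[k] _ : Fin 3, H) →ₗ[k] H ⊗[k] H :=
  contr (fun v => Q.SΔop (v 0) * Q.γ * Q.Δ (v 1 * Q.β * Q.S (v 2)))
    (by intro v i x y
        fin_cases i <;> simp [Function.update, add_mul, mul_add])
    (by intro v i x y
        fin_cases i <;> simp [Function.update])

theorem eqL_twistMap : Q.EqL (factors k H 3) Q.twistMap (0 * 1) unit := by
  refine eqL_unit antipode_left_γ Q.SΔop_one (map_one Q.Δ) (by norm_num) fun v =>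
    ⟨LinearMap.mulRight k (Q.Δ (v 1 * Q.β * Q.S (v 2))) ∘ₗ LinearMap.mulLeft k (Q.SΔop (v 0)),
      fun x y => ?_⟩
  simp [factors_apply, twistMap, SΔop_mul, mul_assoc]

theorem eqR_twistMap : Q.EqR (factors k H 3) Q.twistMap (1 * 2) unit := by
  refine eqR_unit_β (by norm_num) fun v =>
    ⟨LinearMap.mulRight k (Q.Δ (Q.S (v 2))) ∘ₗ LinearMap.mulLeft k (Q.SΔop (v 0) * Q.γ * Q.Δ (v 1))
      ∘ₗ Q.Δ.toLinearMap, fun x y => ?_⟩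
  simp [factors_apply, twistMap, Q.S_mul, mul_assoc]

theorem f_eq_twistMap : Q.f = Q.twistMap ↑(Q.Φ (factors k H 3) 0 1 2)⁻¹ := by
  rw [coe_Φ_inv (by decide)]
  change LinearMap.mul' k (H ⊗[k] H) (TensorProduct.map _ _ Q.φinv) = _
  induction Q.φinv using tensor3_induction with
  | tmul x y z => simp [factors_apply, twistMap, SΔop, mul_assoc]
  | add z z' h1 h2 => simp only [map_add, h1, h2]

theorem twistMap_mul_leg (x : H) (w) : Q.twistMap (w * Q.leg (factors k H 3) 0 x) =
    Q.SΔop x * Q.twistMap w := by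
  induction w using power_induction with
  | hz => norm_num
  | tprod v => simp [factors_apply, twistMap, SΔop_mul, mul_assoc]
  | add z z' h1 h2 => simp only [map_add, add_mul, mul_add, h1, h2]

theorem twistMap_leg_mul (x : H) (w) : Q.twistMap (Q.leg (factors k H 3) 2 x * w) =
    Q.twistMap w * Q.Δ (Q.S x) := by
  induction w using power_induction with
  | hz => norm_num
  | tprod v => simp [factors_apply, twistMap, Q.S_mul, mul_assoc]
  | add z z' h1 h2 => simp only [map_add, add_mul, mul_add, h1, h2]

/-- `f Δ(S(a)) = (S ⊗ S)(Δᵒᵖ(a)) f`. -/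
theorem f_mul_Δ_S (x : H) : Q.f * Q.Δ (Q.S x) = Q.SΔop x * Q.f := by
  rw [f_eq_twistMap, ← twistMap_mul_leg, ← (eqR_twistMap.mul_left 0) x, ← twistMap_leg_mul,
    (Φ_nat (a := 0) (b := 1) (c := 2)).inv, (eqL_twistMap.mul_right 2) x]

/-- The map `(S ⊗ S)(Δᵒᵖ(x₀)) γ Δ(x₁ β S(x₂) α x₃)`. -/
def twistMap' (Q : QuasiHopfAlgebra k H) : (⨂[k] _ : Fin 4, H) →ₗ[k] H ⊗[k] H :=
  contr (fun v => Q.SΔop (v 0) * Q.γ * Q.Δ (v 1 * Q.β * Q.S (v 2) * Q.α * v 3))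
    (by intro v i x y
        fin_cases i <;> simp [Function.update, add_mul, mul_add])
    (by intro v i x y
        fin_cases i <;> simp [Function.update])

theorem eqL_twistMap'_01 : Q.EqL (factors k H 4) Q.twistMap' (0 * 1) unit := by
  refine eqL_unit antipode_left_γ Q.SΔop_one (map_one Q.Δ) (by norm_num) fun v =>
    ⟨LinearMap.mulRight k (Q.Δ (v 1 * Q.β * Q.S (v 2) * Q.α * v 3)) ∘ₗ
      LinearMap.mulLeft k (Q.SΔop (v 0)), fun x y => ?_⟩
  simp [factors_apply, twistMap', SΔop_mul, mul_assoc]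

theorem eqL_twistMap'_23 : Q.EqL (factors k H 4) Q.twistMap' (2 * 3) unit := by
  refine eqL_unit_α (by norm_num) fun v =>
    ⟨LinearMap.mulRight k (Q.Δ (v 3)) ∘ₗ
      LinearMap.mulLeft k (Q.SΔop (v 0) * Q.γ * Q.Δ (v 1 * Q.β * Q.S (v 2))) ∘ₗ
      Q.Δ.toLinearMap, fun x y => ?_⟩
  simp [factors_apply, twistMap', Q.S_mul, mul_assoc]

theorem eqR_twistMap' : Q.EqR (factors k H 4) Q.twistMap' (1 * 2) unit := by
  refine eqR_unit_β (by norm_num) fun v =>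
    ⟨LinearMap.mulRight k (Q.Δ (Q.S (v 2) * Q.α * v 3)) ∘ₗ
      LinearMap.mulLeft k (Q.SΔop (v 0) * Q.γ * Q.Δ (v 1)) ∘ₗ Q.Δ.toLinearMap, fun x y => ?_⟩
  simp [factors_apply, twistMap', Q.S_mul, mul_assoc]

section
local notation "φ₄" => Q.Φ (factors k H 4)

/-- `f Δ(α) = γ`. -/
theorem f_mul_Δ_α : Q.f * Q.Δ Q.α = Q.γ := by
  have h1 : Q.f * Q.Δ Q.α = Q.twistMap' ↑(φ₄ 0 1 2)⁻¹ := by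
    rw [coe_Φ_inv (by decide)]
    change LinearMap.mul' k (H ⊗[k] H) (TensorProduct.map _ _ Q.φinv) * _ = _
    induction Q.φinv using tensor3_induction with
    | tmul x y z => simp [factors_apply, twistMap', SΔop, mul_assoc]
    | add z z' h1 h2 => simp only [map_add, add_mul, h1, h2]
  have h2 : Q.twistMap' ↑(φ₄ 1 2 3) = Q.γ := by
    have h3 : ∀ t, Q.twistMap' (mul3 (Q.leg (factors k H 4) 1) (Q.leg (factors k H 4) 2)
        (Q.leg (factors k H 4) 3) t) = Q.γ * Q.Δ (Q.zigzag t) := by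
      intro t
      induction t using tensor3_induction with
      | tmul x y z => simp [factors_apply, twistMap', SΔop_one, mul_assoc]
      | add z z' h1 h2 => simp only [map_add, mul_add, h1, h2]
    rw [coe_Φ (by decide), h3, zigzag_φ, map_one, mul_one]
  rw [h1, ← h2]
  calc Q.twistMap' ↑(φ₄ 0 1 2)⁻¹
      = Q.twistMap' ↑(1 * (φ₄ (0 * 1) 2 3)⁻¹ * ((φ₄ 0 1 (2 * 3))⁻¹ * φ₄ 1 2 3 * φ₄ 0 (1 * 2) 3)) := by
        congr 2
        rw [one_mul, ← mul_assoc, ← mul_assoc, ← mul_inv_rev, pentagon_Φ]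
        group
    _ = Q.twistMap' ↑(1 * (φ₄ 0 1 (2 * 3))⁻¹ * (φ₄ 1 2 3 * φ₄ 0 (1 * 2) 3)) := by
        rw [eqL_twistMap'_01.Φ₁_inv (intw_one _) (intw_one _), Φ_unit₁]
        simp only [mul_assoc, inv_one, one_mul]
    _ = Q.twistMap' ↑(φ₄ 1 2 3 * φ₄ 0 (1 * 2) 3 * 1) := by
        rw [eqL_twistMap'_23.Φ₃_inv (intw_one _) (intw_one _), Φ_unit₃]
        simp only [inv_one, one_mul, mul_one]
    _ = Q.twistMap' ↑(φ₄ 1 2 3) := by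
        rw [eqR_twistMap'.Φ₂ (intw_one _) (intw_one _), Φ_unit₂]
        simp only [mul_one]

end

/-! ### Invertibility of the twist -/

/-- The map `S(x₁) α x₂ β S(x₅) ⊗ S(x₀) α x₃ β S(x₄)`. -/
def nestedZigzag (Q : QuasiHopfAlgebra k H) : (⨂[k] _ : Fin 6, H) →ₗ[k] H ⊗[k] H :=
  contr (fun v => (Q.S (v 1) * Q.α * v 2 * Q.β * Q.S (v 5)) ⊗ₜ[k]
      (Q.S (v 0) * Q.α * v 3 * Q.β * Q.S (v 4)))
    (by intro v i x y
        fin_cases i <;> simp [Function.update, add_mul, mul_add, TensorProduct.tmul_add,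
          TensorProduct.add_tmul])
    (by intro v i x y
        fin_cases i <;> simp [Function.update, ← TensorProduct.smul_tmul'])

theorem eqL_nestedZigzag_12 : Q.EqL (factors k H 6) Q.nestedZigzag (1 * 2) unit := by
  refine eqL_unit_α (by norm_num) fun v => ⟨(TensorProduct.mk k H H).flip
    (Q.S (v 0) * Q.α * v 3 * Q.β * Q.S (v 4)) ∘ₗ LinearMap.mulRight k (v 2 * Q.β * Q.S (v 5)) ∘ₗ
      LinearMap.mulLeft k (Q.S (v 1)), fun x y => ?_⟩
  simp [factors_apply, nestedZigzag, Q.S_mul, mul_assoc]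

theorem eqL_nestedZigzag_03 : Q.EqL (factors k H 6) Q.nestedZigzag (0 * 3) unit := by
  refine eqL_unit_α (by norm_num) fun v => ⟨(TensorProduct.mk k H H)
    (Q.S (v 1) * Q.α * v 2 * Q.β * Q.S (v 5)) ∘ₗ LinearMap.mulRight k (v 3 * Q.β * Q.S (v 4)) ∘ₗ
      LinearMap.mulLeft k (Q.S (v 0)), fun x y => ?_⟩
  simp [factors_apply, nestedZigzag, Q.S_mul, mul_assoc]

theorem eqR_nestedZigzag_25 : Q.EqR (factors k H 6) Q.nestedZigzag (2 * 5) unit := by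
  refine eqR_unit_β (by norm_num) fun v => ⟨(TensorProduct.mk k H H).flip
    (Q.S (v 0) * Q.α * v 3 * Q.β * Q.S (v 4)) ∘ₗ LinearMap.mulRight k (Q.S (v 5)) ∘ₗ
      LinearMap.mulLeft k (Q.S (v 1) * Q.α * v 2), fun x y => ?_⟩
  simp [factors_apply, nestedZigzag, Q.S_mul, mul_assoc]

theorem eqR_nestedZigzag_34 : Q.EqR (factors k H 6) Q.nestedZigzag (3 * 4) unit := by
  refine eqR_unit_β (by norm_num) fun v => ⟨(TensorProduct.mk k H H)
    (Q.S (v 1) * Q.α * v 2 * Q.β * Q.S (v 5)) ∘ₗ LinearMap.mulRight k (Q.S (v 4)) ∘ₗ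
      LinearMap.mulLeft k (Q.S (v 0) * Q.α * v 3), fun x y => ?_⟩
  simp [factors_apply, nestedZigzag, Q.S_mul, mul_assoc]

section

local notation "φ₆" => Q.Φ (factors k H 6)
local notation "l₆" => Q.leg (factors k H 6)

theorem nestedZigzag_mul (s s' : H ⊗[k] (H ⊗[k] (H ⊗[k] H))) (p q r : H ⊗[k] H) :
    Q.nestedZigzag (mul4 (l₆ 0) (l₆ 1) (l₆ 2) (l₆ 3) s * (mul2 (l₆ 0) (l₆ 1) p *
      (mul2 (l₆ 2) (l₆ 3) q * mul2 (l₆ 4) (l₆ 5) r)) * mul4 (l₆ 2) (l₆ 3) (l₆ 4) (l₆ 5) s') =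
      Q.SS (flip p) * Q.gammaContr s * q * Q.deltaContr s' * Q.SS (flip r) := by
  induction s using tensor4_induction with
  | add z z' h1 h2 => simp only [map_add, mul_add, add_mul, h1, h2]
  | tmul x y z w =>
  induction s' using tensor4_induction with
  | add z z' h1 h2 => simp only [map_add, mul_add, add_mul, h1, h2]
  | tmul x y z w =>
  induction p using tensor2_induction with
  | add z z' h1 h2 => simp only [map_add, mul_add, add_mul, h1, h2]
  | tmul x x' =>
  induction q using tensor2_induction with
  | add z z' h1 h2 => simp only [map_add, mul_add, add_mul, h1, h2]
  | tmul x x' =>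
  induction r using tensor2_induction with
  | add z z' h1 h2 => simp only [map_add, mul_add, add_mul, h1, h2]
  | tmul x x' => simp [factors_apply, nestedZigzag, Q.S_mul, mul_assoc]

theorem nestedZigzag_mul3 (s s' : H ⊗[k] (H ⊗[k] H)) :
    Q.nestedZigzag (mul3 (l₆ 0) (l₆ 3) (l₆ 4) s' * mul3 (l₆ 1) (l₆ 2) (l₆ 5) s) =
      Q.zigzagInv s ⊗ₜ Q.zigzagInv s' := by
  induction s using tensor3_induction with
  | add z z' h1 h2 => simp only [map_add, mul_add, h1, h2, TensorProduct.add_tmul]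
  | tmul x y z =>
  induction s' using tensor3_induction with
  | add z z' h1 h2 => simp only [map_add, add_mul, h1, h2, TensorProduct.tmul_add]
  | tmul x y z => simp [factors_apply, nestedZigzag, mul_assoc]

/-- Up to naturality and deletions, the word collapses to two nested copies of `φ⁻¹`, on the legs
`034` and `125`. -/
theorem nestedZigzag_coherence : Q.nestedZigzag
    ↑(Q.Γ (factors k H 6) 0 1 2 3 * (φ₆ (0 * 1) (2 * 3) (4 * 5))⁻¹ *
      (Q.Γ (factors k H 6) 2 3 4 5)⁻¹) = 1 := by
  have p1 := pentagon_Φ (Q := Q) (L := factors k H 6) (a := 0) (b := 1) (c := 2 * 3) (d := 4 * 5)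
  have p2 := pentagon_Φ (Q := Q) (L := factors k H 6) (a := 1) (b := 2) (c := 3) (d := 4 * 5)
  have p3 := pentagon_Φ (Q := Q) (L := factors k H 6) (a := 0) (b := 3) (c := 4) (d := 5)
  have n1 : (φ₆ 2 3 (4 * 5)) * φ₆ 0 1 (2 * 3 * (4 * 5)) =
      φ₆ 0 1 (2 * (3 * (4 * 5))) * φ₆ 2 3 (4 * 5) := Intw.Φ Φ_comm Φ_comm Φ_nat
  have n2 : (φ₆ 3 4 5) * φ₆ 0 1 (2 * (3 * 4 * 5)) =
      φ₆ 0 1 (2 * (3 * (4 * 5))) * φ₆ 3 4 5 := Intw.Φ Φ_comm Φ_comm (Intw.node Φ_comm Φ_nat)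
  have n3 : (φ₆ 1 2 3) * φ₆ 0 (1 * 2 * 3) (4 * 5) =
      φ₆ 0 (1 * (2 * 3)) (4 * 5) * φ₆ 1 2 3 := Intw.Φ Φ_comm Φ_nat Φ_comm
  have n4 : (φ₆ 3 4 5) * φ₆ 1 2 (3 * 4 * 5) =
      φ₆ 1 2 (3 * (4 * 5)) * φ₆ 3 4 5 := Intw.Φ Φ_comm Φ_comm Φ_nat
  have word : Q.Γ (factors k H 6) 0 1 2 3 * (φ₆ (0 * 1) (2 * 3) (4 * 5))⁻¹ *
      (Q.Γ (factors k H 6) 2 3 4 5)⁻¹ = (φ₆ 0 (1 * 2 * 3) (4 * 5))⁻¹ * (φ₆ (1 * 2) 3 (4 * 5))⁻¹ *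
        φ₆ 3 4 5 * (φ₆ 1 2 (3 * 4 * 5))⁻¹ * φ₆ 0 1 (2 * (3 * 4 * 5)) := by
    rw [← eq_inv_mul_iff_mul_eq] at p1 p2 n1 n2 n3 n4
    rw [Γ, Γ, p1, p2, n1, n3, n4, n2]
    group
  have r1 : Q.EqR (factors k H 6) Q.nestedZigzag (2 * (3 * 4 * 5)) unit :=
    ((eqR_nestedZigzag_34.mul_right 5).congr_left 2).trans eqR_nestedZigzag_25
  have p3' : (φ₆ (0 * 3) 4 5)⁻¹ * (φ₆ 0 3 (4 * 5))⁻¹ * φ₆ 3 4 5 =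
      (φ₆ 0 3 4)⁻¹ * (φ₆ 0 (3 * 4) 5)⁻¹ := by
    rw [← mul_inv_rev, p3]
    group
  rw [word]
  calc Q.nestedZigzag ↑((φ₆ 0 (1 * 2 * 3) (4 * 5))⁻¹ * (φ₆ (1 * 2) 3 (4 * 5))⁻¹ *
        φ₆ 3 4 5 * (φ₆ 1 2 (3 * 4 * 5))⁻¹ * φ₆ 0 1 (2 * (3 * 4 * 5)))
      = Q.nestedZigzag ↑((φ₆ 0 (1 * 2 * 3) (4 * 5))⁻¹ * (φ₆ (1 * 2) 3 (4 * 5))⁻¹ *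
        φ₆ 3 4 5 * (φ₆ 1 2 (3 * 4 * 5))⁻¹ * φ₆ 0 1 (2 * (3 * 4 * 5)) * 1) := by rw [mul_one]
    _ = Q.nestedZigzag ↑((φ₆ 0 (1 * 2 * 3) (4 * 5))⁻¹ * (φ₆ (1 * 2) 3 (4 * 5))⁻¹ *
        φ₆ 3 4 5 * (φ₆ 1 2 (3 * 4 * 5))⁻¹ * 1) := by
      rw [r1.Φ₃ (intw_one _) (intw_one _), Φ_unit₃, mul_one]
    _ = Q.nestedZigzag ↑(1 * (φ₆ 0 (1 * 2 * 3) (4 * 5))⁻¹ * ((φ₆ (1 * 2) 3 (4 * 5))⁻¹ *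
        φ₆ 3 4 5 * (φ₆ 1 2 5)⁻¹)) := by
      rw [(eqR_nestedZigzag_34.mul_right 5).Φ₃_inv (intw_one _) (intw_one _)]
      simp only [mul_assoc, mul_one, one_mul]
    _ = Q.nestedZigzag ↑((φ₆ 0 3 (4 * 5))⁻¹ * (φ₆ (1 * 2) 3 (4 * 5))⁻¹ *
        (φ₆ 3 4 5 * (φ₆ 1 2 5)⁻¹)) := by
      rw [(eqL_nestedZigzag_12.mul_right 3).Φ₂_inv (intw_one _) (intw_one _)]
      simp only [mul_assoc, one_mul]
    _ = Q.nestedZigzag ↑((φ₆ 0 3 (4 * 5))⁻¹ * (φ₆ 3 4 5 * (φ₆ 1 2 5)⁻¹)) := by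
      rw [eqL_nestedZigzag_12.Φ₁_inv (Intw.inv Φ_comm) (intw_unit _), Φ_unit₁, inv_one, mul_one]
    -- The factor inserted here is deleted by the bracket `03`; it completes a pentagon.
    _ = Q.nestedZigzag ↑(1 * (φ₆ (0 * 3) 4 5)⁻¹ *
          ((φ₆ 0 3 (4 * 5))⁻¹ * (φ₆ 3 4 5 * (φ₆ 1 2 5)⁻¹))) := by
      rw [eqL_nestedZigzag_03.Φ₁_inv (intw_one _) (intw_one _), Φ_unit₁, inv_one, mul_one, one_mul]
    _ = Q.nestedZigzag ↑((φ₆ 0 3 4)⁻¹ * (φ₆ 0 (3 * 4) 5)⁻¹ * (φ₆ 1 2 5)⁻¹) := by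
      rw [← p3']
      simp only [mul_assoc, one_mul]
    _ = Q.nestedZigzag ↑((φ₆ 0 3 4)⁻¹ * (φ₆ 1 2 5)⁻¹) := by
      rw [eqR_nestedZigzag_34.Φ₂_inv (Intw.inv Φ_comm) (intw_unit _), Φ_unit₂, inv_one, mul_one]
    _ = Q.zigzagInv Q.φinv ⊗ₜ Q.zigzagInv Q.φinv := by
      rw [Units.val_mul, coe_Φ_inv (by decide), coe_Φ_inv (by decide), nestedZigzag_mul3]
    _ = 1 := by rw [zigzagInv_φinv]; rfl

variable (Q) in
/-- The map `x ⊗ y ⊗ z ↦ Δ(S(x)) Δ(α) Δ(y) δ (S ⊗ S)(Δᵒᵖ(z))`, which takes `φ⁻¹` to `f⁻¹`. -/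
def twistInvMap : H ⊗[k] (H ⊗[k] H) →ₗ[k] H ⊗[k] H :=
  mul3 (LinearMap.mulRight k (Q.Δ Q.α) ∘ₗ Q.Δ.toLinearMap ∘ₗ Q.S.toLinearMap)
    (LinearMap.mulRight k Q.δ ∘ₗ Q.Δ.toLinearMap) Q.SΔop

/-- `f Δ(S(x) α y) δ (S ⊗ S)(Δᵒᵖ(z)) = (S ⊗ S)(Δᵒᵖ(x)) γ Δ(y) δ (S ⊗ S)(Δᵒᵖ(z))`, and the right
side is the nested zigzag evaluated in `nestedZigzag_coherence`. -/
theorem f_mul_twistInvMap : Q.f * Q.twistInvMap Q.φinv = 1 := by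
  rw [← nestedZigzag_coherence (Q := Q)]
  rw [Units.val_mul, Units.val_mul, coe_Φ_inv (by decide), ← mul4_gammaTensor,
    ← mul4_deltaTensor]
  induction Q.φinv using tensor3_induction with
  | add z z' h1 h2 => simp only [map_add, mul_add, add_mul, h1, h2]
  | tmul x y z =>
    rw [mul3_tmul, leg_mul, leg_mul, leg_mul, nestedZigzag_mul, gammaContr_gammaTensor]
    change Q.f * (Q.Δ (Q.S x) * Q.Δ Q.α * (Q.Δ y * Q.δ * Q.SΔop z)) =
      Q.SΔop x * Q.γ * Q.Δ y * Q.δ * Q.SΔop z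
    rw [← f_mul_Δ_α, ← mul_assoc, ← mul_assoc Q.f, f_mul_Δ_S]
    simp only [mul_assoc]

end

section Finite

variable [FiniteDimensional k H]

/-- Drinfeld's theorem: the twist is invertible. -/
theorem isUnit_f : IsUnit Q.f := by
  have : IsArtinianRing (H ⊗[k] H) := IsArtinianRing.of_finite k _
  exact IsUnit.of_mul_eq_one _ f_mul_twistInvMap

variable (Q) in
/-- The inverse of the twist. -/
def g : H ⊗[k] H := Ring.inverse Q.f

theorem f_mul_g : Q.f * Q.g = 1 := Ring.mul_inverse_cancel _ isUnit_f

theorem g_mul_f : Q.g * Q.f = 1 := Ring.inverse_mul_cancel _ isUnit_f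

end Finite

/-! ### The elements `p_R` and `q_R` -/

variable (k H) in
/-- The embedding `x ↦ x ⊗ 1`. -/
abbrev inL : H →ₐ[k] H ⊗[k] H := Algebra.TensorProduct.includeLeft

variable (k H) in
/-- The embedding `x ↦ 1 ⊗ x`. -/
abbrev inR : H →ₐ[k] H ⊗[k] H := Algebra.TensorProduct.includeRight

/-- The morphism `id ⊗ Δ : H ⊗ H → H ⊗ H ⊗ H`. -/
def idΔ (Q : QuasiHopfAlgebra k H) : H ⊗[k] H →ₐ[k] H ⊗[k] (H ⊗[k] H) :=
  Algebra.TensorProduct.map (AlgHom.id k H) Q.Δ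

/-- The morphism `Δ ⊗ id : H ⊗ H → H ⊗ H ⊗ H`. -/
def Δid (Q : QuasiHopfAlgebra k H) : H ⊗[k] H →ₐ[k] H ⊗[k] (H ⊗[k] H) :=
  (Algebra.TensorProduct.assoc k k k H H H).toAlgHom.comp
    (Algebra.TensorProduct.map Q.Δ (AlgHom.id k H))

theorem Δid_tmul (x y : H) :
    Q.Δid (x ⊗ₜ y) = TensorProduct.assoc k H H H (Q.Δ x ⊗ₜ y) := rfl

theorem idΔ_tmul (x y : H) : Q.idΔ (x ⊗ₜ y) = x ⊗ₜ Q.Δ y := rfl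

theorem idΔ_Δ_mul_φ (a : H) : Q.idΔ (Q.Δ a) * Q.φ = Q.φ * Q.Δid (Q.Δ a) := Q.quasi_coassoc a

/-- The map `x ⊗ y ⊗ z ↦ x ⊗ S(y) n z`. -/
def innerContr (Q : QuasiHopfAlgebra k H) (n : H) : H ⊗[k] (H ⊗[k] H) →ₗ[k] H ⊗[k] H :=
  TensorProduct.map LinearMap.id (mul2 (LinearMap.mulRight k n ∘ₗ Q.S.toLinearMap) LinearMap.id)

/-- The map `S(x₁) α x₂ ⊗ S(x₀)`. -/
def qMap (Q : QuasiHopfAlgebra k H) : (⨂[k] _ : Fin 3, H) →ₗ[k] H ⊗[k] H :=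
  contr (fun v => (Q.S (v 1) * Q.α * v 2) ⊗ₜ[k] Q.S (v 0))
    (by intro v i x y
        fin_cases i <;> simp [Function.update, add_mul, mul_add, TensorProduct.tmul_add,
          TensorProduct.add_tmul])
    (by intro v i x y
        fin_cases i <;> simp [Function.update, ← TensorProduct.smul_tmul'])

theorem eqL_qMap : Q.EqL (factors k H 3) Q.qMap (1 * 2) unit := by
  refine eqL_unit_α (by norm_num) fun v => ⟨(TensorProduct.mk k H H).flip
    (Q.S (v 0)) ∘ₗ LinearMap.mulRight k (v 2) ∘ₗ LinearMap.mulLeft k (Q.S (v 1)), fun x y => ?_⟩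
  simp [factors_apply, qMap, Q.S_mul, mul_assoc]

theorem SS_flip_qR : Q.SS (flip Q.qR) = Q.qMap (Q.Φ (factors k H 3) 0 1 2) := by
  rw [coe_Φ (by decide), qR]
  induction (Q.φ : H ⊗[k] (H ⊗[k] H)) using tensor3_induction with
  | tmul x y z => simp [factors_apply, qMap, Q.S_mul, mul_assoc]
  | add z z' h1 h2 => simp only [map_add, h1, h2]

theorem qMap_leg_mul (x : H) (w) : Q.qMap (Q.leg (factors k H 3) 0 x * w) =
    Q.qMap w * inR k H (Q.S x) := by
  induction w using power_induction with
  | hz => norm_num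
  | tprod v => simp [factors_apply, qMap, Q.S_mul]
  | add z z' h1 h2 => simp only [map_add, add_mul, mul_add, h1, h2]

theorem qMap_mul_mul2 (w) (t : H ⊗[k] H) (y : H) :
    Q.qMap (w * (mul2 (Q.leg (factors k H 3) 0) (Q.leg (factors k H 3) 1) t *
      Q.leg (factors k H 3) 2 y)) = Q.SS (flip t) * Q.qMap w * inL k H y := by
  induction w using power_induction with
  | hz => norm_num
  | add z z' h1 h2 => simp only [map_add, add_mul, mul_add, h1, h2]
  | tprod v =>
  induction t using tensor2_induction with
  | tmul x x' => simp [factors_apply, qMap, Q.S_mul, mul_assoc]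
  | add z z' h1 h2 => simp only [map_add, add_mul, mul_add, h1, h2]

/-- `(S ⊗ S)(Δᵒᵖ(a₁)) q (a₂ ⊗ 1) = q (1 ⊗ S(a))` for `q = (S ⊗ S)(q_R²¹)`. -/
theorem SΔop_mul_qR (a : H) : mul2 (LinearMap.mulRight k (Q.SS (flip Q.qR)) ∘ₗ Q.SΔop)
    (inL k H).toLinearMap (Q.Δ a) = Q.SS (flip Q.qR) * inR k H (Q.S a) := by
  have h1 : ∀ z : H ⊗[k] H, mul2 (LinearMap.mulRight k (Q.SS (flip Q.qR)) ∘ₗ Q.SΔop)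
      (inL k H).toLinearMap z = Q.qMap (Q.Φ (factors k H 3) 0 1 2 *
        mul2 (Q.leg (factors k H 3) (0 * 1)) (Q.leg (factors k H 3) 2) z) := by
    intro z
    induction z using tensor2_induction with
    | tmul x y => rw [mul2_tmul, mul2_tmul, leg_mul, qMap_mul_mul2, SS_flip_qR]; rfl
    | add z z' h1 h2 => simp only [map_add, mul_add, h1, h2]
  rw [h1, ← leg_mul, Φ_nat, (eqL_qMap.mul_left 0) a, qMap_leg_mul, SS_flip_qR]

/-- The map `x₀ ⊗ x₁ β S(x₂)`. -/
def pMap (Q : QuasiHopfAlgebra k H) : (⨂[k] _ : Fin 3, H) →ₗ[k] H ⊗[k] H :=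
  contr (fun v => v 0 ⊗ₜ[k] (v 1 * Q.β * Q.S (v 2)))
    (by intro v i x y
        fin_cases i <;> simp [Function.update, add_mul, mul_add, TensorProduct.tmul_add,
          TensorProduct.add_tmul])
    (by intro v i x y
        fin_cases i <;> simp [Function.update, ← TensorProduct.smul_tmul'])

theorem eqR_pMap : Q.EqR (factors k H 3) Q.pMap (1 * 2) unit := by
  refine eqR_unit_β (by norm_num) fun v => ⟨TensorProduct.mk k H H (v 0) ∘ₗ
    LinearMap.mulRight k (Q.S (v 2)) ∘ₗ LinearMap.mulLeft k (v 1), fun x y => ?_⟩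
  simp [factors_apply, pMap, Q.S_mul, mul_assoc]

theorem pR_eq : Q.pR = Q.pMap ↑(Q.Φ (factors k H 3) 0 1 2)⁻¹ := by
  rw [coe_Φ_inv (by decide), pR]
  induction Q.φinv using tensor3_induction with
  | tmul x y z => simp [factors_apply, pMap]
  | add z z' h1 h2 => simp only [map_add, h1, h2]

theorem pMap_mul_leg (x : H) (w) : Q.pMap (w * Q.leg (factors k H 3) 0 x) =
    Q.pMap w * inL k H x := by
  induction w using power_induction with
  | hz => norm_num
  | tprod v => simp [factors_apply, pMap]
  | add z z' h1 h2 => simp only [map_add, add_mul, h1, h2]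

theorem pMap_mul2_mul (w) (t : H ⊗[k] H) (y : H) :
    Q.pMap ((mul2 (Q.leg (factors k H 3) 0) (Q.leg (factors k H 3) 1) t *
      Q.leg (factors k H 3) 2 y) * w) = t * Q.pMap w * inR k H (Q.S y) := by
  induction w using power_induction with
  | hz => norm_num
  | add z z' h1 h2 => simp only [map_add, add_mul, mul_add, h1, h2]
  | tprod v =>
  induction t using tensor2_induction with
  | tmul x x' => simp [factors_apply, pMap, Q.S_mul, mul_assoc]
  | add z z' h1 h2 => simp only [map_add, add_mul, h1, h2]

/-- `Δ(a₁) p (1 ⊗ S(a₂)) = p (a ⊗ 1)` for `p = p_R`. -/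
theorem Δ_mul_pR (a : H) : mul2 (LinearMap.mulRight k Q.pR ∘ₗ Q.Δ.toLinearMap)
    ((inR k H).toLinearMap ∘ₗ Q.S.toLinearMap) (Q.Δ a) = Q.pR * inL k H a := by
  have h1 : ∀ z : H ⊗[k] H, mul2 (LinearMap.mulRight k Q.pR ∘ₗ Q.Δ.toLinearMap)
      ((inR k H).toLinearMap ∘ₗ Q.S.toLinearMap) z = Q.pMap (
        mul2 (Q.leg (factors k H 3) (0 * 1)) (Q.leg (factors k H 3) 2) z *
          ↑(Q.Φ (factors k H 3) 0 1 2)⁻¹) := by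
    intro z
    induction z using tensor2_induction with
    | tmul x y => rw [mul2_tmul, mul2_tmul, leg_mul, pMap_mul2_mul, ← pR_eq]; rfl
    | add z z' h1 h2 => simp only [map_add, add_mul, h1, h2]
  rw [h1, ← leg_mul, ← (Intw.inv Φ_nat), (eqR_pMap.mul_left 0) a, pMap_mul_leg, pR_eq]

/-- The map `x₀ ⊗ x₁ β S(x₂) α x₃`. -/
def qpMap (Q : QuasiHopfAlgebra k H) : (⨂[k] _ : Fin 4, H) →ₗ[k] H ⊗[k] H :=
  contr (fun v => v 0 ⊗ₜ[k] (v 1 * Q.β * Q.S (v 2) * Q.α * v 3))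
    (by intro v i x y
        fin_cases i <;> simp [Function.update, add_mul, mul_add, TensorProduct.tmul_add,
          TensorProduct.add_tmul])
    (by intro v i x y
        fin_cases i <;> simp [Function.update, ← TensorProduct.smul_tmul'])

theorem eqL_qpMap : Q.EqL (factors k H 4) Q.qpMap (2 * 3) unit := by
  refine eqL_unit_α (by norm_num) fun v => ⟨TensorProduct.mk k H H (v 0) ∘ₗ
    LinearMap.mulRight k (v 3) ∘ₗ LinearMap.mulLeft k (v 1 * Q.β * Q.S (v 2)), fun x y => ?_⟩
  simp [factors_apply, qpMap, Q.S_mul, mul_assoc]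

theorem eqR_qpMap : Q.EqR (factors k H 4) Q.qpMap (1 * 2) unit := by
  refine eqR_unit_β (by norm_num) fun v => ⟨TensorProduct.mk k H H (v 0) ∘ₗ
    LinearMap.mulRight k (Q.S (v 2) * Q.α * v 3) ∘ₗ LinearMap.mulLeft k (v 1), fun x y => ?_⟩
  simp [factors_apply, qpMap, Q.S_mul, mul_assoc]

/-- The map `x₀ ⊗ S(x₁) α x₂ β S(x₃)`. -/
def pqMap (Q : QuasiHopfAlgebra k H) : (⨂[k] _ : Fin 4, H) →ₗ[k] H ⊗[k] H :=
  contr (fun v => v 0 ⊗ₜ[k] (Q.S (v 1) * Q.α * v 2 * Q.β * Q.S (v 3)))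
    (by intro v i x y
        fin_cases i <;> simp [Function.update, add_mul, mul_add, TensorProduct.tmul_add,
          TensorProduct.add_tmul])
    (by intro v i x y
        fin_cases i <;> simp [Function.update, ← TensorProduct.smul_tmul'])

theorem eqL_pqMap : Q.EqL (factors k H 4) Q.pqMap (1 * 2) unit := by
  refine eqL_unit_α (by norm_num) fun v => ⟨TensorProduct.mk k H H (v 0) ∘ₗ
    LinearMap.mulRight k (v 2 * Q.β * Q.S (v 3)) ∘ₗ LinearMap.mulLeft k (Q.S (v 1)),
      fun x y => ?_⟩
  simp [factors_apply, pqMap, Q.S_mul, mul_assoc]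

theorem eqR_pqMap : Q.EqR (factors k H 4) Q.pqMap (2 * 3) unit := by
  refine eqR_unit_β (by norm_num) fun v => ⟨TensorProduct.mk k H H (v 0) ∘ₗ
    LinearMap.mulRight k (Q.S (v 3)) ∘ₗ LinearMap.mulLeft k (Q.S (v 1) * Q.α * v 2),
      fun x y => ?_⟩
  simp [factors_apply, pqMap, Q.S_mul, mul_assoc]

section
local notation "φ₄" => Q.Φ (factors k H 4)
local notation "l₄" => Q.leg (factors k H 4)

theorem qpMap_coherence : Q.qpMap ↑(φ₄ (0 * 1) 2 3 * (φ₄ 0 1 2)⁻¹) = 1 := by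
  have p := pentagon_Φ (Q := Q) (L := factors k H 4) (a := 0) (b := 1) (c := 2) (d := 3)
  have h3 : ∀ t, Q.qpMap (mul3 (l₄ 1) (l₄ 2) (l₄ 3) t) = 1 ⊗ₜ Q.zigzag t := by
    intro t
    induction t using tensor3_induction with
    | tmul x y z => simp [factors_apply, qpMap, mul_assoc]
    | add z z' h1 h2 => simp only [map_add, TensorProduct.tmul_add, h1, h2]
  calc Q.qpMap ↑(φ₄ (0 * 1) 2 3 * (φ₄ 0 1 2)⁻¹)
      = Q.qpMap ↑(1 * (φ₄ 0 1 (2 * 3))⁻¹ * (φ₄ 1 2 3 * φ₄ 0 (1 * 2) 3)) := by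
        rw [← eq_inv_mul_iff_mul_eq] at p
        rw [p]
        congr 2
        group
    _ = Q.qpMap ↑(φ₄ 1 2 3 * φ₄ 0 (1 * 2) 3 * 1) := by
        rw [eqL_qpMap.Φ₃_inv (intw_one _) (intw_one _), Φ_unit₃]
        simp only [inv_one, one_mul, mul_one]
    _ = 1 := by
        rw [eqR_qpMap.Φ₂ (intw_one _) (intw_one _), Φ_unit₂, mul_one, mul_one,
          coe_Φ (by decide), h3, zigzag_φ, Algebra.TensorProduct.one_def]

theorem pqMap_coherence : Q.pqMap ↑(φ₄ 0 1 2 * (φ₄ (0 * 1) 2 3)⁻¹) = 1 := by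
  have p := pentagon_Φ (Q := Q) (L := factors k H 4) (a := 0) (b := 1) (c := 2) (d := 3)
  have h3 : ∀ t, Q.pqMap (mul3 (l₄ 1) (l₄ 2) (l₄ 3) t) = 1 ⊗ₜ Q.zigzagInv t := by
    intro t
    induction t using tensor3_induction with
    | tmul x y z => simp [factors_apply, pqMap, mul_assoc]
    | add z z' h1 h2 => simp only [map_add, TensorProduct.tmul_add, h1, h2]
  calc Q.pqMap ↑(φ₄ 0 1 2 * (φ₄ (0 * 1) 2 3)⁻¹)
      = Q.pqMap ↑(1 * (φ₄ 0 (1 * 2) 3)⁻¹ * ((φ₄ 1 2 3)⁻¹ * φ₄ 0 1 (2 * 3))) := by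
        rw [← eq_inv_mul_iff_mul_eq] at p
        rw [p]
        congr 2
        group
    _ = Q.pqMap ↑((φ₄ 1 2 3)⁻¹ * φ₄ 0 1 (2 * 3) * 1) := by
        rw [eqL_pqMap.Φ₂_inv (intw_one _) (intw_one _), Φ_unit₂]
        simp only [inv_one, one_mul, mul_one]
    _ = 1 := by
        rw [eqR_pqMap.Φ₃ (intw_one _) (intw_one _), Φ_unit₃, mul_one, mul_one,
          coe_Φ_inv (by decide), h3, zigzagInv_φinv, Algebra.TensorProduct.one_def]

/-- `Δ(q¹) p (1 ⊗ S(q²)) = 1`. -/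
theorem Δ_qR_mul_pR : mul2 (LinearMap.mulRight k Q.pR ∘ₗ Q.Δ.toLinearMap)
    ((inR k H).toLinearMap ∘ₗ Q.S.toLinearMap) Q.qR = 1 := by
  rw [← qpMap_coherence (Q := Q), Units.val_mul, coe_Φ (by decide), coe_Φ_inv (by decide), qR, pR]
  induction (Q.φ : H ⊗[k] (H ⊗[k] H)) using tensor3_induction with
  | add z z' h1 h2 => simp only [map_add, add_mul, h1, h2]
  | tmul x y z =>
  have h : ∀ t s, t * (TensorProduct.map LinearMap.id (LinearMap.mul' k H ∘ₗ
      TensorProduct.map (LinearMap.mulRight k Q.β) Q.S.toLinearMap) s) *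
      inR k H (Q.S y * Q.α * z) = Q.qpMap (mul2 (l₄ 0) (l₄ 1) t * (l₄ 2 y * l₄ 3 z) *
        mul3 (l₄ 0) (l₄ 1) (l₄ 2) s) := by
    intro t s
    induction t using tensor2_induction with
    | add z z' h1 h2 => simp only [map_add, add_mul, h1, h2]
    | tmul a b =>
    induction s using tensor3_induction with
    | add z z' h1 h2 => simp only [map_add, add_mul, mul_add, h1, h2]
    | tmul x y z => simp [factors_apply, qpMap, mul_assoc, Q.S_mul]
  rw [mul3_tmul, leg_mul, ← h]
  simp [Q.S_mul, mul_assoc]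

/-- With `X ⊗ Y ⊗ Z = φ` and `p = p_R`, this is `X p¹₁ ⊗ S(Y p¹₂) α Z p² = 1`. -/
theorem innerContr_φ_mul_Δ_pR : Q.innerContr Q.α (Q.φ * Q.Δid Q.pR) = 1 := by
  rw [← pqMap_coherence (Q := Q), Units.val_mul, coe_Φ (by decide), coe_Φ_inv (by decide), pR]
  induction Q.φinv using tensor3_induction with
  | add z z' h1 h2 => simp only [map_add, mul_add, h1, h2]
  | tmul x y z =>
  have h : ∀ t s, Q.innerContr Q.α (t * TensorProduct.assoc k H H H (s ⊗ₜ (y * Q.β * Q.S z))) =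
      Q.pqMap (mul3 (l₄ 0) (l₄ 1) (l₄ 2) t * (mul2 (l₄ 0) (l₄ 1) s * (l₄ 2 y * l₄ 3 z))) := by
    intro t s
    induction t using tensor3_induction with
    | add z z' h1 h2 => simp only [map_add, add_mul, h1, h2]
    | tmul a b c =>
    induction s using tensor2_induction with
    | add z z' h1 h2 => simp only [map_add, add_mul, mul_add, TensorProduct.add_tmul, h1, h2]
    | tmul x y => simp [factors_apply, pqMap, innerContr, mul_assoc, Q.S_mul]
  rw [mul3_tmul, leg_mul, ← h]
  rfl

/-- The map `S(x₀ β S(x₁) α x₂) α x₃`. -/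
def antipodeMap (Q : QuasiHopfAlgebra k H) : (⨂[k] _ : Fin 4, H) →ₗ[k] H :=
  contr (fun v => Q.S (v 0 * Q.β * (Q.S (v 1) * Q.α * v 2)) * Q.α * v 3)
    (by intro v i x y
        fin_cases i <;> simp [Function.update, add_mul, mul_add])
    (by intro v i x y
        fin_cases i <;> simp [Function.update])

theorem eqL_antipodeMap : Q.EqL (factors k H 4) Q.antipodeMap (1 * 2) unit := by
  refine eqL_unit_α (by norm_num) fun v => ⟨LinearMap.mulRight k (Q.α * v 3) ∘ₗ
    Q.S.toLinearMap ∘ₗ LinearMap.mulLeft k (v 0 * Q.β) ∘ₗ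
    LinearMap.mulRight k (v 2) ∘ₗ LinearMap.mulLeft k (Q.S (v 1)), fun x y => ?_⟩
  simp [factors_apply, antipodeMap, Q.S_mul, mul_assoc]

theorem eqR_antipodeMap : Q.EqR (factors k H 4) Q.antipodeMap (0 * 1) unit := by
  refine eqR_unit_β (by norm_num) fun v => ⟨LinearMap.mulRight k (Q.α * v 3) ∘ₗ
    Q.S.toLinearMap ∘ₗ LinearMap.mulLeft k (v 0) ∘ₗ
    LinearMap.mulRight k (Q.S (v 1) * Q.α * v 2), fun x y => ?_⟩
  simp [factors_apply, antipodeMap, Q.S_mul, mul_assoc]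

theorem antipodeMap_coherence : Q.antipodeMap ↑(Q.Γ (factors k H 4) 0 1 2 3) = Q.α := by
  have p := pentagon_Φ (Q := Q) (L := factors k H 4) (a := 0) (b := 1) (c := 2) (d := 3)
  have h3 : ∀ t, Q.antipodeMap (mul3 (l₄ 0) (l₄ 1) (l₄ 2) t) = Q.S (Q.zigzag t) * Q.α := by
    intro t
    induction t using tensor3_induction with
    | tmul x y z => simp [factors_apply, antipodeMap]
    | add z z' h1 h2 => simp only [map_add, add_mul, h1, h2]
  calc Q.antipodeMap ↑(Q.Γ (factors k H 4) 0 1 2 3)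
      = Q.antipodeMap ↑(1 * φ₄ 0 (1 * 2) 3 * (φ₄ 0 1 2 * (φ₄ (0 * 1) 2 3)⁻¹)) := by
        rw [← eq_mul_inv_iff_mul_eq] at p
        rw [Γ, p]
        congr 2
        group
    _ = Q.antipodeMap ↑(φ₄ 0 1 2 * (φ₄ (0 * 1) 2 3)⁻¹ * 1) := by
        rw [eqL_antipodeMap.Φ₂ (intw_one _) (intw_one _), Φ_unit₂]
        simp only [one_mul, mul_one]
    _ = Q.α := by
        rw [eqR_antipodeMap.Φ₁_inv (intw_one _) (intw_one _), Φ_unit₁, mul_one, inv_one, mul_one,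
          coe_Φ (by decide), h3, zigzag_φ, Q.S_one, one_mul]

end

/-! ### Counits of the structure elements -/

theorem ε_α_ne_zero : Q.ε Q.α ≠ 0 := by
  intro h
  have h1 : ∀ t, Q.ε (Q.zigzag t) = 0 := by
    intro t
    induction t using tensor3_induction with
    | add z z' h1 h2 => simp only [map_add, h1, h2, add_zero]
    | tmul x y z => simp [h]
  have := h1 Q.φ
  rw [zigzag_φ, map_one] at this
  exact one_ne_zero this

theorem ε_S (x : H) : Q.ε (Q.S x) = Q.ε x := by
  have h := congrArg Q.ε (Q.antipode_left x)
  rw [map_smul, smul_eq_mul] at h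
  refine mul_right_cancel₀ (ε_α_ne_zero (Q := Q)) ?_
  rw [← h]
  conv_lhs => rw [← Q.counit_right x]
  induction Q.Δ x using tensor2_induction with
  | add z z' h1 h2 => simp only [map_add, add_mul, h1, h2]
  | tmul x y => simp [mul_comm, mul_left_comm]

theorem ε_α_mul_ε_β : Q.ε Q.α * Q.ε Q.β = 1 := by
  have h1 : ∀ t, Q.ε (Q.zigzag t) = Q.ε Q.α * Q.ε Q.β * mul2 (Q.ε.toLinearMap) Q.ε.toLinearMap
      (TensorProduct.map LinearMap.id ((TensorProduct.lid k H).toLinearMap ∘ₗ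
        TensorProduct.map Q.ε.toLinearMap LinearMap.id) t) := by
    intro t
    induction t using tensor3_induction with
    | add z z' h1 h2 => simp only [map_add, mul_add, h1, h2]
    | tmul x y z => simp [ε_S]; ring
  have h2 := h1 Q.φ
  rw [Q.counit_reassociator, zigzag_φ] at h2
  simpa using h2.symm

/-- The map `x ⊗ y ↦ S(x) S(β) y`. -/
def twistedMul (Q : QuasiHopfAlgebra k H) : H ⊗[k] H →ₗ[k] H :=
  mul2 (LinearMap.mulRight k (Q.S Q.β) ∘ₗ Q.S.toLinearMap) LinearMap.id

@[simp] theorem twistedMul_tmul (x y : H) :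
    Q.twistedMul (x ⊗ₜ y) = Q.S x * Q.S Q.β * y := rfl

theorem twistedMul_γ : Q.twistedMul Q.γ = Q.α := by
  rw [← antipodeMap_coherence, ← mul4_gammaTensor, ← gammaContr_gammaTensor]
  induction Q.gammaTensor using tensor4_induction with
  | add z z' h1 h2 => simp only [map_add, h1, h2]
  | tmul x y z w => simp [factors_apply, antipodeMap, Q.S_mul, mul_assoc]

/-- Since `f Δ(S(c)) = (S ⊗ S)(Δᵒᵖ(c)) f`, a factor `S(c₁ β S(c₂))` appears. -/
theorem twistedMul_f_mul_Δ (b : H) : Q.twistedMul (Q.f * Q.Δ b) = Q.ε b • Q.twistedMul Q.f := by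
  obtain ⟨c, rfl⟩ := Q.S.surjective b
  rw [f_mul_Δ_S, ε_S, SΔop_apply]
  induction Q.f using tensor2_induction with
  | add z z' h1 h2 => simp only [map_add, mul_add, smul_add, h1, h2]
  | tmul x y =>
  have h : ∀ t, Q.twistedMul (Q.SS (flip t) * x ⊗ₜ[k] y) = Q.S x * Q.S (LinearMap.mul' k H
      (TensorProduct.map (LinearMap.mulRight k Q.β) Q.S.toLinearMap t)) * y := by
    intro t
    induction t using tensor2_induction with
    | add z z' h1 h2 => simp only [map_add, mul_add, add_mul, h1, h2]
    | tmul a b => simp [Q.S_mul, mul_assoc]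
  rw [h, Q.antipode_right]
  simp

/-- `S(f¹) S(β) f² = ε(β) α`. -/
theorem twistedMul_f : Q.twistedMul Q.f = Q.ε Q.β • Q.α := by
  have h := twistedMul_f_mul_Δ (Q := Q) Q.α
  rw [f_mul_Δ_α, twistedMul_γ] at h
  rw [h, smul_smul, mul_comm, ε_α_mul_ε_β, one_smul]

/-! ### The twist and the reassociator -/

variable (k H) in
/-- The embedding `w ↦ w ⊗ 1` of `H ⊗ H` into `H ⊗ H ⊗ H`. -/
def in₁₂ : H ⊗[k] H →ₐ[k] H ⊗[k] (H ⊗[k] H) :=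
  (Algebra.TensorProduct.assoc k k k H H H).toAlgHom.comp Algebra.TensorProduct.includeLeft

variable (k H) in
/-- The embedding `w ↦ 1 ⊗ w` of `H ⊗ H` into `H ⊗ H ⊗ H`. -/
def in₂₃ : H ⊗[k] H →ₐ[k] H ⊗[k] (H ⊗[k] H) := Algebra.TensorProduct.includeRight

theorem in₁₂_apply (w : H ⊗[k] H) : in₁₂ k H w = TensorProduct.assoc k H H H (w ⊗ₜ 1) := rfl

theorem in₂₃_apply (w : H ⊗[k] H) : in₂₃ k H w = 1 ⊗ₜ w := rfl

theorem assoc_mul (s t : (H ⊗[k] H) ⊗[k] H) : TensorProduct.assoc k H H H (s * t) =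
    TensorProduct.assoc k H H H s * TensorProduct.assoc k H H H t :=
  map_mul (Algebra.TensorProduct.assoc k k k H H H) s t

/-- The antimultiplicative map `x ⊗ y ⊗ z ↦ S(z) ⊗ S(y) ⊗ S(x)`. -/
def rev3 (Q : QuasiHopfAlgebra k H) : H ⊗[k] (H ⊗[k] H) →ₗ[k] H ⊗[k] (H ⊗[k] H) :=
  (TensorProduct.assoc k H H H).toLinearMap ∘ₗ
    TensorProduct.map (Q.SS ∘ₗ flip) Q.S.toLinearMap ∘ₗ
      (TensorProduct.comm k H (H ⊗[k] H)).toLinearMap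

@[simp] theorem rev3_tmul (x y z : H) :
    Q.rev3 (x ⊗ₜ (y ⊗ₜ z)) = Q.S z ⊗ₜ (Q.S y ⊗ₜ Q.S x) := rfl

theorem rev3_mul (s t : H ⊗[k] (H ⊗[k] H)) : Q.rev3 (s * t) = Q.rev3 t * Q.rev3 s := by
  induction s using tensor3_induction with
  | add z z' h1 h2 => simp only [map_add, mul_add, add_mul, h1, h2]
  | tmul x y z =>
    induction t using tensor3_induction with
    | add z z' h1 h2 => simp only [map_add, mul_add, add_mul, h1, h2]
    | tmul x' y' z' => simp [Q.S_mul]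

theorem rev3_one : Q.rev3 1 = 1 := by
  rw [Algebra.TensorProduct.one_def, Algebra.TensorProduct.one_def]
  simp [Q.S_one]

/-- The map `S(x₂) α x₃ ⊗ S(x₁) α x₄ ⊗ S(x₀) α x₅`. -/
def gammaMap₃ (Q : QuasiHopfAlgebra k H) :
    (⨂[k] _ : Fin 6, H) →ₗ[k] H ⊗[k] (H ⊗[k] H) :=
  contr (fun v => (Q.S (v 2) * Q.α * v 3) ⊗ₜ[k]
      ((Q.S (v 1) * Q.α * v 4) ⊗ₜ[k] (Q.S (v 0) * Q.α * v 5)))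
    (by intro v i x y
        fin_cases i <;> simp [Function.update, add_mul, mul_add, TensorProduct.tmul_add,
          TensorProduct.add_tmul])
    (by intro v i x y
        fin_cases i <;> simp [Function.update, ← TensorProduct.smul_tmul'])

theorem eqL_gammaMap₃ : Q.EqL (factors k H 6) Q.gammaMap₃ (2 * 3) unit := by
  refine eqL_unit_α (by norm_num) fun v => ⟨(TensorProduct.mk k H (H ⊗[k] H)).flip
    ((Q.S (v 1) * Q.α * v 4) ⊗ₜ[k] (Q.S (v 0) * Q.α * v 5)) ∘ₗ LinearMap.mulRight k (v 3) ∘ₗ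
      LinearMap.mulLeft k (Q.S (v 2)), fun x y => ?_⟩
  simp [factors_apply, gammaMap₃, Q.S_mul, mul_assoc]

section

local notation "φ₆" => Q.Φ (factors k H 6)
local notation "l₆" => Q.leg (factors k H 6)
local notation "Γ₆" => Q.Γ (factors k H 6)

theorem gammaMap₃_mul_φ_inner (w) (p : H ⊗[k] (H ⊗[k] H)) :
    Q.gammaMap₃ (w * mul3 (l₆ 3) (l₆ 4) (l₆ 5) p) = Q.gammaMap₃ w * p := by
  induction w using power_induction with
  | hz => norm_num
  | add z z' h1 h2 => simp only [map_add, add_mul, h1, h2]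
  | tprod v =>
  induction p using tensor3_induction with
  | tmul x y z => simp [factors_apply, gammaMap₃, mul_assoc]
  | add z z' h1 h2 => simp only [map_add, mul_add, h1, h2]

theorem gammaMap₃_mul_φ_outer (w) (p : H ⊗[k] (H ⊗[k] H)) :
    Q.gammaMap₃ (w * mul3 (l₆ 0) (l₆ 1) (l₆ 2) p) = Q.rev3 p * Q.gammaMap₃ w := by
  induction w using power_induction with
  | hz => norm_num
  | add z z' h1 h2 => simp only [map_add, add_mul, mul_add, h1, h2]
  | tprod v =>
  induction p using tensor3_induction with
  | tmul x y z => simp [factors_apply, gammaMap₃, mul_assoc, Q.S_mul]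
  | add z z' h1 h2 => simp only [map_add, mul_add, add_mul, h1, h2]

theorem gammaMap₃_nested_left (s : H ⊗[k] (H ⊗[k] (H ⊗[k] H))) (a b : H ⊗[k] H) (y z : H) :
    Q.gammaMap₃ (mul4 (l₆ 0) (l₆ 1) (l₆ 4) (l₆ 5) s *
      (mul2 (l₆ 0) (l₆ 1) a * (l₆ 2 y * (l₆ 3 z * mul2 (l₆ 4) (l₆ 5) b)))) =
      (Q.S y * Q.α * z) ⊗ₜ (Q.SS (flip a) * Q.gammaContr s * b) := by
  induction s using tensor4_induction with
  | add z z' h1 h2 => simp only [map_add, mul_add, add_mul, TensorProduct.tmul_add, h1, h2]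
  | tmul x y z w =>
  induction a using tensor2_induction with
  | add z z' h1 h2 => simp only [map_add, mul_add, add_mul, TensorProduct.tmul_add, h1, h2]
  | tmul x x' =>
  induction b using tensor2_induction with
  | add z z' h1 h2 => simp only [map_add, mul_add, TensorProduct.tmul_add, h1, h2]
  | tmul x x' => simp [factors_apply, gammaMap₃, Q.S_mul, mul_assoc]

theorem gammaMap₃_nested_right (s : H ⊗[k] (H ⊗[k] (H ⊗[k] H))) (a b : H ⊗[k] H) (x w : H) :
    Q.gammaMap₃ (mul4 (l₆ 1) (l₆ 2) (l₆ 3) (l₆ 4) s *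
      (l₆ 0 x * (mul2 (l₆ 1) (l₆ 2) a * (mul2 (l₆ 3) (l₆ 4) b * l₆ 5 w)))) =
      TensorProduct.assoc k H H H
        ((Q.SS (flip a) * Q.gammaContr s * b) ⊗ₜ (Q.S x * Q.α * w)) := by
  induction s using tensor4_induction with
  | add z z' h1 h2 => simp only [map_add, mul_add, add_mul, TensorProduct.add_tmul, h1, h2]
  | tmul x y z w =>
  induction a using tensor2_induction with
  | add z z' h1 h2 => simp only [map_add, mul_add, add_mul, TensorProduct.add_tmul, h1, h2]
  | tmul x x' =>
  induction b using tensor2_induction with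
  | add z z' h1 h2 => simp only [map_add, mul_add, add_mul, TensorProduct.add_tmul, h1, h2]
  | tmul x x' => simp [factors_apply, gammaMap₃, Q.S_mul, mul_assoc]

/-- Deleting the bracket `23` on either side leaves the same word. -/
theorem gammaMap₃_coherence :
    Q.gammaMap₃ ↑(Γ₆ 0 1 4 5 * Γ₆ (0 * 1) 2 3 (4 * 5) * φ₆ 3 4 5) =
      Q.gammaMap₃ ↑(Γ₆ 1 2 3 4 * Γ₆ 0 (1 * 2) (3 * 4) 5 * φ₆ 0 1 2) := by
  have p1 := pentagon_Φ (Q := Q) (L := factors k H 6) (a := 2) (b := 3) (c := 4) (d := 5)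
  have p2 := pentagon_Φ (Q := Q) (L := factors k H 6) (a := 0) (b := 1) (c := 2)
    (d := 3 * 4 * 5)
  have p3 := pentagon_Φ (Q := Q) (L := factors k H 6) (a := 1) (b := 2) (c := 3 * 4) (d := 5)
  have n1 : φ₆ 3 4 5 * φ₆ (0 * 1) 2 (3 * 4 * 5) = φ₆ (0 * 1) 2 (3 * (4 * 5)) * φ₆ 3 4 5 :=
    Intw.Φ (Intw.node Φ_comm Φ_comm) Φ_comm Φ_nat
  have n2 : φ₆ 2 (3 * 4) 5 * φ₆ 0 1 (2 * (3 * 4) * 5) =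
      φ₆ 0 1 (2 * (3 * 4 * 5)) * φ₆ 2 (3 * 4) 5 := Intw.Φ Φ_comm Φ_comm Φ_nat
  have n3 : φ₆ 2 3 4 * φ₆ 1 (2 * 3 * 4) 5 = φ₆ 1 (2 * (3 * 4)) 5 * φ₆ 2 3 4 :=
    Intw.Φ Φ_comm Φ_nat Φ_comm
  have n4 : φ₆ 2 3 4 * φ₆ 0 1 (2 * 3 * 4 * 5) = φ₆ 0 1 (2 * (3 * 4) * 5) * φ₆ 2 3 4 :=
    Intw.Φ Φ_comm Φ_comm (Intw.node Φ_nat Φ_comm)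
  have word1 : Γ₆ 0 1 4 5 * Γ₆ (0 * 1) 2 3 (4 * 5) * φ₆ 3 4 5 = Γ₆ 0 1 4 5 * φ₆ (2 * 3) 4 5 *
      ((φ₆ 2 3 4)⁻¹ * (φ₆ 2 (3 * 4) 5)⁻¹ * φ₆ (0 * 1) 2 (3 * 4 * 5)) := by
    rw [← eq_inv_mul_iff_mul_eq] at p1 n1
    rw [p1, n1, Γ, Γ]
    group
  have word2 : Γ₆ 1 2 3 4 * Γ₆ 0 (1 * 2) (3 * 4) 5 * φ₆ 0 1 2 =
      1 * (φ₆ 1 (2 * 3 * 4) 5)⁻¹ * (φ₆ 0 1 (2 * 3 * 4 * 5) *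
      ((φ₆ 2 3 4)⁻¹ * (φ₆ 2 (3 * 4) 5)⁻¹ * φ₆ (0 * 1) 2 (3 * 4 * 5))) := by
    rw [← eq_inv_mul_iff_mul_eq] at p2 p3 n2 n3 n4
    rw [p2, n3, n4, n2, Γ, Γ, p3]
    group
  have i1 : Q.Intw (factors k H 6) (Γ₆ 0 1 4 5) (2 * 3) (2 * 3) :=
    (Intw.inv Φ_comm).mul Φ_comm
  have e1 := eqL_gammaMap₃ (Q := Q).mul_right 4
  -- The factor `Φ 1 4 5⁻¹` does not commute with the leg `((23)4)5`, only with its part `23`.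
  have i2 : Q.Intw (factors k H 6) (φ₆ 1 4 5)⁻¹ (2 * 3) (2 * 3) := Intw.inv Φ_comm
  have e2 := ((eqL_gammaMap₃.comp_mulLeft i2 (intw_unit _)).mul_right 4).congr_right 5
  have e3 := fun v : (⨂[k] _ : Fin 6, H)ˣ =>
    e2.Φ₃ (a := 0) (b := 1) (intw_one _) (intw_one _) (v := v)
  simp only [LinearMap.comp_apply, LinearMap.mulLeft_apply, ← Units.val_mul, one_mul] at e3
  rw [word1, word2, eqL_gammaMap₃.Φ₁ i1 (intw_unit _), Φ_unit₁, mul_one,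
    e1.Φ₂_inv (intw_one _) (intw_one _), one_mul, e3, Γ, mul_assoc]

theorem in₂₃_f_mul_idΔ_gammaContr (t : H ⊗[k] (H ⊗[k] (H ⊗[k] H))) :
    in₂₃ k H Q.f * Q.idΔ (Q.gammaContr t) = Q.gammaMap₃ (Γ₆ 0 1 4 5 *
      mul4 (l₆ (0 * 1)) (l₆ 2) (l₆ 3) (l₆ (4 * 5)) t) := by
  rw [← mul4_gammaTensor]
  induction t using tensor4_induction with
  | add z z' h1 h2 => simp only [map_add, mul_add, h1, h2]
  | tmul x y z w =>
    rw [mul4_tmul, leg_mul, leg_mul, gammaMap₃_nested_left, gammaContr_gammaTensor,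
      ← SΔop_apply, ← f_mul_Δ_α, ← mul_assoc, ← f_mul_Δ_S]
    simp [in₂₃_apply, idΔ_tmul, mul_assoc]

theorem in₁₂_f_mul_Δid_gammaContr (t : H ⊗[k] (H ⊗[k] (H ⊗[k] H))) :
    in₁₂ k H Q.f * Q.Δid (Q.gammaContr t) = Q.gammaMap₃ (Γ₆ 1 2 3 4 *
      mul4 (l₆ 0) (l₆ (1 * 2)) (l₆ (3 * 4)) (l₆ 5) t) := by
  rw [← mul4_gammaTensor]
  induction t using tensor4_induction with
  | add z z' h1 h2 => simp only [map_add, mul_add, h1, h2]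
  | tmul x y z w =>
    rw [mul4_tmul, leg_mul, leg_mul, gammaMap₃_nested_right, gammaContr_gammaTensor,
      ← SΔop_apply, ← f_mul_Δ_α, ← mul_assoc, ← f_mul_Δ_S, gammaContr_tmul, Δid_tmul, in₁₂_apply,
      ← assoc_mul]
    simp [mul_assoc]

/-- The compatibility of `f` with `φ`, with `γ = f Δ(α)` in place of the second factor `f`. -/
theorem in₂₃_f_mul_idΔ_γ : in₂₃ k H Q.f * Q.idΔ Q.γ * Q.φ =
    Q.rev3 Q.φ * (in₁₂ k H Q.f * Q.Δid Q.γ) := by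
  rw [← gammaContr_gammaTensor, in₂₃_f_mul_idΔ_gammaContr, in₁₂_f_mul_Δid_gammaContr,
    ← gammaMap₃_mul_φ_inner, ← gammaMap₃_mul_φ_outer, mul4_gammaTensor, mul4_gammaTensor,
    ← coe_Φ (by decide), ← coe_Φ (by decide)]
  exact gammaMap₃_coherence

end

/-- An element `F` with `F j(S(a)) = σ(a) F` is determined by `F j(α)`. -/
theorem twist_ext {E : Type*} [Ring E] [Algebra k E] {j : H →ₐ[k] E} {σ : H →ₗ[k] E} {F F' : E}
    (h : ∀ a, F * j (Q.S a) = σ a * F) (h' : ∀ a, F' * j (Q.S a) = σ a * F')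
    (hα : F * j Q.α = F' * j Q.α) : F = F' := by
  have key : ∀ t, F * j (Q.zigzagInv t) = F' * j (Q.zigzagInv t) := by
    intro t
    induction t using tensor3_induction with
    | add z z' h1 h2 => simp only [map_add, mul_add, h1, h2]
    | tmul x y z =>
      rw [zigzagInv_tmul, map_mul, map_mul, ← mul_assoc, ← mul_assoc, h, mul_assoc (σ x), hα,
        ← mul_assoc, ← mul_assoc, ← mul_assoc, h']
  simpa [zigzagInv_φinv] using key Q.φinv

theorem in₂₃_f_mul_idΔ (t : H ⊗[k] H) : in₂₃ k H Q.f * Q.idΔ (Q.SS (flip t)) =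
    Q.rev3 (Q.Δid t) * in₂₃ k H Q.f := by
  induction t using tensor2_induction with
  | add z z' h1 h2 => simp only [map_add, mul_add, add_mul, h1, h2]
  | tmul x y =>
    have h : ∀ s : H ⊗[k] H, Q.rev3 (TensorProduct.assoc k H H H (s ⊗ₜ y)) =
        Q.S y ⊗ₜ Q.SS (flip s) := by
      intro s
      induction s using tensor2_induction with
      | add z z' h1 h2 => simp only [map_add, TensorProduct.add_tmul, TensorProduct.tmul_add,
          h1, h2]
      | tmul a b => rfl
    rw [flip_tmul, SS_tmul, idΔ_tmul, Δid_tmul, h, in₂₃_apply,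
      Algebra.TensorProduct.tmul_mul_tmul, Algebra.TensorProduct.tmul_mul_tmul, f_mul_Δ_S,
      one_mul, mul_one, SΔop_apply]

theorem in₁₂_f_mul_Δid (t : H ⊗[k] H) : in₁₂ k H Q.f * Q.Δid (Q.SS (flip t)) =
    Q.rev3 (Q.idΔ t) * in₁₂ k H Q.f := by
  induction t using tensor2_induction with
  | add z z' h1 h2 => simp only [map_add, mul_add, add_mul, h1, h2]
  | tmul x y =>
    have h : ∀ s : H ⊗[k] H, Q.rev3 (x ⊗ₜ s) =
        TensorProduct.assoc k H H H (Q.SS (flip s) ⊗ₜ Q.S x) := by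
      intro s
      induction s using tensor2_induction with
      | add z z' h1 h2 => simp only [map_add, TensorProduct.add_tmul, TensorProduct.tmul_add,
          h1, h2]
      | tmul a b => rfl
    rw [flip_tmul, SS_tmul, idΔ_tmul, Δid_tmul, h, in₁₂_apply, ← assoc_mul, ← assoc_mul,
      Algebra.TensorProduct.tmul_mul_tmul, Algebra.TensorProduct.tmul_mul_tmul, f_mul_Δ_S,
      one_mul, mul_one, SΔop_apply]

/-- The twist is compatible with the reassociator. -/
theorem twist_cocycle : in₂₃ k H Q.f * Q.idΔ Q.f * Q.φ =
    Q.rev3 Q.φ * (in₁₂ k H Q.f * Q.Δid Q.f) := by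
  refine twist_ext (Q := Q) (j := Q.Δid.comp Q.Δ)
    (σ := Q.rev3 ∘ₗ Q.Δid.toLinearMap ∘ₗ Q.Δ.toLinearMap) (fun a => ?_) (fun a => ?_) ?_
  · change _ * Q.Δid (Q.Δ (Q.S a)) = Q.rev3 (Q.Δid (Q.Δ a)) * _
    rw [mul_assoc, ← idΔ_Δ_mul_φ, ← mul_assoc, mul_assoc _ (Q.idΔ Q.f), ← map_mul, f_mul_Δ_S,
      map_mul, ← mul_assoc, SΔop_apply, in₂₃_f_mul_idΔ]
    simp only [mul_assoc]
  · change _ * Q.Δid (Q.Δ (Q.S a)) = Q.rev3 (Q.Δid (Q.Δ a)) * _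
    rw [mul_assoc, mul_assoc _ (Q.Δid _), ← map_mul, f_mul_Δ_S, map_mul, ← mul_assoc (in₁₂ k H Q.f),
      SΔop_apply, in₁₂_f_mul_Δid, ← mul_assoc, ← mul_assoc, ← rev3_mul, idΔ_Δ_mul_φ, rev3_mul]
    simp only [mul_assoc]
  · change _ * Q.Δid (Q.Δ Q.α) = _ * Q.Δid (Q.Δ Q.α)
    rw [mul_assoc, ← idΔ_Δ_mul_φ, ← mul_assoc, mul_assoc _ (Q.idΔ Q.f), ← map_mul, f_mul_Δ_α,
      in₂₃_f_mul_idΔ_γ, mul_assoc, mul_assoc, ← map_mul, f_mul_Δ_α]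

/-! ### The element `U` and the reassociator -/

/-- The map `S(x₂) α x₃ ⊗ S(x₁) α x₄ ⊗ S(x₀)`. -/
def qMap₃ (Q : QuasiHopfAlgebra k H) : (⨂[k] _ : Fin 5, H) →ₗ[k] H ⊗[k] (H ⊗[k] H) :=
  contr (fun v => (Q.S (v 2) * Q.α * v 3) ⊗ₜ[k] ((Q.S (v 1) * Q.α * v 4) ⊗ₜ[k] Q.S (v 0)))
    (by intro v i x y
        fin_cases i <;> simp [Function.update, add_mul, mul_add, TensorProduct.tmul_add,
          TensorProduct.add_tmul])
    (by intro v i x y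
        fin_cases i <;> simp [Function.update, ← TensorProduct.smul_tmul'])

theorem eqL_qMap₃ : Q.EqL (factors k H 5) Q.qMap₃ (2 * 3) unit := by
  refine eqL_unit_α (by norm_num) fun v => ⟨(TensorProduct.mk k H (H ⊗[k] H)).flip
    ((Q.S (v 1) * Q.α * v 4) ⊗ₜ[k] Q.S (v 0)) ∘ₗ LinearMap.mulRight k (v 3) ∘ₗ
      LinearMap.mulLeft k (Q.S (v 2)), fun x y => ?_⟩
  simp [factors_apply, qMap₃, Q.S_mul, mul_assoc]

section

local notation "φ₅" => Q.Φ (factors k H 5)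
local notation "l₅" => Q.leg (factors k H 5)
local notation "Γ₅" => Q.Γ (factors k H 5)

/-- The pentagon turns the right side into a word from which the bracket `23` can be deleted
three times, leaving the left side. -/
theorem qMap₃_coherence :
    Q.qMap₃ ↑(φ₅ 0 1 4 * φ₅ (0 * 1) 2 3 * (φ₅ 0 1 2)⁻¹) =
      Q.qMap₃ ↑(Γ₅ 1 2 3 4 * φ₅ 0 (1 * 2) (3 * 4) * φ₅ (0 * (1 * 2)) 3 4) := by
  have p1 := pentagon_Φ (Q := Q) (L := factors k H 5) (a := 0) (b := 1 * 2) (c := 3) (d := 4)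
  have p2 := pentagon_Φ (Q := Q) (L := factors k H 5) (a := 1) (b := 2) (c := 3) (d := 4)
  have p3 := pentagon_Φ (Q := Q) (L := factors k H 5) (a := 0) (b := 1) (c := 2) (d := 3)
  have n1 : φ₅ 1 2 3 * φ₅ 0 (1 * 2 * 3) 4 = φ₅ 0 (1 * (2 * 3)) 4 * φ₅ 1 2 3 :=
    Intw.Φ Φ_comm Φ_nat Φ_comm
  have word : Γ₅ 1 2 3 4 * φ₅ 0 (1 * 2) (3 * 4) * φ₅ (0 * (1 * 2)) 3 4 =
      1 * φ₅ 1 (2 * 3) 4 * (φ₅ 0 (1 * (2 * 3)) 4 *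
        (φ₅ 0 1 (2 * 3) * (φ₅ (0 * 1) 2 3 * (φ₅ 0 1 2)⁻¹))) := by
    rw [← eq_inv_mul_iff_mul_eq] at p1 p2 p3 n1
    rw [Γ, p1, p2, p3, n1]
    group
  have i1 : Q.Intw (factors k H 5) (φ₅ 0 1 4) (2 * 3) (2 * 3) := Φ_comm
  rw [word, eqL_qMap₃.Φ₂ (intw_one _) (intw_unit _), Φ_unit₂, mul_one, ← mul_assoc 1,
    (eqL_qMap₃.mul_left 1).Φ₂ (intw_one _) (intw_one _), one_mul, ← mul_assoc (φ₅ 0 1 4),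
    eqL_qMap₃.Φ₃ i1 (intw_unit _), Φ_unit₃, mul_one, mul_assoc]

theorem qMap₃_mul_φ_outer (w) (p : H ⊗[k] (H ⊗[k] H)) :
    Q.qMap₃ (w * mul3 (l₅ 0) (l₅ 1) (l₅ 2) p) = Q.rev3 p * Q.qMap₃ w := by
  induction w using power_induction with
  | hz => norm_num
  | add z z' h1 h2 => simp only [map_add, add_mul, mul_add, h1, h2]
  | tprod v =>
  induction p using tensor3_induction with
  | tmul x y z => simp [factors_apply, qMap₃, mul_assoc, Q.S_mul]
  | add z z' h1 h2 => simp only [map_add, mul_add, add_mul, h1, h2]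

/-- The map `x ⊗ y ⊗ z ↦ S(y) α z ⊗ S(x)`, which takes `φ` to `(S ⊗ S)(q_R²¹)`. -/
def qContr (Q : QuasiHopfAlgebra k H) : H ⊗[k] (H ⊗[k] H) →ₗ[k] H ⊗[k] H :=
  flip ∘ₗ TensorProduct.map Q.S.toLinearMap
    (mul2 (LinearMap.mulRight k Q.α ∘ₗ Q.S.toLinearMap) LinearMap.id)

@[simp] theorem qContr_tmul (x y z : H) :
    Q.qContr (x ⊗ₜ (y ⊗ₜ z)) = (Q.S y * Q.α * z) ⊗ₜ Q.S x := rfl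

theorem qContr_φ : Q.qContr Q.φ = Q.SS (flip Q.qR) := by
  rw [qR]
  induction (Q.φ : H ⊗[k] (H ⊗[k] H)) using tensor3_induction with
  | tmul x y z => simp [Q.S_mul, mul_assoc]
  | add z z' h1 h2 => simp only [map_add, h1, h2]

theorem qMap₃_nested_left (s : H ⊗[k] (H ⊗[k] H)) (a : H ⊗[k] H) (y z : H) :
    Q.qMap₃ (mul3 (l₅ 0) (l₅ 1) (l₅ 4) s * (mul2 (l₅ 0) (l₅ 1) a * (l₅ 2 y * l₅ 3 z))) =
      (Q.S y * Q.α * z) ⊗ₜ (Q.SS (flip a) * Q.qContr s) := by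
  induction s using tensor3_induction with
  | add z z' h1 h2 => simp only [map_add, mul_add, add_mul, TensorProduct.tmul_add, h1, h2]
  | tmul x y z =>
  induction a using tensor2_induction with
  | add z z' h1 h2 => simp only [map_add, mul_add, add_mul, TensorProduct.tmul_add, h1, h2]
  | tmul x x' => simp [factors_apply, qMap₃, Q.S_mul, mul_assoc]

theorem qMap₃_nested_right (s : H ⊗[k] (H ⊗[k] (H ⊗[k] H))) (c d : H ⊗[k] H) (x x' y z : H) :
    Q.qMap₃ (mul4 (l₅ 1) (l₅ 2) (l₅ 3) (l₅ 4) s *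
      (l₅ 0 x * (mul2 (l₅ 1) (l₅ 2) c * mul2 (l₅ 3) (l₅ 4) d)) *
        (l₅ 0 x' * (l₅ 3 y * l₅ 4 z))) =
      TensorProduct.assoc k H H H
        ((Q.SS (flip c) * Q.gammaContr s * d * y ⊗ₜ z) ⊗ₜ (Q.S x' * Q.S x)) := by
  induction s using tensor4_induction with
  | add z z' h1 h2 => simp only [map_add, mul_add, add_mul, TensorProduct.add_tmul, h1, h2]
  | tmul x y z w =>
  induction c using tensor2_induction with
  | add z z' h1 h2 => simp only [map_add, mul_add, add_mul, TensorProduct.add_tmul, h1, h2]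
  | tmul x x' =>
  induction d using tensor2_induction with
  | add z z' h1 h2 => simp only [map_add, mul_add, add_mul, TensorProduct.add_tmul, h1, h2]
  | tmul x x' => simp [factors_apply, qMap₃, Q.S_mul, mul_assoc]

/-- The map `x ⊗ y ⊗ z ↦ S(y) α z ⊗ (S ⊗ S)(Δᵒᵖ(x)) q`, with `q = (S ⊗ S)(q_R²¹)`. -/
def qContr₂ (Q : QuasiHopfAlgebra k H) : H ⊗[k] (H ⊗[k] H) →ₗ[k] H ⊗[k] (H ⊗[k] H) :=
  TensorProduct.map LinearMap.id (LinearMap.mulRight k (Q.SS (flip Q.qR)) ∘ₗ Q.SΔop) ∘ₗ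
    (TensorProduct.comm k H H).toLinearMap ∘ₗ
    TensorProduct.map LinearMap.id
      (mul2 (LinearMap.mulRight k Q.α ∘ₗ Q.S.toLinearMap) LinearMap.id)

@[simp] theorem qContr₂_tmul (x y z : H) : Q.qContr₂ (x ⊗ₜ (y ⊗ₜ z)) =
    (Q.S y * Q.α * z) ⊗ₜ (Q.SΔop x * (Q.SS (flip Q.qR))) := rfl

theorem qContr₂_eq (t : H ⊗[k] (H ⊗[k] H)) :
    Q.qContr₂ t = Q.qMap₃ (φ₅ 0 1 4 * mul3 (l₅ (0 * 1)) (l₅ 2) (l₅ 3) t) := by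
  rw [coe_Φ (by decide)]
  induction t using tensor3_induction with
  | add z z' h1 h2 => simp only [map_add, mul_add, h1, h2]
  | tmul x y z => rw [mul3_tmul, leg_mul, qMap₃_nested_left, qContr_φ]; rfl

theorem in₁₂_f_mul_Δid_qContr (b : H ⊗[k] H) (t : H ⊗[k] (H ⊗[k] H)) (y z : H) :
    in₁₂ k H Q.f * Q.Δid (Q.SS (flip b) * Q.qContr t) * in₁₂ k H (y ⊗ₜ z) =
      Q.qMap₃ (Γ₅ 1 2 3 4 * mul3 (l₅ 0) (l₅ (1 * 2)) (l₅ (3 * 4)) t *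
        (mul2 (l₅ 0) (l₅ (1 * 2)) b * (l₅ 3 y * l₅ 4 z))) := by
  rw [← mul4_gammaTensor]
  induction t using tensor3_induction with
  | add z z' h1 h2 => simp only [map_add, mul_add, add_mul, h1, h2]
  | tmul x1 x2 x3 =>
  induction b using tensor2_induction with
  | add z z' h1 h2 => simp only [map_add, mul_add, add_mul, h1, h2]
  | tmul b1 b2 =>
    have c1 := commMaps_of_ok (Q := Q) (L := factors k H 5) (s := 3 * 4) (t := 0) (by decide)
    have c2 := commMaps_of_ok (Q := Q) (L := factors k H 5) (s := 3 * 4) (t := 1 * 2) (by decide)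
    have c3 := commMaps_of_ok (Q := Q) (L := factors k H 5) (s := 1 * 2) (t := 0) (by decide)
    have e : l₅ 0 x1 * (l₅ (1 * 2) x2 * l₅ (3 * 4) x3) *
        (l₅ 0 b1 * l₅ (1 * 2) b2 * (l₅ 3 y * l₅ 4 z)) =
        l₅ 0 x1 * (l₅ (1 * 2) (x2 * b2) * l₅ (3 * 4) x3) * (l₅ 0 b1 * (l₅ 3 y * l₅ 4 z)) := by
      rw [(isMulMap_leg (by decide)).2]
      simp only [mul_assoc]
      rw [(c2 x3 b2).symm.left_comm, (c3 b2 b1).left_comm]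
    rw [mul3_tmul, mul2_tmul, mul_assoc _ (_ * _) (_ * _), e, ← mul_assoc, leg_mul, leg_mul,
      qMap₃_nested_right, gammaContr_gammaTensor, ← SΔop_apply, ← f_mul_Δ_α, ← mul_assoc,
      ← f_mul_Δ_S]
    simp only [flip_tmul, SS_tmul, qContr_tmul, Algebra.TensorProduct.tmul_mul_tmul, Δid_tmul,
      in₁₂_apply, ← assoc_mul, map_mul, Q.S_mul, mul_assoc, one_mul, mul_one]

end

theorem U_eq : Q.U = Q.g * Q.SS (flip Q.qR) := rfl

section Finite

variable [FiniteDimensional k H]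

theorem f_mul_U : Q.f * Q.U = Q.SS (flip Q.qR) := by
  rw [U_eq, ← mul_assoc, f_mul_g, one_mul]

theorem in₂₃_f_mul_idΔ_qContr (t : H ⊗[k] (H ⊗[k] H)) :
    in₂₃ k H Q.f * Q.idΔ (Q.qContr t) * in₂₃ k H Q.U = Q.qContr₂ t := by
  induction t using tensor3_induction with
  | add z z' h1 h2 => simp only [map_add, mul_add, add_mul, h1, h2]
  | tmul x y z =>
    rw [qContr_tmul, qContr₂_tmul, idΔ_tmul, in₂₃_apply, in₂₃_apply,
      Algebra.TensorProduct.tmul_mul_tmul, Algebra.TensorProduct.tmul_mul_tmul, f_mul_Δ_S,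
      mul_assoc (Q.SΔop x), f_mul_U, one_mul, mul_one]

theorem Δ_S_mul_g (x : H) : Q.Δ (Q.S x) * Q.g = Q.g * Q.SΔop x := by
  have := congrArg (fun w => Q.g * w * Q.g) (f_mul_Δ_S (Q := Q) x)
  simp only [mul_assoc, f_mul_g, mul_one] at this
  rwa [← mul_assoc, g_mul_f, one_mul] at this

/-- `φ⁻¹ (id ⊗ Δ)(U) (1 ⊗ U) = (Δ ⊗ id)(Δ(S(X)) U) (Y ⊗ Z ⊗ 1)`, with `φ = X ⊗ Y ⊗ Z`. -/
theorem idΔ_U_mul : Q.φinv * (Q.idΔ Q.U * in₂₃ k H Q.U) =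
    LinearMap.mul' k _ (TensorProduct.map (Q.Δid.toLinearMap ∘ₗ LinearMap.mulRight k Q.U ∘ₗ
      Q.Δ.toLinearMap ∘ₗ Q.S.toLinearMap) (in₁₂ k H).toLinearMap Q.φ) := by
  -- The unit that occurs on the left of `twist_cocycle` clears the inverses of `f`.
  have hu : IsUnit (in₂₃ k H Q.f * Q.idΔ Q.f * Q.φ) :=
    ((isUnit_f.map _).mul (isUnit_f.map _)).mul Q.φ.isUnit
  apply hu.mul_left_cancel
  have e1 : in₂₃ k H Q.f * Q.idΔ Q.f * Q.φ * (Q.φinv * (Q.idΔ Q.U * in₂₃ k H Q.U)) =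
      Q.qContr₂ Q.φ := by
    rw [mul_assoc _ (Q.φ : H ⊗[k] (H ⊗[k] H)), ← mul_assoc (Q.φ : H ⊗[k] (H ⊗[k] H)),
      φ_mul_φinv, one_mul, mul_assoc, ← mul_assoc (Q.idΔ _), ← map_mul, f_mul_U, ← qContr_φ,
      ← mul_assoc, in₂₃_f_mul_idΔ_qContr]
  have e2 : ∀ t, in₁₂ k H Q.f * Q.Δid Q.f * LinearMap.mul' k _ (TensorProduct.map
      (Q.Δid.toLinearMap ∘ₗ LinearMap.mulRight k Q.U ∘ₗ
        Q.Δ.toLinearMap ∘ₗ Q.S.toLinearMap) (in₁₂ k H).toLinearMap t) =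
      Q.qMap₃ (Q.Γ (factors k H 5) 1 2 3 4 * Q.Φ (factors k H 5) 0 (1 * 2) (3 * 4) *
        mul3 (Q.leg (factors k H 5) (0 * (1 * 2))) (Q.leg (factors k H 5) 3)
          (Q.leg (factors k H 5) 4) t) := by
    intro t
    rw [coe_Φ (by decide)]
    induction t using tensor3_induction with
    | add z z' h1 h2 => simp only [map_add, mul_add, h1, h2]
    | tmul x y z =>
      rw [mul3_tmul, leg_mul, ← in₁₂_f_mul_Δid_qContr, qContr_φ, ← SΔop_apply]
      simp only [TensorProduct.map_tmul, LinearMap.mul'_apply, LinearMap.comp_apply,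
        LinearMap.mulRight_apply, AlgHom.toLinearMap_apply, LinearEquiv.coe_coe]
      rw [U_eq, ← mul_assoc, ← mul_assoc, mul_assoc (in₁₂ k H Q.f), ← map_mul, ← mul_assoc Q.f,
        ← mul_assoc Q.f, f_mul_Δ_S, mul_assoc (Q.SΔop x), f_mul_g, mul_one]
  rw [e1, twist_cocycle, mul_assoc, e2, ← coe_Φ (by decide), ← Units.val_mul, ← Units.val_mul,
    ← qMap₃_coherence, Units.val_mul _ (_⁻¹), coe_Φ_inv (by decide), qMap₃_mul_φ_outer,
    Units.val_mul, coe_Φ (a := 0 * 1) (by decide), ← qContr₂_eq, ← mul_assoc, ← rev3_mul,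
    φinv_mul_φ, rev3_one, one_mul]

end Finite

/-! ### Counits of the twist -/

variable (k H) in
/-- The two inclusions of `H` into `H ⊗ H`. -/
def pairLegs : Legs k H (H ⊗[k] H) (Fin 2) where
  toFun := ![inL k H, inR k H]
  comm {i j} hij x y := by
    fin_cases i <;> fin_cases j
    · exact absurd rfl hij
    · simp [Commute, SemiconjBy]
    · simp [Commute, SemiconjBy]
    · exact absurd rfl hij

variable (Q) in
/-- The morphism `ε ⊗ id : H ⊗ H → H`. -/
def counitL : H ⊗[k] H →ₐ[k] H :=
  (Algebra.TensorProduct.lid k H).toAlgHom.comp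
    (Algebra.TensorProduct.map Q.ε (AlgHom.id k H))

variable (Q) in
/-- The morphism `id ⊗ ε : H ⊗ H → H`. -/
def counitR : H ⊗[k] H →ₐ[k] H :=
  (Algebra.TensorProduct.rid k k H).toAlgHom.comp
    (Algebra.TensorProduct.map (AlgHom.id k H) Q.ε)

@[simp] theorem counitL_tmul (x y : H) : Q.counitL (x ⊗ₜ y) = Q.ε x • y := rfl

@[simp] theorem counitR_tmul (x y : H) : Q.counitR (x ⊗ₜ y) = Q.ε y • x := rfl

theorem counitL_Δ (x : H) : Q.counitL (Q.Δ x) = x := Q.counit_left x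

theorem counitR_Δ (x : H) : Q.counitR (Q.Δ x) = x := Q.counit_right x

theorem counitL_SS_flip (t : H ⊗[k] H) : Q.counitL (Q.SS (flip t)) = Q.S (Q.counitR t) := by
  induction t using tensor2_induction with
  | add z z' h1 h2 => simp only [map_add, h1, h2]
  | tmul x y => simp [ε_S]

theorem counitR_SS_flip (t : H ⊗[k] H) : Q.counitR (Q.SS (flip t)) = Q.S (Q.counitL t) := by
  induction t using tensor2_induction with
  | add z z' h1 h2 => simp only [map_add, h1, h2]
  | tmul x y => simp [ε_S]

theorem counitL_γ : Q.counitL Q.γ = Q.ε Q.α • Q.α := by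
  have h : ∀ t, Q.counitL (Q.gammaContr t) = Q.ε Q.α •
      mul2 (LinearMap.mulRight k Q.α ∘ₗ Q.S.toLinearMap) LinearMap.id
      (mul4 (Q.leg (pairLegs k H) 0) (Q.leg (pairLegs k H) unit)
        (Q.leg (pairLegs k H) unit) (Q.leg (pairLegs k H) 1) t) := by
    intro t
    induction t using tensor4_induction with
    | add z z' h1 h2 => simp only [map_add, smul_add, h1, h2]
    | tmul x y z w =>
      simp [leg_unit, pairLegs, ε_S, Algebra.algebraMap_eq_smul_one, smul_smul]
      ring_nf
  rw [← gammaContr_gammaTensor, h, mul4_gammaTensor, Γ, Φ_unit₁, Φ_unit₂, inv_one, one_mul,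
    Units.val_one, Algebra.TensorProduct.one_def]
  simp [Q.S_one]

theorem counitR_γ : Q.counitR Q.γ = Q.ε Q.α • Q.α := by
  have h : ∀ t, Q.counitR (Q.gammaContr t) = Q.ε Q.α •
      mul2 (LinearMap.mulRight k Q.α ∘ₗ Q.S.toLinearMap) LinearMap.id
      (mul4 (Q.leg (pairLegs k H) unit) (Q.leg (pairLegs k H) 0)
        (Q.leg (pairLegs k H) 1) (Q.leg (pairLegs k H) unit) t) := by
    intro t
    induction t using tensor4_induction with
    | add z z' h1 h2 => simp only [map_add, smul_add, h1, h2]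
    | tmul x y z w =>
      simp [leg_unit, pairLegs, ε_S, Algebra.algebraMap_eq_smul_one, smul_smul]
      ring_nf
  rw [← gammaContr_gammaTensor, h, mul4_gammaTensor, Γ, Φ_unit₁, Φ_unit₃, inv_one, one_mul,
    Units.val_one, Algebra.TensorProduct.one_def]
  simp [Q.S_one]

/-- The common evaluation of `ε ⊗ id` and `id ⊗ ε` at the twist. -/
theorem algHom_f (e : H ⊗[k] H →ₐ[k] H) (h1 : ∀ x, e (Q.Δ x) = x)
    (h2 : ∀ x, e (Q.SΔop x) = Q.S x) (h3 : e Q.γ = Q.ε Q.α • Q.α) : e Q.f = Q.ε Q.α • 1 := by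
  rw [← zigzagInv_φinv (Q := Q)]
  change e (LinearMap.mul' k (H ⊗[k] H) (TensorProduct.map _ _ Q.φinv)) = _
  induction Q.φinv using tensor3_induction with
  | add z z' h1 h2 => simp only [map_add, smul_add, h1, h2]
  | tmul x y z =>
    change e (Q.SΔop x * Q.γ * Q.Δ (y * Q.β * Q.S z)) = _
    rw [map_mul, map_mul, h1, h2, h3]
    simp

theorem counitL_f : Q.counitL Q.f = Q.ε Q.α • 1 :=
  algHom_f _ counitL_Δ (fun x => by rw [SΔop_apply, counitL_SS_flip, counitR_Δ]) counitL_γ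

theorem counitR_f : Q.counitR Q.f = Q.ε Q.α • 1 :=
  algHom_f _ counitR_Δ (fun x => by rw [SΔop_apply, counitR_SS_flip, counitL_Δ]) counitR_γ

theorem counitL_SS_flip_qR : Q.counitL (Q.SS (flip Q.qR)) = Q.ε Q.α • 1 := by
  have h : ∀ t, Q.counitL (Q.qContr t) = Q.ε Q.α • mul2 Q.S.toLinearMap
      (Algebra.linearMap k H ∘ₗ Q.ε.toLinearMap)
      (TensorProduct.map LinearMap.id ((TensorProduct.lid k H).toLinearMap ∘ₗ
        TensorProduct.map Q.ε.toLinearMap LinearMap.id) t) := by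
    intro t
    induction t using tensor3_induction with
    | add z z' h1 h2 => simp only [map_add, smul_add, h1, h2]
    | tmul x y z =>
      simp [ε_S, Algebra.algebraMap_eq_smul_one, smul_smul]
      ring_nf
  rw [← qContr_φ, h, Q.counit_reassociator]
  simp [Q.S_one]

theorem counitR_pR : Q.counitR Q.pR = Q.ε Q.β • 1 := by
  have h : ∀ t, Q.counitR (TensorProduct.map LinearMap.id (LinearMap.mul' k H ∘ₗ
      TensorProduct.map (LinearMap.mulRight k Q.β) Q.S.toLinearMap) t) = Q.ε Q.β •
      Q.counitR (mul3 (Q.leg (pairLegs k H) 0) (Q.leg (pairLegs k H) unit)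
        (Q.leg (pairLegs k H) 1) t) := by
    intro t
    induction t using tensor3_induction with
    | add z z' h1 h2 => simp only [map_add, smul_add, h1, h2]
    | tmul x y z =>
      simp [leg_unit, pairLegs, ε_S, Algebra.algebraMap_eq_smul_one, smul_smul]
      ring_nf
  rw [pR, h, ← coe_Φ_inv (by decide), Φ_unit₂, inv_one, Units.val_one, map_one]

/-! ### Reversal of tensors by the inverse antipode -/

variable (Q) in
/-- The antimultiplicative map `x ⊗ y ↦ S⁻¹(y) ⊗ S⁻¹(x)`. -/
def revInv : H ⊗[k] H →ₗ[k] H ⊗[k] H := Q.SSinv ∘ₗ flip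

@[simp] theorem revInv_tmul (x y : H) :
    Q.revInv (x ⊗ₜ y) = Q.S.symm y ⊗ₜ Q.S.symm x := rfl

theorem S_symm_mul (x y : H) : Q.S.symm (x * y) = Q.S.symm y * Q.S.symm x := by
  apply Q.S.injective
  simp [Q.S_mul]

theorem S_symm_one : Q.S.symm 1 = 1 := by
  apply Q.S.injective
  simp [Q.S_one]

theorem revInv_mul (s t : H ⊗[k] H) : Q.revInv (s * t) = Q.revInv t * Q.revInv s := by
  induction s using tensor2_induction with
  | add z z' h1 h2 => simp only [map_add, mul_add, add_mul, h1, h2]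
  | tmul x y =>
    induction t using tensor2_induction with
    | add z z' h1 h2 => simp only [map_add, mul_add, add_mul, h1, h2]
    | tmul x' y' => simp [S_symm_mul]

theorem revInv_one : Q.revInv 1 = 1 := by
  rw [Algebra.TensorProduct.one_def]
  simp [S_symm_one]

theorem revInv_SS_flip (t : H ⊗[k] H) : Q.revInv (Q.SS (flip t)) = t := by
  induction t using tensor2_induction with
  | add z z' h1 h2 => simp only [map_add, h1, h2]
  | tmul x y => simp

theorem SS_flip_revInv (t : H ⊗[k] H) : Q.SS (flip (Q.revInv t)) = t := by
  induction t using tensor2_induction with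
  | add z z' h1 h2 => simp only [map_add, h1, h2]
  | tmul x y => simp

theorem counitL_revInv (t : H ⊗[k] H) : Q.counitL (Q.revInv t) = Q.S.symm (Q.counitR t) := by
  apply Q.S.injective
  rw [← counitR_SS_flip, SS_flip_revInv]
  simp

/-- `V` is the image of `f p_R` under `x ⊗ y ↦ S⁻¹(y) ⊗ S⁻¹(x)`. -/
theorem V_eq : Q.V = Q.revInv (Q.f * Q.pR) := by rw [revInv_mul]; rfl

theorem counitL_V : Q.counitL Q.V = 1 := by
  rw [V_eq, counitL_revInv, map_mul, counitR_f, counitR_pR, smul_mul_smul_comm, one_mul,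
    ε_α_mul_ε_β, one_smul, S_symm_one]

/-! ### The commutation rules of `U` and `V` -/

/-- `(b ⊗ 1) V Δ(S⁻¹(a))` is the image of `f Δ(a) p_R (1 ⊗ S(b))` under
`x ⊗ y ↦ S⁻¹(y) ⊗ S⁻¹(x)`. -/
theorem revInv_f_mul (t : H ⊗[k] H) :
    mul2 (LinearMap.mulRight k Q.V ∘ₗ (inL k H).toLinearMap)
      (Q.Δ.toLinearMap ∘ₗ Q.S.symm.toLinearMap) (flip t) =
    Q.revInv (Q.f * mul2 (LinearMap.mulRight k Q.pR ∘ₗ Q.Δ.toLinearMap)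
      ((inR k H).toLinearMap ∘ₗ Q.S.toLinearMap) t) := by
  induction t using tensor2_induction with
  | add z z' h1 h2 => simp only [map_add, mul_add, h1, h2]
  | tmul x y =>
    obtain ⟨x, rfl⟩ := Q.S.surjective x
    simp only [flip_tmul, mul2_tmul, LinearMap.comp_apply, LinearMap.mulRight_apply,
      AlgHom.toLinearMap_apply, LinearEquiv.coe_coe, LinearEquiv.symm_apply_apply]
    rw [← mul_assoc, ← mul_assoc, f_mul_Δ_S, mul_assoc (Q.SΔop x), revInv_mul, revInv_mul,
      SΔop_apply, revInv_SS_flip, ← V_eq]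
    simp [S_symm_one, mul_assoc]

/-- `(a₂ ⊗ 1) V Δ(S⁻¹(a₁)) = (1 ⊗ S⁻¹(a)) V`. -/
theorem inL_mul_V_mul_Δ (a : H) :
    mul2 (LinearMap.mulRight k Q.V ∘ₗ (inL k H).toLinearMap)
      (Q.Δ.toLinearMap ∘ₗ Q.S.symm.toLinearMap) (flip (Q.Δ a)) = inR k H (Q.S.symm a) * Q.V := by
  rw [revInv_f_mul, Δ_mul_pR, ← mul_assoc, revInv_mul, ← V_eq]
  simp [S_symm_one]

/-- `(q² ⊗ 1) V Δ(S⁻¹(q¹)) = h`. -/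
theorem inL_qR_mul_V_mul_Δ :
    mul2 (LinearMap.mulRight k Q.V ∘ₗ (inL k H).toLinearMap)
      (Q.Δ.toLinearMap ∘ₗ Q.S.symm.toLinearMap) (flip Q.qR) = Q.h := by
  rw [revInv_f_mul, Δ_qR_mul_pR, mul_one]
  rfl

section Finite

variable [FiniteDimensional k H]

theorem counitL_U : Q.counitL Q.U = 1 := by
  have h := congrArg Q.counitL (g_mul_f (Q := Q))
  rw [map_mul, counitL_f, map_one, mul_smul_comm, mul_one] at h
  rw [U_eq, map_mul, counitL_SS_flip_qR, mul_smul_comm, mul_one, h]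

/-- `Δ(S(a₁)) U (a₂ ⊗ 1) = U (1 ⊗ S(a))`. -/
theorem Δ_S_mul_U (a : H) : mul2 (LinearMap.mulRight k Q.U ∘ₗ Q.Δ.toLinearMap ∘ₗ Q.S.toLinearMap)
    (inL k H).toLinearMap (Q.Δ a) = Q.U * inR k H (Q.S a) := by
  rw [U_eq, mul_assoc, ← SΔop_mul_qR, ← U_eq]
  induction Q.Δ a using tensor2_induction with
  | add z z' h1 h2 => simp only [map_add, mul_add, h1, h2]
  | tmul x y =>
    simp only [mul2_tmul, LinearMap.comp_apply, LinearMap.mulRight_apply,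
      AlgHom.toLinearMap_apply, LinearEquiv.coe_coe]
    rw [U_eq, ← mul_assoc, Δ_S_mul_g]
    simp only [mul_assoc]

end Finite

/-! ### The element `V` and the reassociator -/

/-- The antimultiplicative map `x ⊗ y ⊗ z ↦ S⁻¹(z) ⊗ S⁻¹(y) ⊗ S⁻¹(x)`. -/
def revInv3 (Q : QuasiHopfAlgebra k H) : H ⊗[k] (H ⊗[k] H) →ₗ[k] H ⊗[k] (H ⊗[k] H) :=
  (TensorProduct.assoc k H H H).toLinearMap ∘ₗ
    TensorProduct.map Q.revInv Q.S.symm.toLinearMap ∘ₗ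
      (TensorProduct.comm k H (H ⊗[k] H)).toLinearMap

@[simp] theorem revInv3_tmul (x y z : H) : Q.revInv3 (x ⊗ₜ (y ⊗ₜ z)) =
    Q.S.symm z ⊗ₜ (Q.S.symm y ⊗ₜ Q.S.symm x) := rfl

theorem revInv3_mul (s t : H ⊗[k] (H ⊗[k] H)) :
    Q.revInv3 (s * t) = Q.revInv3 t * Q.revInv3 s := by
  induction s using tensor3_induction with
  | add z z' h1 h2 => simp only [map_add, mul_add, add_mul, h1, h2]
  | tmul x y z =>
    induction t using tensor3_induction with
    | add z z' h1 h2 => simp only [map_add, mul_add, add_mul, h1, h2]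
    | tmul x' y' z' => simp [S_symm_mul]

theorem revInv3_rev3 (t : H ⊗[k] (H ⊗[k] H)) : Q.revInv3 (Q.rev3 t) = t := by
  induction t using tensor3_induction with
  | add z z' h1 h2 => simp only [map_add, h1, h2]
  | tmul x y z => simp

theorem revInv3_in₁₂ (t : H ⊗[k] H) : Q.revInv3 (in₁₂ k H t) = in₂₃ k H (Q.revInv t) := by
  induction t using tensor2_induction with
  | add z z' h1 h2 => simp only [map_add, h1, h2]
  | tmul x y => simp [in₁₂_apply, in₂₃_apply, S_symm_one]

theorem revInv3_in₂₃ (t : H ⊗[k] H) : Q.revInv3 (in₂₃ k H t) = in₁₂ k H (Q.revInv t) := by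
  induction t using tensor2_induction with
  | add z z' h1 h2 => simp only [map_add, h1, h2]
  | tmul x y => simp [in₁₂_apply, in₂₃_apply, S_symm_one]

theorem h_eq : Q.h = Q.revInv Q.f := rfl

theorem in₂₃_h_mul_idΔ (w : H ⊗[k] H) : in₂₃ k H Q.h * Q.idΔ (Q.revInv w) =
    Q.revInv3 (in₁₂ k H Q.f * Q.Δid w) := by
  rw [← SS_flip_revInv (Q := Q) w, in₁₂_f_mul_Δid, revInv3_mul, revInv3_rev3, revInv3_in₁₂,
    SS_flip_revInv, ← h_eq]

theorem in₁₂_h_mul_Δid (w : H ⊗[k] H) : in₁₂ k H Q.h * Q.Δid (Q.revInv w) =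
    Q.revInv3 (in₂₃ k H Q.f * Q.idΔ w) := by
  rw [← SS_flip_revInv (Q := Q) w, in₂₃_f_mul_idΔ, revInv3_mul, revInv3_rev3, revInv3_in₂₃,
    SS_flip_revInv, ← h_eq]

/-- The image of `twist_cocycle`, multiplied by `(Δ ⊗ id)(p_R)`, under
`x ⊗ y ⊗ z ↦ S⁻¹(z) ⊗ S⁻¹(y) ⊗ S⁻¹(x)`. -/
theorem in₂₃_h_mul_idΔ_V : in₂₃ k H Q.h * Q.idΔ Q.V * Q.φ =
    Q.revInv3 (Q.φ * Q.Δid Q.pR) * (in₁₂ k H Q.h * Q.Δid Q.h) := by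
  have e : in₁₂ k H Q.h * Q.Δid Q.h = Q.revInv3 (in₂₃ k H Q.f * Q.idΔ Q.f) := in₁₂_h_mul_Δid Q.f
  rw [V_eq, in₂₃_h_mul_idΔ, e, ← revInv3_mul]
  conv_lhs => rw [← revInv3_rev3 (Q := Q) Q.φ]
  rw [← revInv3_mul, map_mul Q.Δid, ← mul_assoc (in₁₂ k H Q.f), ← mul_assoc (Q.rev3 _),
    ← twist_cocycle, mul_assoc]

variable (Q) in
/-- The map `x ⊗ y ⊗ z ↦ x β S(y) ⊗ z`. -/
def contrβ : H ⊗[k] (H ⊗[k] H) →ₗ[k] H ⊗[k] H :=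
  TensorProduct.map (mul2 (LinearMap.mulRight k Q.β) Q.S.toLinearMap) LinearMap.id ∘ₗ
    (TensorProduct.assoc k H H H).symm.toLinearMap

@[simp] theorem contrβ_tmul (x y z : H) :
    Q.contrβ (x ⊗ₜ (y ⊗ₜ z)) = (x * Q.β * Q.S y) ⊗ₜ z := rfl

theorem contrβ_revInv3_mul (s : H ⊗[k] (H ⊗[k] H)) (w : H ⊗[k] H) :
    Q.contrβ (Q.revInv3 s * in₁₂ k H (Q.revInv w)) =
      Q.revInv (Q.innerContr (Q.twistedMul w) s) := by
  have h : ∀ m n, Q.innerContr (m + n) s = Q.innerContr m s + Q.innerContr n s := by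
    intro m n
    induction s using tensor3_induction with
    | add z z' h1 h2 => simp only [map_add, h1, h2]; abel
    | tmul x y z => simp [innerContr, mul_add, add_mul, TensorProduct.tmul_add]
  induction w using tensor2_induction with
  | add z z' h1 h2 => simp only [map_add, mul_add, h1, h2, h]
  | tmul a b =>
  clear h
  induction s using tensor3_induction with
  | add z z' h1 h2 => simp only [map_add, add_mul, h1, h2]
  | tmul x y z => simp [innerContr, S_symm_mul, Q.S_mul, in₁₂_apply, mul_assoc]

theorem innerContr_smul (c : k) (n : H) (s : H ⊗[k] (H ⊗[k] H)) :
    Q.innerContr (c • n) s = c • Q.innerContr n s := by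
  induction s using tensor3_induction with
  | add z z' h1 h2 => simp only [map_add, smul_add, h1, h2]
  | tmul x y z => simp [innerContr]

theorem contrβ_const : Q.contrβ (Q.revInv3 (Q.φ * Q.Δid Q.pR) * in₁₂ k H Q.h) = Q.ε Q.β • 1 := by
  rw [h_eq, contrβ_revInv3_mul, twistedMul_f, innerContr_smul, innerContr_φ_mul_Δ_pR, map_smul,
    revInv_one]

theorem contrβ_mul_Δid (t : H ⊗[k] (H ⊗[k] H)) (w : H ⊗[k] H) :
    Q.contrβ (t * Q.Δid w) = Q.contrβ t * inR k H (Q.counitL w) := by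
  induction t using tensor3_induction with
  | add z z' h1 h2 => simp only [map_add, add_mul, h1, h2]
  | tmul x y z =>
  induction w using tensor2_induction with
  | add z z' h1 h2 => simp only [map_add, mul_add, h1, h2]
  | tmul a b =>
    have h : ∀ s : H ⊗[k] H, Q.contrβ (x ⊗ₜ (y ⊗ₜ z) * TensorProduct.assoc k H H H (s ⊗ₜ b)) =
        (x * LinearMap.mul' k H (TensorProduct.map (LinearMap.mulRight k Q.β) Q.S.toLinearMap s) *
          Q.S y) ⊗ₜ (z * b) := by
      intro s
      induction s using tensor2_induction with
      | add z z' h1 h2 =>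
        simp only [map_add, mul_add, add_mul, TensorProduct.add_tmul, h1, h2]
      | tmul a a' => simp [Q.S_mul, mul_assoc]
    rw [Δid_tmul, h, Q.antipode_right]
    simp [TensorProduct.smul_tmul']

/-- `ε(X) j(Y ⊗ Z) = j(1)` for `φ = X ⊗ Y ⊗ Z`. -/
theorem map_counit_φ (j : H ⊗[k] H →ₗ[k] A) : LinearMap.mul' k A (TensorProduct.map
    (Algebra.linearMap k A ∘ₗ Q.ε.toLinearMap) j Q.φ) = j 1 := by
  have h : ∀ t, LinearMap.mul' k A (TensorProduct.map
      (Algebra.linearMap k A ∘ₗ Q.ε.toLinearMap) j t) = j (mul3 (Q.leg (pairLegs k H) unit)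
        (Q.leg (pairLegs k H) 0) (Q.leg (pairLegs k H) 1) t) := by
    intro t
    induction t using tensor3_induction with
    | add z z' h1 h2 => simp only [map_add, h1, h2]
    | tmul x y z => simp [leg_unit, pairLegs, Algebra.algebraMap_eq_smul_one]
  rw [h, ← coe_Φ (by decide), Φ_unit₁, Units.val_one]

/-! ### Integrals and cointegrals -/

theorem rightIntegral_mul {r : H} (hr : r ∈ Q.rightIntegrals) (a : H) :
    r * a = Q.ε a • r := hr a

/-- The map `id ⊗ ψ : H ⊗ H → H`. -/
abbrev sliceR (ψ : Module.Dual k H) : H ⊗[k] H →ₗ[k] H :=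
  (TensorProduct.rid k H).toLinearMap ∘ₗ TensorProduct.map LinearMap.id ψ

/-- The map `q¹ ⊗ q² ↦ q² τ(S⁻¹(q¹) ·)`. -/
def conjHom (Q : QuasiHopfAlgebra k H) (τ : H →ₗ[k] H) : H ⊗[k] H →ₗ[k] H →ₗ[k] H :=
  TensorProduct.lift (LinearMap.mk₂ k
    (fun x y => LinearMap.mulLeft k y ∘ₗ τ ∘ₗ LinearMap.mulLeft k (Q.S.symm x))
    (by intros; ext; simp [add_mul, mul_add]) (by intros; ext; simp)
    (by intros; ext; simp [add_mul]) (by intros; ext; simp))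

theorem conjHom_tmul (τ : H →ₗ[k] H) (x y : H) : Q.conjHom τ (x ⊗ₜ y) =
    LinearMap.mulLeft k y ∘ₗ τ ∘ₗ LinearMap.mulLeft k (Q.S.symm x) := rfl

theorem sliceR_comp_mulRight (m : Module.Dual k H) (b : H) (D : H ⊗[k] H) :
    sliceR (m ∘ₗ LinearMap.mulRight k b) D = sliceR m (D * inR k H b) := by
  induction D using tensor2_induction with
  | add z z' h1 h2 => simp only [map_add, add_mul, h1, h2]
  | tmul x y => simp

theorem sliceR_inL_mul (m : Module.Dual k H) (b : H) (D : H ⊗[k] H) :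
    sliceR m (inL k H b * D) = b * sliceR m D := by
  induction D using tensor2_induction with
  | add z z' h1 h2 => simp only [map_add, mul_add, h1, h2]
  | tmul x y => simp

theorem sliceR_mul_inL (m : Module.Dual k H) (b : H) (D : H ⊗[k] H) :
    sliceR m (D * inL k H b) = sliceR m D * b := by
  induction D using tensor2_induction with
  | add z z' h1 h2 => simp only [map_add, add_mul, h1, h2]
  | tmul x y => simp

theorem sliceR_contrβ_tmul (m : Module.Dual k H) (b : H) (D : H ⊗[k] H) :
    sliceR m (Q.contrβ (b ⊗ₜ D)) = b * Q.β * Q.S (sliceR m D) := by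
  induction D using tensor2_induction with
  | add z z' h1 h2 => simp only [map_add, mul_add, TensorProduct.tmul_add, h1, h2]
  | tmul x y => simp

section Finite

variable [FiniteDimensional k H]

/-- `V Δ(r) U (1 ⊗ S(a)) = V Δ(r) U (a ⊗ 1)`. -/
theorem Δbar_mul_inR {r : H} (hr : r ∈ Q.rightIntegrals) (a : H) :
    Q.Δbar r * inR k H (Q.S a) = Q.Δbar r * inL k H a := by
  have h : ∀ t, Q.V * (Q.Δ r * mul2 (LinearMap.mulRight k Q.U ∘ₗ Q.Δ.toLinearMap ∘ₗ
      Q.S.toLinearMap) (inL k H).toLinearMap t) = Q.Δbar r * inL k H (Q.counitL t) := by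
    intro t
    induction t using tensor2_induction with
    | add z z' h1 h2 => simp only [map_add, mul_add, h1, h2]
    | tmul x y =>
      simp only [mul2_tmul, LinearMap.comp_apply, LinearMap.mulRight_apply,
        AlgHom.toLinearMap_apply, LinearEquiv.coe_coe]
      rw [← mul_assoc (Q.Δ r), ← mul_assoc (Q.Δ r), ← map_mul, rightIntegral_mul hr, ε_S,
        counitL_tmul, map_smul, map_smul]
      simp [Δbar, mul_assoc]
  rw [← counitL_Δ (Q := Q) a, ← h, Δ_S_mul_U, counitL_Δ]
  simp [Δbar, mul_assoc]

/-- For a right integral `r`, the element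
`(1 ⊗ h) (id ⊗ Δ)(V Δ(r) U) (1 ⊗ U)` is contracted by `x ⊗ y ⊗ z ↦ x β S(y) ⊗ z` to a multiple
of `1 ⊗ z`. -/
theorem contrβ_idΔ_Δbar {r : H} (hr : r ∈ Q.rightIntegrals) :
    Q.contrβ (in₂₃ k H Q.h * Q.idΔ (Q.Δbar r) * in₂₃ k H Q.U) =
      Q.ε Q.β • inR k H (Q.counitL (Q.h * (Q.Δ r * Q.U))) := by
  -- As `r S(x) = ε(x) r`, only `(ε ⊗ id ⊗ id)(φ) = 1` remains of the sum over `φ`.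
  have h1 : ∀ t, Q.Δid (Q.Δ r) * LinearMap.mul' k _ (TensorProduct.map
      (Q.Δid.toLinearMap ∘ₗ LinearMap.mulRight k Q.U ∘ₗ
      Q.Δ.toLinearMap ∘ₗ Q.S.toLinearMap) (in₁₂ k H).toLinearMap t) = Q.Δid (Q.Δ r * Q.U) *
      LinearMap.mul' k _ (TensorProduct.map (Algebra.linearMap k _ ∘ₗ Q.ε.toLinearMap)
        (in₁₂ k H).toLinearMap t) := by
    intro t
    induction t using tensor3_induction with
    | add z z' h1 h2 => simp only [map_add, mul_add, h1, h2]
    | tmul x y z =>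
      simp only [TensorProduct.map_tmul, LinearMap.mul'_apply, LinearMap.comp_apply,
        LinearMap.mulRight_apply, AlgHom.toLinearMap_apply, LinearEquiv.coe_coe]
      rw [← mul_assoc, ← map_mul, ← mul_assoc (Q.Δ r), ← map_mul, rightIntegral_mul hr, ε_S,
        map_smul, smul_mul_assoc, map_smul, smul_mul_assoc]
      simp [Algebra.algebraMap_eq_smul_one]
  have h2 : in₂₃ k H Q.h * Q.idΔ (Q.Δbar r) * in₂₃ k H Q.U =
      Q.revInv3 (Q.φ * Q.Δid Q.pR) * in₁₂ k H Q.h * Q.Δid (Q.h * (Q.Δ r * Q.U)) := by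
    calc in₂₃ k H Q.h * Q.idΔ (Q.Δbar r) * in₂₃ k H Q.U
        = in₂₃ k H Q.h * Q.idΔ Q.V * (Q.idΔ (Q.Δ r) * (Q.φ * Q.φinv)) *
            (Q.idΔ Q.U * in₂₃ k H Q.U) := by
          rw [φ_mul_φinv]
          simp [Δbar, mul_assoc]
      _ = in₂₃ k H Q.h * Q.idΔ Q.V * Q.φ * (Q.Δid (Q.Δ r) *
            (Q.φinv * (Q.idΔ Q.U * in₂₃ k H Q.U))) := by
          rw [← mul_assoc (Q.idΔ (Q.Δ r)), idΔ_Δ_mul_φ]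
          simp only [mul_assoc]
      _ = _ := by
          rw [in₂₃_h_mul_idΔ_V, idΔ_U_mul, h1, map_counit_φ, AlgHom.toLinearMap_apply, map_one,
            mul_one, map_mul Q.Δid Q.h]
          simp only [mul_assoc]
  rw [h2, contrβ_mul_Δid, contrβ_const, smul_mul_assoc, one_mul]

/-- The cointegral `E(ψ)`, applied to the second factor of an element `D` of `H ⊗ H` with
`D (1 ⊗ S(a)) = D (a ⊗ 1)`. -/
theorem sliceR_E (ψ : Module.Dual k H) {D : H ⊗[k] H}
    (hD : ∀ a, D * inR k H (Q.S a) = D * inL k H a) :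
    sliceR (Q.E Q.dualLeft Q.dualRight Q.dualCoaction ψ) D =
      sliceR ψ (Q.contrβ (in₂₃ k H Q.h * Q.idΔ D * in₂₃ k H Q.U)) := by
  have h1 : ∀ (q : H ⊗[k] H) (T : Module.Dual k H ⊗[k] H),
      sliceR (TensorProduct.lift (Q.dualRight.flip.compl₂ (LinearMap.mulLeft k Q.β ∘ₗ
        Q.S.toLinearMap)) (TensorProduct.homTensorHomMap (RingHom.id k) (Module.Dual k H) H
          (Module.Dual k H) H (TensorProduct.map Q.dualLeft (LinearMap.mul k H) q) T)) D =
      mul2 (LinearMap.mulRight k Q.β) (Q.S.toLinearMap ∘ₗ Q.conjHom (dualTensorHom k H H T) q)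
        D := by
    have hadd : ∀ m n : Module.Dual k H, sliceR (m + n) D = sliceR m D + sliceR n D := by
      intro m n
      simp [sliceR, TensorProduct.map_add_right]
    have hadd' : ∀ m n : H →ₗ[k] H, mul2 (LinearMap.mulRight k Q.β) (m + n) D =
        mul2 (LinearMap.mulRight k Q.β) m D + mul2 (LinearMap.mulRight k Q.β) n D := by
      intro m n
      simp [mul2, TensorProduct.map_add_right]
    intro q T
    induction q using tensor2_induction with
    | add z z' h1 h2 =>
      rw [map_add, map_add, LinearMap.add_apply, map_add, hadd, h1, h2, map_add,
        LinearMap.comp_add, hadd']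
    | tmul x y =>
    induction T using tensor2_induction with
    | add z z' h1 h2 =>
      rw [map_add, map_add, hadd, h1, h2, map_add, conjHom_tmul, conjHom_tmul, conjHom_tmul,
        LinearMap.add_comp, LinearMap.comp_add, LinearMap.comp_add, hadd']
    | tmul m z =>
      have e : TensorProduct.lift (Q.dualRight.flip.compl₂ (LinearMap.mulLeft k Q.β ∘ₗ
          Q.S.toLinearMap)) (TensorProduct.homTensorHomMap (RingHom.id k) (Module.Dual k H) H
          (Module.Dual k H) H (TensorProduct.map Q.dualLeft (LinearMap.mul k H) (x ⊗ₜ y))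
            (m ⊗ₜ z)) = (m ∘ₗ LinearMap.mulLeft k (Q.S.symm x)) ∘ₗ
              LinearMap.mulRight k (Q.S (Q.β * Q.S (y * z))) := by
        ext w
        simp [dualLeft, dualRight, Module.Dual.transpose]
      have e' : ∀ D', sliceR (m ∘ₗ LinearMap.mulLeft k (Q.S.symm x))
          (D' * inL k H (Q.β * Q.S (y * z))) = mul2 (LinearMap.mulRight k Q.β)
            (Q.S.toLinearMap ∘ₗ Q.conjHom (dualTensorHom k H H (m ⊗ₜ z)) (x ⊗ₜ y)) D' := by
        intro D'
        induction D' using tensor2_induction with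
        | add z z' h1 h2 => simp only [map_add, add_mul, h1, h2]
        | tmul a b => simp [conjHom_tmul, mul_assoc]
      rw [e, sliceR_comp_mulRight, hD, e']
  have h2 : dualTensorHom k H H (Q.dualCoaction ψ) = sliceR ψ ∘ₗ Q.Δbar :=
    (dualTensorHomEquiv k H H).apply_symm_apply _
  have h3 : ∀ q D, mul2 (LinearMap.mulRight k Q.β)
      (Q.S.toLinearMap ∘ₗ Q.conjHom (sliceR ψ ∘ₗ Q.Δbar) q) D =
      sliceR ψ (Q.contrβ (in₂₃ k H (mul2 (LinearMap.mulRight k Q.V ∘ₗ (inL k H).toLinearMap)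
      (Q.Δ.toLinearMap ∘ₗ Q.S.symm.toLinearMap) (flip q)) * Q.idΔ D * in₂₃ k H Q.U)) := by
    intro q D
    induction D using tensor2_induction with
    | add z z' h1 h2 => simp only [map_add, mul_add, add_mul, h1, h2]
    | tmul a b =>
    induction q using tensor2_induction with
    | add z z' h1 h2 =>
      simp only [map_add, add_mul, ← h1, ← h2]
      simp [mul_add]
    | tmul x y =>
      rw [flip_tmul, mul2_tmul, mul2_tmul, idΔ_tmul, in₂₃_apply, in₂₃_apply,
        Algebra.TensorProduct.tmul_mul_tmul, Algebra.TensorProduct.tmul_mul_tmul, one_mul, mul_one,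
        sliceR_contrβ_tmul, conjHom_tmul]
      change a * Q.β * Q.S (y * sliceR ψ (Q.V * (Q.Δ (Q.S.symm x * b) * Q.U))) = a * Q.β * Q.S
        (sliceR ψ (inL k H y * Q.V * Q.Δ (Q.S.symm x) * Q.Δ b * Q.U))
      rw [mul_assoc (inL k H y), mul_assoc (inL k H y), mul_assoc (inL k H y), sliceR_inL_mul,
        map_mul Q.Δ]
      simp only [mul_assoc]
  rw [← inL_qR_mul_V_mul_Δ, ← h3, ← h2, ← h1]
  rfl

/-- A left cointegral `λ` satisfies `(id ⊗ λ)(V Δ(r) U) = λ(r) 1` for each right integral `r`. -/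
theorem sliceR_Δbar {lam : Module.Dual k H} (hlam : lam ∈ Q.leftCointegrals)
    {r : H} (hr : r ∈ Q.rightIntegrals) : sliceR lam (Q.Δbar r) = lam r • 1 := by
  obtain ⟨ψ, rfl⟩ := hlam
  have h1 := sliceR_E (Q := Q) ψ (Δbar_mul_inR hr)
  rw [contrβ_idΔ_Δbar hr] at h1
  set lam := Q.E Q.dualLeft Q.dualRight Q.dualCoaction ψ
  -- So `(id ⊗ λ)(V Δ(r) U)` is a scalar, which is determined by applying `ε`.
  obtain ⟨c, hc⟩ : ∃ c : k, sliceR lam (Q.Δbar r) = c • 1 :=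
    ⟨Q.ε Q.β * ψ (Q.counitL (Q.h * (Q.Δ r * Q.U))), by rw [h1]; simp [smul_smul]⟩
  have h2 : ∀ t, Q.ε (sliceR lam t) = lam (Q.counitL t) := by
    intro t
    induction t using tensor2_induction with
    | add z z' h1 h2 => simp only [map_add, h1, h2]
    | tmul x y => simp [mul_comm]
  have h3 := h2 (Q.Δbar r)
  have h4 : Q.Δbar r = Q.V * (Q.Δ r * Q.U) := rfl
  rw [hc, h4, map_mul Q.counitL, map_mul Q.counitL, counitL_V, counitL_U, counitL_Δ, one_mul, mul_one] at h3
  rw [hc, ← h3]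
  simp

end Finite

end QuasiHopfAlgebra

/-! ### Nondegenerate functionals and the Nakayama automorphism -/

section Frobenius

variable {k H : Type*} [Field k] [Ring H] [Algebra k H] {ω : Module.Dual k H}

/-- Every functional has the form `b ↦ ω(b c)`, by a dimension count. -/
theorem exists_eq_apply_mul [FiniteDimensional k H] (hω : ∀ c, (∀ b, ω (b * c) = 0) → c = 0)
    (ψ : Module.Dual k H) : ∃ c, ∀ b, ψ b = ω (b * c) := by
  let R : H →ₗ[k] Module.Dual k H := (LinearMap.mul k H).flip.compr₂ ω
  have hR : Function.Injective R := by
    rw [← LinearMap.ker_eq_bot, LinearMap.ker_eq_bot']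
    exact fun c hc => hω c fun b => LinearMap.congr_fun hc b
  obtain ⟨c, hc⟩ := (LinearMap.injective_iff_surjective_of_finrank_eq_finrank
    (Subspace.dual_finrank_eq (K := k) (V := H)).symm).1 hR ψ
  exact ⟨c, fun b => (LinearMap.congr_fun hc b).symm⟩

theorem eq_zero_of_apply_mul_left [FiniteDimensional k H] (hω : ∀ c, (∀ b, ω (b * c) = 0) → c = 0)
    {b : H} (h : ∀ c, ω (b * c) = 0) : b = 0 := by
  rw [← Module.forall_dual_apply_eq_zero_iff k]
  intro ψ
  obtain ⟨c, hc⟩ := exists_eq_apply_mul hω ψ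
  rw [hc, h]

theorem ext_apply_mul_right (hω : ∀ c, (∀ b, ω (b * c) = 0) → c = 0) {c c' : H}
    (h : ∀ b, ω (b * c) = ω (b * c')) : c = c' :=
  sub_eq_zero.1 (hω _ fun b => by rw [mul_sub, map_sub, h, sub_self])

theorem ext_apply_mul_left [FiniteDimensional k H] (hω : ∀ c, (∀ b, ω (b * c) = 0) → c = 0)
    {b b' : H} (h : ∀ c, ω (b * c) = ω (b' * c)) : b = b' :=
  sub_eq_zero.1 (eq_zero_of_apply_mul_left hω fun c => by rw [sub_mul, map_sub, h, sub_self])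

theorem exists_eq_apply_mul' [FiniteDimensional k H] (hω : ∀ c, (∀ b, ω (b * c) = 0) → c = 0)
    (ψ : Module.Dual k H) : ∃ c, ∀ b, ψ b = ω (c * b) := by
  let R : H →ₗ[k] Module.Dual k H := (LinearMap.mul k H).compr₂ ω
  have hR : Function.Injective R := by
    rw [← LinearMap.ker_eq_bot, LinearMap.ker_eq_bot']
    exact fun c hc => eq_zero_of_apply_mul_left hω fun b => LinearMap.congr_fun hc b
  obtain ⟨c, hc⟩ := (LinearMap.injective_iff_surjective_of_finrank_eq_finrank
    (Subspace.dual_finrank_eq (K := k) (V := H)).symm).1 hR ψ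
  exact ⟨c, fun b => (LinearMap.congr_fun hc b).symm⟩

/-- The Nakayama automorphism of a nondegenerate functional. -/
theorem exists_nakayama [FiniteDimensional k H] (hω : ∀ c, (∀ b, ω (b * c) = 0) → c = 0) :
    ∃ θ : H ≃ₐ[k] H, ∀ a b, ω (a * b) = ω (b * θ a) := by
  choose θ hθ using fun a => exists_eq_apply_mul hω (ω ∘ₗ LinearMap.mulLeft k a)
  simp only [LinearMap.comp_apply, LinearMap.mulLeft_apply] at hθ
  let θ' : H →ₐ[k] H := AlgHom.ofLinearMap
    { toFun := θ
      map_add' := fun x y => ext_apply_mul_right hω fun b => by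
        rw [← hθ (x + y) b, add_mul, mul_add, map_add, map_add, hθ x b, hθ y b]
      map_smul' := fun c x => ext_apply_mul_right hω fun b => by
        rw [← hθ, smul_mul_assoc, RingHom.id_apply, mul_smul_comm, map_smul, map_smul, hθ] }
    (ext_apply_mul_right hω fun b => by
      change ω (b * θ 1) = _
      rw [← hθ, one_mul, mul_one])
    (fun x y => ext_apply_mul_right hω fun b => by
      change ω (b * θ (x * y)) = ω (b * (θ x * θ y))
      rw [← hθ, mul_assoc, hθ, mul_assoc, hθ, mul_assoc])
  have hinj : Function.Injective θ' := by
    refine (injective_iff_map_eq_zero θ').2 fun a ha => eq_zero_of_apply_mul_left hω fun b => ?_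
    rw [hθ]
    change ω (b * θ' a) = 0
    rw [ha, mul_zero, map_zero]
  exact ⟨AlgEquiv.ofBijective θ' ⟨hinj, (LinearMap.injective_iff_surjective
    (f := θ'.toLinearMap)).1 hinj⟩, hθ⟩

end Frobenius

namespace QuasiHopfAlgebra

variable {k H : Type*} [Field k] [Ring H] [Algebra k H] [FiniteDimensional k H]
  {Q : QuasiHopfAlgebra k H} {lam : Module.Dual k H} {r : H}

/-! ### The dual bases attached to a cointegral and an integral -/

/-- `D¹ λ(D² S(a)) = λ(r) a` for `D = V Δ(r) U`. -/
theorem sliceR_Δbar_mul_inR (hlam : lam ∈ Q.leftCointegrals) (hr : r ∈ Q.rightIntegrals) (a : H) :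
    sliceR lam (Q.Δbar r * inR k H (Q.S a)) = lam r • a := by
  rw [Δbar_mul_inR hr, sliceR_mul_inL, sliceR_Δbar hlam hr, smul_mul_assoc, one_mul]

/-- A left cointegral which is `1` at some right integral is nondegenerate, because
`c` is recovered from the functional `b ↦ λ(b S(c))`. -/
theorem cointegral_nondegenerate (hlam : lam ∈ Q.leftCointegrals) (hr : r ∈ Q.rightIntegrals)
    (hlr : lam r = 1) (c : H) (hc : ∀ b, lam (b * c) = 0) : c = 0 := by
  obtain ⟨c, rfl⟩ := Q.S.surjective c
  have h := sliceR_Δbar_mul_inR hlam hr c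
  rw [hlr, one_smul, ← sliceR_comp_mulRight] at h
  have h0 : lam ∘ₗ LinearMap.mulRight k (Q.S c) = 0 := LinearMap.ext hc
  rw [h0] at h
  rw [← h]
  simp

/-- `λ(x S(D¹)) D² = λ(r) x` for `D = V Δ(r) U`. -/
theorem sliceL_Δbar (hlam : lam ∈ Q.leftCointegrals)
    (hω : ∀ c, (∀ b, lam (b * c) = 0) → c = 0) (hr : r ∈ Q.rightIntegrals) (x : H) :
    TensorProduct.lid k H (TensorProduct.map (lam ∘ₗ LinearMap.mulLeft k x ∘ₗ Q.S.toLinearMap)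
      LinearMap.id (Q.Δbar r)) = lam r • x := by
  refine ext_apply_mul_left hω fun c => ?_
  obtain ⟨c, rfl⟩ := Q.S.surjective c
  have h : ∀ t : H ⊗[k] H, lam (TensorProduct.lid k H (TensorProduct.map
      (lam ∘ₗ LinearMap.mulLeft k x ∘ₗ Q.S.toLinearMap) LinearMap.id t) * Q.S c) =
      lam (x * Q.S (sliceR lam (t * inR k H (Q.S c)))) := by
    intro t
    induction t using tensor2_induction with
    | add z z' h1 h2 => simp only [map_add, add_mul, mul_add, h1, h2]
    | tmul x y => simp [mul_comm]
  rw [h, sliceR_Δbar_mul_inR hlam hr]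
  simp

/-- The space of right integrals is spanned by `r`. -/
theorem rightIntegral_eq_smul (hlam : lam ∈ Q.leftCointegrals)
    (hω : ∀ c, (∀ b, lam (b * c) = 0) → c = 0) (hr : r ∈ Q.rightIntegrals) (hlr : lam r = 1)
    {r' : H} (hr' : r' ∈ Q.rightIntegrals) : r' = lam r' • r := by
  -- Choose `x` with `λ(x S(y)) = ε(y)`; then `λ(x S(D¹)) D² = (ε ⊗ id)(D)`.
  obtain ⟨x, hx⟩ := exists_eq_apply_mul' hω (Q.ε.toLinearMap ∘ₗ Q.S.symm.toLinearMap)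
  have hx' : lam ∘ₗ LinearMap.mulLeft k x ∘ₗ Q.S.toLinearMap = Q.ε.toLinearMap := by
    ext y
    simpa using (hx (Q.S y)).symm
  have h : ∀ {s}, s ∈ Q.rightIntegrals → s = lam s • x := by
    intro s hs
    rw [← sliceL_Δbar hlam hω hs, hx']
    change s = Q.counitL (Q.V * (Q.Δ s * Q.U))
    rw [map_mul, map_mul, counitL_V, counitL_Δ, counitL_U, one_mul, mul_one]
  have h1 := h hr
  rw [hlr, one_smul] at h1
  rw [h1]
  exact h hr'

/-- `λ(S⁻¹(z)) = λ(u z)`, where `u` is the comodulus. -/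
theorem apply_S_symm (hlam : lam ∈ Q.leftCointegrals)
    (hω : ∀ c, (∀ b, lam (b * c) = 0) → c = 0) (hr : r ∈ Q.rightIntegrals) (hlr : lam r = 1)
    (z : H) : lam (Q.S.symm z) = lam (Q.comodulus lam r * z) := by
  obtain ⟨u, hu⟩ := exists_eq_apply_mul' hω (lam ∘ₗ Q.S.symm.toLinearMap)
  have hu' : lam ∘ₗ LinearMap.mulLeft k u ∘ₗ Q.S.toLinearMap = lam := by
    ext y
    simpa using (hu (Q.S y)).symm
  have h := sliceL_Δbar hlam hω hr u
  rw [hu', hlr, one_smul] at h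
  rw [comodulus, h]
  exact hu z

theorem isUnit_comodulus (hlam : lam ∈ Q.leftCointegrals)
    (hω : ∀ c, (∀ b, lam (b * c) = 0) → c = 0) (hr : r ∈ Q.rightIntegrals) (hlr : lam r = 1) :
    IsUnit (Q.comodulus lam r) := by
  have hinj : Function.Injective (LinearMap.mulLeft k (Q.comodulus lam r)) := by
    rw [← LinearMap.ker_eq_bot, LinearMap.ker_eq_bot']
    intro z hz
    rw [LinearMap.mulLeft_apply] at hz
    refine Q.S.symm.map_eq_zero_iff.1 (hω _ fun b => ?_)
    obtain ⟨b, rfl⟩ := Q.S.symm.surjective b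
    rw [← S_symm_mul, apply_S_symm hlam hω hr hlr, ← mul_assoc, hz, zero_mul, map_zero]
  obtain ⟨w, hw⟩ := LinearMap.injective_iff_surjective.1 hinj 1
  have : IsArtinianRing H := IsArtinianRing.of_finite k _
  exact IsUnit.of_mul_eq_one _ hw

/-- With `u` the comodulus and `θ` the Nakayama automorphism of `λ`,
`u⁻¹ θ⁻¹(S(a)) u = S(θ(a))`. -/
theorem comodulus_conj (hlam : lam ∈ Q.leftCointegrals)
    (hω : ∀ c, (∀ b, lam (b * c) = 0) → c = 0) (hr : r ∈ Q.rightIntegrals) (hlr : lam r = 1)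
    {θ : H ≃ₐ[k] H} (hθ : ∀ a b, lam (a * b) = lam (b * θ a)) (a : H) :
    θ.symm (Q.S a) * Q.comodulus lam r = Q.comodulus lam r * Q.S (θ a) := by
  have hS : ∀ y, lam y = lam (Q.comodulus lam r * Q.S y) := by
    intro y
    rw [← apply_S_symm hlam hω hr hlr, LinearEquiv.symm_apply_apply]
  apply θ.injective
  rw [map_mul, map_mul, AlgEquiv.apply_symm_apply]
  refine ext_apply_mul_right hω fun b => ?_
  obtain ⟨b, rfl⟩ := Q.S.surjective b
  rw [← map_mul, ← hθ, ← mul_assoc, ← hθ, ← mul_assoc, mul_assoc _ (Q.S b), ← Q.S_mul, ← hS,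
    mul_assoc, ← Q.S_mul, ← hS, hθ]

/-- Since `a r` is a right integral, `a r = λ(a r) r = ε(θ(a)) r`; by `comodulus_conj` the scalar is
`ε(θ⁻¹(S(a))) = μ(S(a))`. -/
theorem mul_rightIntegral (hlam : lam ∈ Q.leftCointegrals)
    (hω : ∀ c, (∀ b, lam (b * c) = 0) → c = 0) (hr : r ∈ Q.rightIntegrals) (hlr : lam r = 1)
    {θ : H ≃ₐ[k] H} (hθ : ∀ a b, lam (a * b) = lam (b * θ a)) (a : H) :
    a * r = Q.ε (θ.symm (Q.S a)) • r := by
  have h1 : a * r ∈ Q.rightIntegrals := fun b => by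
    rw [mul_assoc, rightIntegral_mul hr, mul_smul_comm]
  have h2 := congrArg Q.ε (comodulus_conj hlam hω hr hlr hθ a)
  rw [map_mul, map_mul, mul_comm, ε_S] at h2
  have h3 := mul_left_cancel₀ ((isUnit_comodulus hlam hω hr hlr).map Q.ε).ne_zero h2
  rw [h3, rightIntegral_eq_smul hlam hω hr hlr h1, hθ, rightIntegral_mul hr, map_smul, hlr]
  simp

/-- `a ↼ μ = S⁻¹ θ S⁻¹(a)`: both sides are `(id ⊗ λ)((1 ⊗ S⁻¹(a)) D)` with `D = V Δ(r) U`. -/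
theorem hitRight_modulus (hlam : lam ∈ Q.leftCointegrals)
    (hω : ∀ c, (∀ b, lam (b * c) = 0) → c = 0) (hr : r ∈ Q.rightIntegrals) (hlr : lam r = 1)
    {θ : H ≃ₐ[k] H} (hθ : ∀ a b, lam (a * b) = lam (b * θ a)) {μ : H →ₐ[k] k}
    (hμ : ∀ a, μ a = Q.ε (θ.symm a)) (a : H) :
    Q.hitRight μ.toLinearMap a = Q.S.symm (θ (Q.S.symm a)) := by
  have h1 : ∀ t : H ⊗[k] H, mul2 (LinearMap.mulRight k Q.V ∘ₗ (inL k H).toLinearMap)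
      (Q.Δ.toLinearMap ∘ₗ Q.S.symm.toLinearMap) (flip t) * (Q.Δ r * Q.U) =
      inL k H (TensorProduct.lid k H (TensorProduct.map μ.toLinearMap LinearMap.id t)) *
        Q.Δbar r := by
    intro t
    induction t using tensor2_induction with
    | add z z' h1 h2 => simp only [map_add, add_mul, h1, h2]
    | tmul x y =>
      have h := mul_rightIntegral hlam hω hr hlr hθ (Q.S.symm x)
      rw [LinearEquiv.apply_symm_apply, ← hμ] at h
      have h' := congrArg Q.Δ h
      rw [map_mul, map_smul] at h'
      simp only [flip_tmul, mul2_tmul, LinearMap.comp_apply, LinearMap.mulRight_apply,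
        AlgHom.toLinearMap_apply, LinearEquiv.coe_coe]
      rw [mul_assoc, ← mul_assoc (Q.Δ _) (Q.Δ r), h', smul_mul_assoc, mul_smul_comm]
      simp [Δbar, mul_assoc]
  have h2 := h1 (Q.Δ a)
  rw [inL_mul_V_mul_Δ, mul_assoc] at h2
  have h3 := congrArg (sliceR lam) h2
  rw [sliceR_inL_mul, sliceR_Δbar hlam hr, hlr, one_smul, mul_one] at h3
  have h4 : ∀ (b : H) (D : H ⊗[k] H),
      sliceR lam (inR k H b * D) = sliceR lam (D * inR k H (θ b)) := by
    intro b D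
    induction D using tensor2_induction with
    | add z z' h1 h2 => simp only [map_add, mul_add, add_mul, h1, h2]
    | tmul x y => simp [hθ b y]
  have h5 : Q.V * (Q.Δ r * Q.U) = Q.Δbar r := rfl
  rw [h5, h4, ← LinearEquiv.apply_symm_apply Q.S (θ _), sliceR_Δbar_mul_inR hlam hr, hlr,
    one_smul] at h3
  exact h3.symm

/-- `λ(S(a)) = λ(a S⁻¹(u⁻¹))`, hence `v = D¹ λ(D² S⁻¹(u⁻¹)) = S⁻²(u⁻¹)`. -/
theorem S_S_comodulusAux (hlam : lam ∈ Q.leftCointegrals)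
    (hω : ∀ c, (∀ b, lam (b * c) = 0) → c = 0) (hr : r ∈ Q.rightIntegrals) (hlr : lam r = 1)
    {w : H} (hw : Q.comodulus lam r * w = 1) : Q.S (Q.S (Q.comodulusAux lam r)) = w := by
  have h1 : lam ∘ₗ Q.S.toLinearMap = lam ∘ₗ LinearMap.mulRight k (Q.S.symm w) := by
    ext a
    have h := apply_S_symm hlam hω hr hlr (w * Q.S a)
    rw [← mul_assoc, hw, one_mul, S_symm_mul, LinearEquiv.symm_apply_apply] at h
    exact h.symm
  have h2 : Q.comodulusAux lam r = Q.S.symm (Q.S.symm w) := by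
    have h3 := sliceR_Δbar_mul_inR hlam hr (Q.S.symm (Q.S.symm w))
    rw [LinearEquiv.apply_symm_apply, ← sliceR_comp_mulRight, hlr, one_smul] at h3
    rw [← h3, ← h1]
    rfl
  rw [h2, LinearEquiv.apply_symm_apply, LinearEquiv.apply_symm_apply]

end QuasiHopfAlgebra

end

theorem proposition6p2 {k H : Type*} [Field k] [Ring H] [Algebra k H] [FiniteDimensional k H]
    (Q : QuasiHopfAlgebra k H)
    (μ : H →ₐ[k] k) (hμ : Q.IsModulus μ)
    (lam : Module.Dual k H) (hlam : lam ∈ Q.leftCointegrals)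
    (r : H) (hr : r ∈ Q.rightIntegrals) (hlr : lam r = 1) :
    ∃ (u : Hˣ) (T : H ≃ₗ[k] H),
      (u : H) = Q.comodulus lam r ∧
      T.toLinearMap = Q.Smod μ ∧
      ((u⁻¹ : Hˣ) : H) = Q.S (Q.S (Q.comodulusAux lam r)) ∧
      ((u⁻¹ : Hˣ) : H) = T.symm (T.symm (Q.comodulusAux lam r)) ∧
      ∀ a : H, ((u⁻¹ : Hˣ) : H) * a * (u : H) = Q.S (Q.S (Q.Smod μ (Q.Smod μ a))) := by
  have hω := QuasiHopfAlgebra.cointegral_nondegenerate hlam hr hlr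
  obtain ⟨θ, hθ⟩ := exists_nakayama hω
  have hμ' := hμ lam θ ⟨fun b h => eq_zero_of_apply_mul_left hω h, fun c h => hω c h⟩ hθ
  obtain ⟨u, hu⟩ := QuasiHopfAlgebra.isUnit_comodulus hlam hω hr hlr
  have hT : (θ.toLinearEquiv.trans Q.S.symm).toLinearMap = Q.Smod μ := by
    ext a
    change Q.S.symm (θ a) = Q.hitRight μ.toLinearMap (Q.S a)
    rw [QuasiHopfAlgebra.hitRight_modulus hlam hω hr hlr hθ hμ', LinearEquiv.symm_apply_apply]
  have hv : Q.S (Q.S (Q.comodulusAux lam r)) = ((u⁻¹ : Hˣ) : H) :=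
    QuasiHopfAlgebra.S_S_comodulusAux hlam hω hr hlr (by rw [← hu, Units.mul_inv])
  have hconj : ∀ a : H, ((u⁻¹ : Hˣ) : H) * a * (u : H) = Q.S (θ (Q.S.symm (θ a))) := by
    intro a
    have h := QuasiHopfAlgebra.comodulus_conj hlam hω hr hlr hθ (Q.S.symm (θ a))
    rw [LinearEquiv.apply_symm_apply, AlgEquiv.symm_apply_apply, ← hu] at h
    rw [mul_assoc, h, Units.inv_mul_cancel_left]
  refine ⟨u, θ.toLinearEquiv.trans Q.S.symm, hu, hT, hv.symm, ?_, fun a => ?_⟩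
  · rw [LinearEquiv.eq_symm_apply, LinearEquiv.eq_symm_apply]
    apply Q.S.injective
    apply Q.S.injective
    change Q.S (Q.S (Q.S.symm (θ (Q.S.symm (θ _))))) = _
    rw [LinearEquiv.apply_symm_apply, ← hconj, Units.inv_mul_cancel_right, hv]
  · rw [hconj, ← hT]
    change _ = Q.S (Q.S (Q.S.symm (θ (Q.S.symm (θ a)))))
    rw [LinearEquiv.apply_symm_apply]
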